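/- A complex algebraic prevariety is a reduced scheme of finite type over $\mathbb{C}$ (not necessarily separated or irreducible); "point" means closed point (equivalently $\mathbb{C}$-valued point), and the set of points carries the Zariski topology. A curve in a prevariety $X$ is a closed algebraic subset of pure dimension $1$ (not necessarily irreducible). Let $p\colon X\to Y$ be a morphism of complex algebraic prevarieties. (a) A local curve in $x\in X$ is a holomorphic map germ $\gamma\colon(\mathbb{C},0)\to(X',x)$, where $X'$ is a curve in $X$ through $x$. A local curve $\tilde\gamma\colon(\mathbb{C},0)\to(X',x)$ in $X$ is a weak $p$-lifting of a local curve $\gamma\colon(\mathbb{C},0)\to(Y',y)$ in $Y$ if $p$ induces a map germ $(X',x)\to(Y',y)$ and there is a non-constant holomorphic map germ $\alpha\colon(\mathbb{C},0)\to(\mathbb{C},0)$ with $p\circ\tilde\gamma=\gamma\circ\alpha$. The morphism $p$ is weakly proper if every local curve in $Y$ admits a weak $p$-lifting. (b) The morphism $p$ has the curve covering property if for every irreducible curve $Y'\subset Y$ and every $y\in Y'$ there is an irreducible curve $X'\subset X$ such that $y\in p(X')\subset Y'$ and $p(X')$ is dense in $Y'$. It has the universal curve covering property if for every morphism of prevarieties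 $Z\to Y$ the base change $X\times_Y Z\to Z$ (fibre product in the category of prevarieties) has the curve covering property. (c) The morphism $p$ is submersive if it is surjective and $Y$ carries the quotient topology with respect to $p$ (for the Zariski topologies). It is universally submersive if for every morphism of prevarieties $Z\to Y$ the base change $X\times_Y Z\to Z$ is submersive. Proposition. Let $p\colon X\to Y$ be a surjective morphism of complex algebraic prevarieties. Then the following conditions are equivalent: (i) $p$ is weakly proper; (ii) $p$ has the universal curve covering property; (iii) $p$ is universally submersive. -/

import Mathlib

open CategoryTheory AlgebraicGeometry Topology Filter

noncomputable section

/-- The property of a scheme over `ℂ` of being a complex algebraic prevariety: reduced and of finite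
type over `ℂ`. Neither separatedness nor irreducibility is required. -/
def isComplexPrevariety : ObjectProperty (Over (Spec (.of ℂ))) := fun X =>
  IsReduced X.left ∧ LocallyOfFiniteType X.hom ∧ QuasiCompact X.hom

/-- The category of complex algebraic prevarieties: the full subcategory of `ℂ`-schemes on the
reduced schemes of finite type over `ℂ`. -/
abbrev ComplexPrevariety : Type 1 := isComplexPrevariety.FullSubcategory

namespace ComplexPrevariety

/-- The points of a prevariety in the classical sense, i.e. its `ℂ`-valued points (these correspond
bijectively to the closed points of the scheme). -/
def Points (X : ComplexPrevariety) : Type := Over.mk (𝟙 (Spec (.of ℂ))) ⟶ X.obj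

/-- The closed point of the underlying scheme given by a `ℂ`-valued point. -/
def Points.pt {X : ComplexPrevariety} (x : X.Points) : X.obj.left :=
  x.left (IsLocalRing.closedPoint ℂ)

/-- The Zariski topology on the set of (classical) points. -/
instance (X : ComplexPrevariety) : TopologicalSpace X.Points :=
  TopologicalSpace.induced Points.pt inferInstance

/-- The map on points induced by a morphism of prevarieties. -/
def mapPoints {X Y : ComplexPrevariety} (p : X ⟶ Y) (x : X.Points) : Y.Points := x ≫ p.hom

theorem Points.top_le_preimage {X : ComplexPrevariety} (x : X.Points) {U : X.obj.left.Opens}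
    (h : x.pt ∈ U) : (⊤ : Scheme.Opens (Spec (.of ℂ))) ≤ x.left ⁻¹ᵁ U := fun z _ => by
  have hz : z = IsLocalRing.closedPoint ℂ := Subsingleton.elim (α := PrimeSpectrum ℂ) _ _
  subst hz
  exact h

open Classical in
/-- The value in `ℂ` of a regular function `f` on `U` at a point `x` of `U`, i.e. the pullback of
`f` along `x : Spec ℂ ⟶ X` (and `0` if `x` does not lie in `U`). -/
def value {X : ComplexPrevariety} {U : X.obj.left.Opens} (f : Γ(X.obj.left, U)) (x : X.Points) :
    ℂ :=
  if h : x.pt ∈ U then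
    (Scheme.ΓSpecIso (.of ℂ)).hom (x.left.appLE U ⊤ (x.top_le_preimage h) f)
  else 0

/-- A curve in a prevariety: a closed algebraic subset of pure dimension `1`. -/
def IsCurve {X : ComplexPrevariety} (C : Set X.Points) : Prop :=
  IsClosed C ∧ ∀ Z ∈ irreducibleComponents C, topologicalKrullDim Z = 1

/-- An irreducible curve in a prevariety. -/
def IsIrreducibleCurve {X : ComplexPrevariety} (C : Set X.Points) : Prop :=
  IsCurve C ∧ IsIrreducible C

/-- `γ` represents a germ at `0` of a holomorphic map from `ℂ` to `X`: for every Zariski open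
neighbourhood `U` of `γ 0` the point `γ t` lies in `U` for all small `t`, and `f ∘ γ` is holomorphic
near `0` for every regular function `f` on `U`. -/
def IsHolomorphicGerm {X : ComplexPrevariety} (γ : ℂ → X.Points) : Prop :=
  ∀ U : X.obj.left.Opens, (γ 0).pt ∈ U →
    (∀ᶠ t in 𝓝 (0 : ℂ), (γ t).pt ∈ U) ∧
    ∀ f : Γ(X.obj.left, U), AnalyticAt ℂ (fun t => value f (γ t)) 0

/-- `γ` represents a local curve in the point `γ 0`, that is, a holomorphic map germ from `(ℂ, 0)`
to `(C, γ 0)` where `C` is an algebraic curve in `X` through `γ 0`. -/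
def IsLocalCurve {X : ComplexPrevariety} (C : Set X.Points) (γ : ℂ → X.Points) : Prop :=
  IsCurve C ∧ IsHolomorphicGerm γ ∧ ∀ᶠ t in 𝓝 (0 : ℂ), γ t ∈ C

/-- The local curve `γ'`, a germ of a map to the curve `C'` in `X`, is a weak `p`-lifting of the
local curve `γ`, a germ of a map to the curve `C` in `Y`: the morphism `p` induces a map germ
`(C', γ' 0) → (C, γ 0)`, and there is a non-constant holomorphic map germ `α : (ℂ, 0) → (ℂ, 0)` with
`p ∘ γ' = γ ∘ α` as germs. -/
def IsWeakLifting {X Y : ComplexPrevariety} (p : X ⟶ Y) (C' : Set X.Points) (γ' : ℂ → X.Points)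
    (C : Set Y.Points) (γ : ℂ → Y.Points) : Prop :=
  (∀ᶠ x in 𝓝[C'] (γ' 0), mapPoints p x ∈ C) ∧
  ∃ α : ℂ → ℂ, AnalyticAt ℂ α 0 ∧ α 0 = 0 ∧ (¬ ∀ᶠ t in 𝓝 (0 : ℂ), α t = 0) ∧
    ∀ᶠ t in 𝓝 (0 : ℂ), mapPoints p (γ' t) = γ (α t)

/-- A morphism `p : X ⟶ Y` is weakly proper if every local curve in `Y` admits a weak
`p`-lifting. -/
def WeaklyProper : MorphismProperty ComplexPrevariety := fun X Y p =>
  ∀ (C : Set Y.Points) (γ : ℂ → Y.Points), IsLocalCurve C γ →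
    ∃ (C' : Set X.Points) (γ' : ℂ → X.Points), IsLocalCurve C' γ' ∧ IsWeakLifting p C' γ' C γ

/-- The curve covering property. -/
def CurveCovering : MorphismProperty ComplexPrevariety := fun X Y p =>
  ∀ C : Set Y.Points, IsIrreducibleCurve C → ∀ y ∈ C,
    ∃ C' : Set X.Points, IsIrreducibleCurve C' ∧
      y ∈ mapPoints p '' C' ∧ mapPoints p '' C' ⊆ C ∧ C ⊆ closure (mapPoints p '' C')

/-- A morphism `p : X ⟶ Y` is submersive if it is surjective and `Y` carries the quotient topology
with respect to `p`. -/
def Submersive : MorphismProperty ComplexPrevariety := fun _ _ p => IsQuotientMap (mapPoints p)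

end ComplexPrevariety

end

/-! Points of an affine prevariety are algebra maps `A →ₐ[ℂ] ℂ`, and holomorphic germs in it are
algebra maps `A →ₐ[ℂ] HolGerm` into the discrete valuation ring of germs at the origin. All analysis
thus becomes algebra in `HolGerm` plus one use of the implicit function theorem.

Weakly proper implies curve covering after base change. An irreducible curve `C` in the base has a
branch at each point (`IsIrreducibleCurve.exists_branch`), obtained by parametrizing a smooth model
of `C`. The image of this branch in `Y` has a weak lifting; if `C` is contracted to a point,
surjectivity of `p` supplies a constant one. The lifting and the reparametrized branch together
generate a finitely generated subalgebra of `HolGerm`, hence an affine variety mapping to the fibre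
product. A curve through its base point, outside the fibre over the given point of `C`, covers `C`
(`exists_covering_curve_of_germ`).

Universal curve covering implies weakly proper. A non-constant germ in a curve factors through a
curve smooth at the centre of the germ. Base change to that curve, cover it, and take a branch of
the covering curve. The given germ and the image of the branch have the same smooth centre. After
substitutions the uniformizer takes the same value on both (`HolGerm.exists_comp_eq_comp`), and this
value determines the germ (`IsUniformizer.algHom_ext`); so the branch is a weak lifting.

Curve covering implies submersive for surjective maps. Let `F` have closed preimage and let `y` lie
in the closure of `F`. By Chevalley some irreducible closed part of the preimage has an image
containing a nonempty open subset of its closure, a closure which contains `y`. A curve through `y`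
meeting this open set is covered by a curve of the source, and that curve lies generically, hence
entirely, in the preimage of `F`.

Universally submersive implies curve covering. After base change to a chart of the curve around `y`,
the point `y` is not open, so the preimage of its complement is not closed. A curve in the fibre
product joining a missing limit point to that preimage covers the given curve. Universal
submersiveness is itself stable under base change, so this gives the universal statement. -/

noncomputable section

namespace ComplexPrevariety

/-! ### Affine prevarieties and their points as algebra homomorphisms to `ℂ`. -/

section Affine

variable (A : Type) [CommRing A] [Algebra ℂ A]

/-- The affine prevariety attached to a reduced finitely generated `ℂ`-algebra. -/
def affine [Algebra.FiniteType ℂ A] [IsReduced A] : ComplexPrevariety :=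
  ⟨Over.mk (Spec.map (CommRingCat.ofHom (algebraMap ℂ A))), by
    refine ⟨?_, ?_, ?_⟩
    · change IsReduced (Spec (.of A))
      infer_instance
    · change LocallyOfFiniteType (Spec.map (CommRingCat.ofHom (algebraMap ℂ A)))
      rw [HasRingHomProperty.Spec_iff (P := @LocallyOfFiniteType)]
      exact RingHom.finiteType_algebraMap.mpr inferInstance
    · change QuasiCompact (Spec.map (CommRingCat.ofHom (algebraMap ℂ A)))
      infer_instance⟩

/-- The one-point prevariety. -/
def pointObj : ComplexPrevariety :=
  ⟨Over.mk (𝟙 (Spec (.of ℂ))), by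
    refine ⟨?_, ?_, ?_⟩
    · change IsReduced (Spec (.of ℂ))
      infer_instance
    · change LocallyOfFiniteType (𝟙 (Spec (.of ℂ)))
      infer_instance
    · change QuasiCompact (𝟙 (Spec (.of ℂ)))
      infer_instance⟩

/-- A point as a morphism from the one-point prevariety. -/
def Points.toHom {X : ComplexPrevariety} (x : X.Points) : pointObj ⟶ X := ObjectProperty.homMk x

/-- A morphism from the one-point prevariety as a point. -/
def Points.ofHom {X : ComplexPrevariety} (f : pointObj ⟶ X) : X.Points := f.hom

theorem mapPoints_ofHom {X Y : ComplexPrevariety} (f : pointObj ⟶ X) (g : X ⟶ Y) :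
    mapPoints g (Points.ofHom f) = Points.ofHom (f ≫ g) := rfl

theorem Points.ofHom_toHom {X : ComplexPrevariety} (x : X.Points) : Points.ofHom x.toHom = x := rfl

theorem mapPoints_comp {X Y Z : ComplexPrevariety} (f : X ⟶ Y) (g : Y ⟶ Z) (x : X.Points) :
    mapPoints (f ≫ g) x = mapPoints g (mapPoints f x) :=
  (Category.assoc (obj := Over (Spec (.of ℂ))) x f.hom g.hom).symm

theorem mapPoints_id {X : ComplexPrevariety} (x : X.Points) : mapPoints (𝟙 X) x = x :=
  Category.comp_id (obj := Over (Spec (.of ℂ))) x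

theorem pt_mapPoints {X Y : ComplexPrevariety} (f : X ⟶ Y) (x : X.Points) :
    (mapPoints f x).pt = f.hom.left x.pt := rfl

theorem continuous_mapPoints {X Y : ComplexPrevariety} (f : X ⟶ Y) :
    Continuous (mapPoints f) := by
  rw [continuous_induced_rng]
  exact f.hom.left.continuous.comp continuous_induced_dom

variable {A} {B C : Type} [CommRing B] [Algebra ℂ B] [CommRing C] [Algebra ℂ C]
  [Algebra.FiniteType ℂ A] [IsReduced A] [Algebra.FiniteType ℂ B] [IsReduced B]
  [Algebra.FiniteType ℂ C] [IsReduced C]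

/-- The morphism of affine prevarieties given by an algebra homomorphism. -/
def affineMap (f : A →ₐ[ℂ] B) : affine B ⟶ affine A :=
  ObjectProperty.homMk (Over.homMk (Spec.map (CommRingCat.ofHom (f : A →+* B))) (by
    change Spec.map _ ≫ Spec.map _ = Spec.map _
    rw [← Spec.map_comp, ← CommRingCat.ofHom_comp]
    congr 2
    exact f.comp_algebraMap))

theorem affineMap_surjective (g : affine B ⟶ affine A) : ∃ f : A →ₐ[ℂ] B, affineMap f = g := by
  have h : g.hom.left ≫ Spec.map (CommRingCat.ofHom (algebraMap ℂ A)) =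
    Spec.map (CommRingCat.ofHom (algebraMap ℂ B)) := Over.w g.hom
  let φ : CommRingCat.of A ⟶ CommRingCat.of B := Spec.preimage g.hom.left
  have hφ : Spec.map φ = g.hom.left := Spec.map_preimage _
  rw [← hφ] at h
  have h2 := Spec.map_injective ((Spec.map_comp _ _).trans h)
  refine ⟨{ φ.hom with commutes' := fun r => ?_ }, ?_⟩
  · exact congr($(h2).hom r)
  · apply ObjectProperty.hom_ext
    apply Over.OverMorphism.ext
    exact hφ

theorem affineMap_comp (f : A →ₐ[ℂ] B) (g : B →ₐ[ℂ] C) :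
    affineMap (g.comp f) = affineMap g ≫ affineMap f := by
  apply ObjectProperty.hom_ext
  apply Over.OverMorphism.ext
  exact Spec.map_comp (CommRingCat.ofHom (f : A →+* B)) (CommRingCat.ofHom (g : B →+* C))

/-- The point of an affine prevariety given by an algebra homomorphism to `ℂ`. -/
def ofAlgHom (φ : A →ₐ[ℂ] ℂ) : (affine A).Points :=
  Over.homMk (Spec.map (CommRingCat.ofHom (φ : A →+* ℂ))) (by
    change Spec.map _ ≫ Spec.map _ = 𝟙 _
    rw [← Spec.map_comp, ← CommRingCat.ofHom_comp, φ.comp_algebraMap]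
    exact Spec.map_id _)

theorem ofAlgHom_surjective (x : (affine A).Points) : ∃ φ : A →ₐ[ℂ] ℂ, ofAlgHom φ = x := by
  have h : x.left ≫ Spec.map (CommRingCat.ofHom (algebraMap ℂ A)) =
    𝟙 (Spec (.of ℂ)) := Over.w x
  let φ : CommRingCat.of A ⟶ CommRingCat.of ℂ := Spec.preimage x.left
  have hφ : Spec.map φ = x.left := Spec.map_preimage _
  rw [← hφ] at h
  have h2 := Spec.map_injective ((Spec.map_comp _ _).trans (h.trans (Spec.map_id _).symm))
  refine ⟨{ φ.hom with commutes' := fun r => ?_ }, ?_⟩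
  · exact congr($(h2).hom r)
  · apply Over.OverMorphism.ext
    exact hφ

theorem ofAlgHom_injective : Function.Injective (ofAlgHom (A := A)) := by
  intro φ ψ h
  have h2 : Spec.map (CommRingCat.ofHom (φ : A →+* ℂ)) = Spec.map (CommRingCat.ofHom (ψ : A →+* ℂ)) :=
    congr(($h).left)
  have h3 := Spec.map_injective h2
  ext a
  exact congr($(h3).hom a)

/-- Points of an affine prevariety as algebra homomorphisms. -/
def evalPt (x : (affine A).Points) : A →ₐ[ℂ] ℂ := (ofAlgHom_surjective x).choose

@[simp] theorem ofAlgHom_evalPt (x : (affine A).Points) : ofAlgHom (evalPt x) = x :=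
  (ofAlgHom_surjective x).choose_spec

@[simp] theorem evalPt_ofAlgHom (φ : A →ₐ[ℂ] ℂ) : evalPt (ofAlgHom φ) = φ :=
  ofAlgHom_injective (ofAlgHom_evalPt _)

theorem mapPoints_affineMap (f : A →ₐ[ℂ] B) (φ : B →ₐ[ℂ] ℂ) :
    mapPoints (affineMap f) (ofAlgHom φ) = ofAlgHom (φ.comp f) := by
  apply Over.OverMorphism.ext
  exact (Spec.map_comp (CommRingCat.ofHom (f : A →+* B)) (CommRingCat.ofHom (φ : B →+* ℂ))).symm

theorem evalPt_mapPoints (f : A →ₐ[ℂ] B) (x : (affine B).Points) :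
    evalPt (mapPoints (affineMap f) x) = (evalPt x).comp f := by
  conv_lhs => rw [← ofAlgHom_evalPt x, mapPoints_affineMap, evalPt_ofAlgHom]

theorem evalPt_injective : Function.Injective (evalPt (A := A)) := fun x y h => by
  rw [← ofAlgHom_evalPt x, h, ofAlgHom_evalPt]

theorem pt_ofAlgHom_mem_basicOpen (φ : A →ₐ[ℂ] ℂ) (a : A) :
    ((ofAlgHom φ).pt : PrimeSpectrum A) ∈ PrimeSpectrum.basicOpen a ↔ φ a ≠ 0 := by
  change ¬ (φ a ∈ IsLocalRing.maximalIdeal ℂ) ↔ _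
  rw [IsLocalRing.mem_maximalIdeal, mem_nonunits_iff, not_not, isUnit_iff_ne_zero]

/-- The basic open subset of an affine prevariety. -/
def basicOpen (a : A) : Set (affine A).Points := {x | evalPt x a ≠ 0}

theorem mem_basicOpen (x : (affine A).Points) (a : A) : x ∈ basicOpen a ↔ evalPt x a ≠ 0 := Iff.rfl

theorem pt_mem_basicOpen (x : (affine A).Points) (a : A) :
    (x.pt : PrimeSpectrum A) ∈ PrimeSpectrum.basicOpen a ↔ evalPt x a ≠ 0 := by
  rw [← pt_ofAlgHom_mem_basicOpen, ofAlgHom_evalPt]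

theorem isOpen_basicOpen (a : A) : IsOpen (basicOpen a) := by
  refine ⟨(PrimeSpectrum.basicOpen a : Set (PrimeSpectrum A)),
    (PrimeSpectrum.basicOpen a).isOpen, ?_⟩
  ext x
  exact pt_mem_basicOpen x a

theorem exists_basicOpen_subset {U : Set (affine A).Points} (hU : IsOpen U) {x : (affine A).Points}
    (hx : x ∈ U) : ∃ a : A, x ∈ basicOpen a ∧ basicOpen a ⊆ U := by
  obtain ⟨V, hV, rfl⟩ := hU
  obtain ⟨_, ⟨a, rfl⟩, h1, h2⟩ :=
    (PrimeSpectrum.isTopologicalBasis_basic_opens (R := A)).exists_subset_of_mem_open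
      (a := x.pt) hx hV
  refine ⟨a, (pt_mem_basicOpen x a).1 h1, fun y hy => h2 ((pt_mem_basicOpen y a).2 hy)⟩

end Affine

/-! ### The space of classical points, and affine charts. -/

section Charts

variable {X Y : ComplexPrevariety}

instance : IsReduced X.obj.left := X.property.1
instance : LocallyOfFiniteType X.obj.hom := X.property.2.1
instance : QuasiCompact X.obj.hom := X.property.2.2

theorem Points.over_w (x : X.Points) : x.left ≫ X.obj.hom = 𝟙 (Spec (.of ℂ)) := Over.w x

theorem pt_injective : Function.Injective (Points.pt (X := X)) := by
  intro x y h
  apply Over.OverMorphism.ext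
  exact ext_of_apply_closedPoint_eq X.obj.hom x.over_w y.over_w h

theorem isEmbedding_pt : IsEmbedding (Points.pt (X := X)) := ⟨⟨rfl⟩, pt_injective⟩

theorem isClosed_pt (x : X.Points) : IsClosed {x.pt} :=
  (pointEquivClosedPoint X.obj.hom ⟨x.left, x.over_w⟩).2

instance : T1Space X.Points := ⟨fun x => by
  refine ⟨⟨{x.pt}ᶜ, (isClosed_pt x).isOpen_compl, ?_⟩⟩
  ext y
  simp [pt_injective.eq_iff]⟩

instance : IsNoetherian X.obj.left where
  toIsLocallyNoetherian := LocallyOfFiniteType.isLocallyNoetherian X.obj.hom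
  toCompactSpace := by
    have := QuasiCompact.compactSpace_of_compactSpace X.obj.hom
    exact this

instance : TopologicalSpace.NoetherianSpace X.Points :=
  (isEmbedding_pt (X := X)).isInducing.noetherianSpace

theorem mapPoints_injective_of_isOpenImmersion (f : X ⟶ Y) [IsOpenImmersion f.hom.left] :
    Function.Injective (mapPoints f) := by
  intro x y h
  apply pt_injective
  apply f.hom.left.isOpenEmbedding.injective
  rw [← pt_mapPoints, h, pt_mapPoints]

theorem range_mapPoints_of_isOpenImmersion (f : X ⟶ Y) [IsOpenImmersion f.hom.left] :
    Set.range (mapPoints f) = {y | y.pt ∈ f.hom.left.opensRange} := by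
  ext y
  constructor
  · rintro ⟨x, rfl⟩
    exact ⟨x.pt, rfl⟩
  · rintro ⟨z, hz⟩
    have hr : Set.range y.left ⊆ Set.range f.hom.left := by
      rintro _ ⟨w, rfl⟩
      have hw : w = IsLocalRing.closedPoint ℂ := Subsingleton.elim (α := PrimeSpectrum ℂ) _ _
      subst hw
      exact ⟨z, hz⟩
    refine ⟨Over.homMk (IsOpenImmersion.lift f.hom.left y.left hr) ?_, ?_⟩
    · rw [← Over.w f.hom, IsOpenImmersion.lift_fac_assoc]
      exact y.over_w
    · apply Over.OverMorphism.ext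
      exact IsOpenImmersion.lift_fac _ _ _

theorem isOpenEmbedding_mapPoints (f : X ⟶ Y) [IsOpenImmersion f.hom.left] :
    IsOpenEmbedding (mapPoints f) := by
  refine ⟨⟨?_, mapPoints_injective_of_isOpenImmersion f⟩, ?_⟩
  · refine IsInducing.of_comp (continuous_mapPoints f) continuous_induced_dom ?_
    · exact f.hom.left.isOpenEmbedding.isInducing.comp isEmbedding_pt.isInducing
  · rw [range_mapPoints_of_isOpenImmersion]
    exact ⟨_, f.hom.left.opensRange.isOpen, rfl⟩

/-- A morphism with image in an open subprevariety factors through it. -/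
theorem exists_lift_of_isOpenImmersion {T : ComplexPrevariety} (f : X ⟶ Y)
    [IsOpenImmersion f.hom.left] (g : T ⟶ Y)
    (h : Set.range g.hom.left ⊆ Set.range f.hom.left) : ∃ l : T ⟶ X, l ≫ f = g := by
  refine ⟨ObjectProperty.homMk (Over.homMk (IsOpenImmersion.lift f.hom.left g.hom.left h) ?_), ?_⟩
  · rw [← Over.w f.hom, IsOpenImmersion.lift_fac_assoc]
    exact Over.w g.hom
  · apply ObjectProperty.hom_ext
    apply Over.OverMorphism.ext
    exact IsOpenImmersion.lift_fac _ _ _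

/-- Every open neighbourhood of a point contains an affine chart around the point. -/
theorem exists_chart {x : X.Points} {U : X.obj.left.Opens} (hx : x.pt ∈ U) :
    ∃ (A : Type) (_ : CommRing A) (_ : Algebra ℂ A) (_ : Algebra.FiniteType ℂ A) (_ : _root_.IsReduced A)
      (j : affine A ⟶ X), IsOpenImmersion j.hom.left ∧ x ∈ Set.range (mapPoints j) ∧
        Set.range j.hom.left ⊆ U := by
  obtain ⟨V, hV, hxV, hVU⟩ := exists_isAffineOpen_mem_and_subset hx
  let e : CommRingCat.of ℂ ⟶ Γ(X.obj.left, V) :=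
    (Scheme.ΓSpecIso (.of ℂ)).inv ≫ X.obj.hom.appLE ⊤ V le_top
  let _ : Algebra ℂ Γ(X.obj.left, V) := e.hom.toAlgebra
  have h1 : Algebra.FiniteType ℂ Γ(X.obj.left, V) := by
    have h := (X.obj.hom.finiteType_appLE (isAffineOpen_top _) hV le_top)
    have h' := h.comp (RingHom.FiniteType.of_surjective (Scheme.ΓSpecIso (.of ℂ)).inv.hom
      (ConcreteCategory.bijective_of_isIso (Scheme.ΓSpecIso (.of ℂ)).inv).surjective)
    exact RingHom.finiteType_algebraMap.mp h'
  have h2 : _root_.IsReduced Γ(X.obj.left, V) := inferInstance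
  have hw : hV.fromSpec ≫ X.obj.hom = Spec.map e := by
    rw [Spec.map_comp, ← Scheme.isoSpec_Spec_inv, ← IsAffineOpen.fromSpec_top]
    exact (IsAffineOpen.SpecMap_appLE_fromSpec (X := X.obj.left) (Y := Spec (.of ℂ)) X.obj.hom
      (U := ⊤) (V := V) (isAffineOpen_top _) hV le_top).symm
  let j : affine Γ(X.obj.left, V) ⟶ X := ObjectProperty.homMk (Over.homMk hV.fromSpec hw)
  have hj : IsOpenImmersion j.hom.left := inferInstanceAs (IsOpenImmersion hV.fromSpec)
  have hr : Set.range j.hom.left = V := hV.range_fromSpec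
  refine ⟨Γ(X.obj.left, V), inferInstance, inferInstance, h1, h2, j, hj, ?_, ?_⟩
  · rw [range_mapPoints_of_isOpenImmersion]
    change x.pt ∈ Set.range j.hom.left
    rwa [hr]
  · rwa [hr]

end Charts

/-! ### Regular functions in affine coordinates. -/

section Value

variable {X Y : ComplexPrevariety}

theorem value_of_mem {U : X.obj.left.Opens} (f : Γ(X.obj.left, U)) {x : X.Points} (h : x.pt ∈ U) :
    value f x = (Scheme.ΓSpecIso (.of ℂ)).hom (x.left.appLE U ⊤ (x.top_le_preimage h) f) :=
  dif_pos h

theorem value_map {U V : X.obj.left.Opens} (i : V ⟶ U) (f : Γ(X.obj.left, U))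
    {x : X.Points} (h : x.pt ∈ V) : value (X.obj.left.presheaf.map i.op f) x = value f x := by
  rw [value_of_mem _ h, value_of_mem _ (i.le h)]
  congr 1
  exact congr($(Scheme.Hom.map_appLE x.left (x.top_le_preimage h) i.op) f)

theorem value_mul {U : X.obj.left.Opens} (f g : Γ(X.obj.left, U)) {x : X.Points} (h : x.pt ∈ U) :
    value (f * g) x = value f x * value g x := by
  simp only [value_of_mem _ h, map_mul]

theorem value_pow {U : X.obj.left.Opens} (f : Γ(X.obj.left, U)) (n : ℕ) {x : X.Points}
    (h : x.pt ∈ U) : value (f ^ n) x = value f x ^ n := by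
  simp only [value_of_mem _ h, map_pow]

theorem value_mapPoints (p : X ⟶ Y) {U : Y.obj.left.Opens} (f : Γ(Y.obj.left, U)) {x : X.Points}
    (h : (mapPoints p x).pt ∈ U) : value f (mapPoints p x) = value (p.hom.left.app U f) x := by
  have h' : x.pt ∈ p.hom.left ⁻¹ᵁ U := h
  rw [value_of_mem _ h, value_of_mem _ h']
  rw [Scheme.Hom.app_eq_appLE]
  congr 1
  exact congr($((Scheme.Hom.appLE_comp_appLE x.left p.hom.left U (p.hom.left ⁻¹ᵁ U) ⊤ le_rfl
    (x.top_le_preimage h')).symm) f)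

variable {A : Type} [CommRing A] [Algebra ℂ A] [Algebra.FiniteType ℂ A] [_root_.IsReduced A]

theorem value_ΓSpecIso_inv (a : A) (x : (affine A).Points) :
    value (X := affine A) (U := ⊤) ((Scheme.ΓSpecIso (.of A)).inv a) x = evalPt x a := by
  obtain ⟨φ, rfl⟩ := ofAlgHom_surjective x
  refine (value_of_mem (X := affine A) (U := ⊤) _ (by trivial)).trans ?_
  rw [evalPt_ofAlgHom]
  have h := Scheme.ΓSpecIso_inv_naturality (CommRingCat.ofHom (φ : A →+* ℂ))
  have h2 : (Spec.map (CommRingCat.ofHom (φ : A →+* ℂ))).appTop ((Scheme.ΓSpecIso (.of A)).inv a) =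
    (Scheme.ΓSpecIso (.of ℂ)).inv (φ a) := congr($(h) a).symm
  change (Scheme.ΓSpecIso (.of ℂ)).hom ((Spec.map (CommRingCat.ofHom (φ : A →+* ℂ))).appLE ⊤ ⊤
    le_top ((Scheme.ΓSpecIso (.of A)).inv a)) = φ a
  have h3 : (Spec.map (CommRingCat.ofHom (φ : A →+* ℂ))).appLE ⊤ ⊤ le_top =
    (Spec.map (CommRingCat.ofHom (φ : A →+* ℂ))).appTop := Scheme.Hom.appLE_eq_app _
  rw [h3, h2]
  exact congr($((Scheme.ΓSpecIso (.of ℂ)).inv_hom_id) (φ a))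

/-- Sections over a basic open subset of an affine scheme are fractions. -/
theorem exists_pow_mul_eq_restrict (R : CommRingCat.{0}) (a : R)
    (g : Γ(Spec R, PrimeSpectrum.basicOpen a)) : ∃ (n : ℕ) (b : R),
    g * ((Spec R).presheaf.map (homOfLE le_top).op ((Scheme.ΓSpecIso R).inv a)) ^ n =
      (Spec R).presheaf.map (homOfLE le_top).op ((Scheme.ΓSpecIso R).inv b) :=
  @IsLocalization.Away.surj R _ Γ(Spec R, PrimeSpectrum.basicOpen a) _
    (IsAffineOpen.instAlgebraCarrierObjOppositeOpensCarrierCarrierCommRingCatSpecPresheafOpOpens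
      (R := R) (U := PrimeSpectrum.basicOpen a)) a
    (StructureSheaf.IsLocalization.to_basicOpen R a) g

/-- A regular function near a point of an affine prevariety is a fraction. -/
theorem exists_value_eq_div (U : (affine A).obj.left.Opens) (f : Γ((affine A).obj.left, U))
    {x : (affine A).Points} (hx : x.pt ∈ U) :
    ∃ (a b : A) (n : ℕ), evalPt x a ≠ 0 ∧ ∀ y : (affine A).Points, evalPt y a ≠ 0 →
      y.pt ∈ U ∧ value f y = evalPt y b / evalPt y a ^ n := by
  obtain ⟨_, ⟨a, rfl⟩, hxa, haU⟩ :=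
    (PrimeSpectrum.isTopologicalBasis_basic_opens (R := A)).exists_subset_of_mem_open
      (a := x.pt) hx U.isOpen
  let W : (Spec (.of A)).Opens := PrimeSpectrum.basicOpen a
  let U' : (Spec (.of A)).Opens := U
  have hWU : W ≤ U' := haU
  let g : Γ(Spec (.of A), W) := (Spec (.of A)).presheaf.map (homOfLE hWU).op f
  let res : A → Γ(Spec (.of A), W) := fun c =>
    (Spec (.of A)).presheaf.map (homOfLE le_top).op ((Scheme.ΓSpecIso (.of A)).inv c)
  obtain ⟨n, b, hb⟩ : ∃ (n : ℕ) (b : A), g * res a ^ n = res b :=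
    exists_pow_mul_eq_restrict (.of A) a g
  have hv : ∀ (c : A) (y : (affine A).Points), evalPt y a ≠ 0 →
      value (X := affine A) (U := W) (res c) y = evalPt y c := by
    intro c y hy
    refine (value_map (X := affine A) (homOfLE le_top) ((Scheme.ΓSpecIso (.of A)).inv c)
      ((pt_mem_basicOpen y a).2 hy)).trans ?_
    exact value_ΓSpecIso_inv c y
  refine ⟨a, b, n, (pt_mem_basicOpen x a).1 hxa, fun y hy => ?_⟩
  have hyW := (pt_mem_basicOpen y a).2 hy
  refine ⟨haU hyW, ?_⟩
  rw [eq_div_iff (pow_ne_zero _ hy), ← hv b y hy, ← hb, ← hv a y hy]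
  refine Eq.trans ?_ (value_mul (X := affine A) (U := W) _ _ hyW).symm
  congr 1
  · exact (value_map (X := affine A) (homOfLE hWU) f hyW).symm
  · exact (value_pow (X := affine A) (U := W) _ n hyW).symm

/-- Regular functions on a chart, as regular functions on its image. -/
theorem exists_section_of_chart (j : affine A ⟶ X) [IsOpenImmersion j.hom.left] (a : A) :
    ∃ f : Γ(X.obj.left, j.hom.left.opensRange), ∀ x, value f (mapPoints j x) = evalPt x a := by
  let g : Γ(Spec (.of A), ⊤) := (Scheme.ΓSpecIso (.of A)).inv a
  have htop : j.hom.left ⁻¹ᵁ j.hom.left.opensRange = ⊤ := by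
    ext z
    simp
  let g' : Γ((affine A).obj.left, j.hom.left ⁻¹ᵁ j.hom.left.opensRange) :=
    (affine A).obj.left.presheaf.map (homOfLE le_top).op g
  have hiso : IsIso (j.hom.left.app j.hom.left.opensRange) :=
    Scheme.Hom.isIso_app _ _ le_rfl
  refine ⟨(inv (j.hom.left.app j.hom.left.opensRange)) g', fun x => ?_⟩
  have hx : (mapPoints j x).pt ∈ j.hom.left.opensRange := ⟨x.pt, rfl⟩
  rw [value_mapPoints j _ hx]
  have : j.hom.left.app j.hom.left.opensRange ((inv (j.hom.left.app j.hom.left.opensRange)) g') = g' :=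
    congr($(IsIso.inv_hom_id (j.hom.left.app j.hom.left.opensRange)) g')
  rw [this]
  refine (value_map (X := affine A) (homOfLE le_top) g hx).trans ?_
  exact value_ΓSpecIso_inv a x

end Value

/-! ### Fibre products of prevarieties. -/

theorem isReduced_nilradical_subscheme (S : Scheme.{0}) : IsReduced S.nilradical.subscheme := by
  have : ∀ i, IsReduced (S.nilradical.subschemeCover.openCover.X i) := by
    intro i
    have : _root_.IsReduced (Γ(S, i.1) ⧸ S.nilradical.ideal i) := by
      rw [← Ideal.isRadical_iff_quotient_reduced]
      exact Ideal.radical_isRadical _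
    exact inferInstanceAs (IsReduced (Spec (.of (Γ(S, i.1) ⧸ S.nilradical.ideal i))))
  exact IsReduced.of_openCover _ S.nilradical.subschemeCover.openCover

/-- A section whose power vanishes pulls back to a nilpotent section, which is zero on a reduced
scheme. This gives the reduction its universal property in `exists_isPullback`. -/
theorem nilradical_le_ker {S T : Scheme.{0}} [IsReduced T] (f : T ⟶ S) :
    S.nilradical ≤ f.ker := by
  refine (Scheme.IdealSheafData.le_ofIdeals_iff).mpr fun U x hx => ?_
  obtain ⟨n, hn⟩ := hx
  rw [RingHom.mem_ker]
  have h : (f.app U x) ^ n = 0 := by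
    have h0 : x ^ n = 0 := hn
    have := congr(f.app U $h0)
    simpa using this
  exact eq_zero_of_pow_eq_zero h

/-- Any two morphisms of prevarieties with a common target have a fibre product. -/
theorem exists_isPullback {X Y Z : ComplexPrevariety} (p : X ⟶ Y) (g : Z ⟶ Y) :
    ∃ (P : ComplexPrevariety) (fst : P ⟶ X) (snd : P ⟶ Z), IsPullback fst snd p g := by
  -- The scheme-theoretic fibre product may be non-reduced; the fibre product of prevarieties is its
  -- reduction, cut out by the nilradical ideal sheaf.
  let S := Limits.pullback p.hom.left g.hom.left
  let r : S.nilradical.subscheme ⟶ S := S.nilradical.subschemeι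
  have hr : IsReduced S.nilradical.subscheme := isReduced_nilradical_subscheme S
  have hgl : LocallyOfFiniteType (g.hom.left ≫ Y.obj.hom) := by
    rw [Over.w g.hom]; infer_instance
  have hg : LocallyOfFiniteType g.hom.left := locallyOfFiniteType_of_comp _ Y.obj.hom
  have hgq : QuasiCompact g.hom.left := inferInstance
  let P : ComplexPrevariety := ⟨Over.mk (r ≫ Limits.pullback.fst _ _ ≫ X.obj.hom),
    hr, by dsimp; infer_instance, by dsimp; infer_instance⟩
  let fst : P ⟶ X := ObjectProperty.homMk (Over.homMk (r ≫ Limits.pullback.fst _ _)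
    (by simp [P]))
  let snd : P ⟶ Z := ObjectProperty.homMk (Over.homMk (r ≫ Limits.pullback.snd _ _) (by
    have h1 := Over.w p.hom
    have h2 := Over.w g.hom
    simp only [P, Over.mk_hom, Category.assoc, ← h1, ← h2]
    rw [Limits.pullback.condition_assoc]))
  have hw : fst ≫ p = snd ≫ g := by
    apply ObjectProperty.hom_ext
    apply Over.OverMorphism.ext
    change (r ≫ Limits.pullback.fst _ _) ≫ p.hom.left = (r ≫ Limits.pullback.snd _ _) ≫ g.hom.left
    rw [Category.assoc, Category.assoc, Limits.pullback.condition]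
  have key : ∀ (T : ComplexPrevariety) (u : T ⟶ X) (v : T ⟶ Z), u ≫ p = v ≫ g →
      ∃ l : T ⟶ P, l ≫ fst = u ∧ l ≫ snd = v := by
    intro T u v huv
    have huv' : u.hom.left ≫ p.hom.left = v.hom.left ≫ g.hom.left := congr(($huv).hom.left)
    let l₀ : T.obj.left ⟶ S := Limits.pullback.lift u.hom.left v.hom.left huv'
    have hker : r.ker ≤ l₀.ker := by
      rw [Scheme.IdealSheafData.ker_subschemeι]
      exact nilradical_le_ker l₀
    let l : T.obj.left ⟶ S.nilradical.subscheme := IsClosedImmersion.lift r l₀ hker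
    have hl : l ≫ r = l₀ := IsClosedImmersion.lift_fac _ _ _
    have h1 : l ≫ r ≫ Limits.pullback.fst _ _ = u.hom.left := by
      rw [reassoc_of% hl, Limits.pullback.lift_fst]
    have h2 : l ≫ r ≫ Limits.pullback.snd _ _ = v.hom.left := by
      rw [reassoc_of% hl, Limits.pullback.lift_snd]
    have hlo : l ≫ r ≫ Limits.pullback.fst _ _ ≫ X.obj.hom = T.obj.hom := by
      rw [reassoc_of% h1]
      exact Over.w u.hom
    refine ⟨ObjectProperty.homMk (Over.homMk l hlo), ?_, ?_⟩
    · apply ObjectProperty.hom_ext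
      apply Over.OverMorphism.ext
      exact h1
    · apply ObjectProperty.hom_ext
      apply Over.OverMorphism.ext
      exact h2
  have uniq : ∀ (T : ComplexPrevariety) (l m : T ⟶ P), l ≫ fst = m ≫ fst → l ≫ snd = m ≫ snd →
      l = m := by
    intro T l m h1 h2
    apply ObjectProperty.hom_ext
    apply Over.OverMorphism.ext
    have h1' : l.hom.left ≫ r ≫ Limits.pullback.fst _ _ = m.hom.left ≫ r ≫ Limits.pullback.fst _ _ :=
      congr(($h1).hom.left)
    have h2' : l.hom.left ≫ r ≫ Limits.pullback.snd _ _ = m.hom.left ≫ r ≫ Limits.pullback.snd _ _ :=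
      congr(($h2).hom.left)
    have h3 : l.hom.left ≫ r = m.hom.left ≫ r := by
      apply Limits.pullback.hom_ext
      · rw [Category.assoc, Category.assoc]
        exact h1'
      · rw [Category.assoc, Category.assoc]
        exact h2'
    exact (cancel_mono r).1 h3
  refine ⟨P, fst, snd, ⟨⟨hw⟩, ⟨Limits.PullbackCone.IsLimit.mk hw
    (fun s => (key s.pt s.fst s.snd s.condition).choose)
    (fun s => (key s.pt s.fst s.snd s.condition).choose_spec.1)
    (fun s => (key s.pt s.fst s.snd s.condition).choose_spec.2)
    (fun s m h1 h2 => uniq _ _ _ ?_ ?_)⟩⟩⟩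
  · rw [h1, (key s.pt s.fst s.snd s.condition).choose_spec.1]
  · rw [h2, (key s.pt s.fst s.snd s.condition).choose_spec.2]

/-- Points of a fibre product are compatible pairs of points. -/
theorem exists_mapPoints_of_isPullback {P X Y Z : ComplexPrevariety} {fst : P ⟶ X} {snd : P ⟶ Z}
    {p : X ⟶ Y} {g : Z ⟶ Y} (h : IsPullback fst snd p g) {x : X.Points} {z : Z.Points}
    (hxz : mapPoints p x = mapPoints g z) :
    ∃ w : P.Points, mapPoints fst w = x ∧ mapPoints snd w = z := by
  have hc : x.toHom ≫ p = z.toHom ≫ g := by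
    apply ObjectProperty.hom_ext
    exact hxz
  refine ⟨Points.ofHom (h.lift x.toHom z.toHom hc), ?_, ?_⟩
  · rw [mapPoints_ofHom, h.lift_fst, Points.ofHom_toHom]
  · rw [mapPoints_ofHom, h.lift_snd, Points.ofHom_toHom]

/-! ### Commutative algebra of finitely generated algebras over `ℂ`. -/

section Algebra

variable {A : Type} [CommRing A] [Algebra ℂ A] [Algebra.FiniteType ℂ A]

/-- Nullstellensatz: the residue field is finite over the algebraically closed field `ℂ`, hence
equal to it. -/
theorem exists_algHom_ker_eq (m : Ideal A) [m.IsMaximal] : ∃ φ : A →ₐ[ℂ] ℂ, RingHom.ker φ = m := by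
  let _ : Field (A ⧸ m) := Ideal.Quotient.field m
  have hf : Module.Finite ℂ (A ⧸ m) := finite_of_finite_type_of_isJacobsonRing ℂ (A ⧸ m)
  have hb : Function.Bijective (algebraMap ℂ (A ⧸ m)) :=
    IsAlgClosed.algebraMap_bijective_of_isIntegral
  let e : ℂ ≃ₐ[ℂ] (A ⧸ m) := AlgEquiv.ofBijective (Algebra.ofId ℂ (A ⧸ m)) hb
  refine ⟨e.symm.toAlgHom.comp (Ideal.Quotient.mkₐ ℂ m), ?_⟩
  ext a
  simp [RingHom.mem_ker, Ideal.Quotient.eq_zero_iff_mem]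

/-- Rabinowitsch's trick: the localization at a non-nilpotent element is nonzero, so it has a
maximal ideal, and `a` is a unit there. -/
theorem exists_algHom_ne_zero {a : A} (ha : ¬ IsNilpotent a) : ∃ φ : A →ₐ[ℂ] ℂ, φ a ≠ 0 := by
  have : Nontrivial (Localization.Away a) := by
    rw [← not_subsingleton_iff_nontrivial, IsLocalization.subsingleton_iff (M := Submonoid.powers a)]
    rintro ⟨n, hn⟩
    exact ha ⟨n, hn⟩
  have : Algebra.FiniteType A (Localization.Away a) := IsLocalization.finiteType_of_monoid_fg
      (Submonoid.powers a) _
  have : Algebra.FiniteType ℂ (Localization.Away a) := .trans (S := A) inferInstance inferInstance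
  obtain ⟨m, hm⟩ := Ideal.exists_maximal (Localization.Away a)
  obtain ⟨φ, -⟩ := exists_algHom_ker_eq m
  refine ⟨φ.comp (IsScalarTower.toAlgHom ℂ A _), ?_⟩
  have : IsUnit (algebraMap A (Localization.Away a) a) := IsLocalization.Away.algebraMap_isUnit a
  exact (this.map φ).ne_zero

theorem exists_algHom_quotient_ne_zero (P : Ideal A) [P.IsPrime] {a : A} (ha : a ∉ P) :
    ∃ φ : A →ₐ[ℂ] ℂ, P ≤ RingHom.ker φ ∧ φ a ≠ 0 := by
  obtain ⟨φ, hφ⟩ := exists_algHom_ne_zero (A := A ⧸ P) (a := Ideal.Quotient.mk P a) (by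
    rwa [isNilpotent_iff_eq_zero, Ideal.Quotient.eq_zero_iff_mem])
  refine ⟨φ.comp (Ideal.Quotient.mkₐ ℂ P), fun x hx => ?_, hφ⟩
  rw [RingHom.mem_ker]
  simp [Ideal.Quotient.eq_zero_iff_mem.2 hx]

omit [Algebra.FiniteType ℂ A] in
theorem isMaximal_ker (φ : A →ₐ[ℂ] ℂ) : (RingHom.ker φ).IsMaximal :=
  RingHom.ker_isMaximal_of_surjective φ fun c => ⟨algebraMap ℂ A c, φ.commutes c⟩

variable [IsDomain A]

-- Transcendence degree is additive in towers and vanishes for integral extensions. Together with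
-- Noether normalization this replaces dimension theory for `A`.
omit [Algebra.FiniteType ℂ A] in
theorem trdeg_eq_of_integral {s : ℕ} (g : MvPolynomial (Fin s) ℂ →ₐ[ℂ] A)
    (hg : Function.Injective g) (hi : g.IsIntegral) : Algebra.trdeg ℂ A = s := by
  let _ : Algebra (MvPolynomial (Fin s) ℂ) A := g.toRingHom.toAlgebra
  have : IsScalarTower ℂ (MvPolynomial (Fin s) ℂ) A :=
    IsScalarTower.of_algebraMap_eq' g.comp_algebraMap.symm
  have : FaithfulSMul (MvPolynomial (Fin s) ℂ) A := (faithfulSMul_iff_algebraMap_injective _ _).2 hg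
  have : Algebra.IsIntegral (MvPolynomial (Fin s) ℂ) A := ⟨hi⟩
  have h := _root_.trdeg_add_eq (R := ℂ) (S := MvPolynomial (Fin s) ℂ) (A := A)
  rw [_root_.trdeg_eq_zero (R := MvPolynomial (Fin s) ℂ) (A := A), add_zero,
    MvPolynomial.trdeg_of_isDomain] at h
  simpa using h.symm

/-- In a finitely generated domain of transcendence degree at most one, nonzero primes are
maximal. -/
theorem isMaximal_of_trdeg_le_one (h : Algebra.trdeg ℂ A ≤ 1) (P : Ideal A) [P.IsPrime]
    (hP : P ≠ ⊥) : P.IsMaximal := by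
  obtain ⟨s, g, hg, hi⟩ := exists_integral_inj_algHom_of_fg ℂ A
  rw [trdeg_eq_of_integral g hg hi] at h
  have hs : s ≤ 1 := by exact_mod_cast h
  let _ : Algebra (MvPolynomial (Fin s) ℂ) A := g.toRingHom.toAlgebra
  have : FaithfulSMul (MvPolynomial (Fin s) ℂ) A := (faithfulSMul_iff_algebraMap_injective _ _).2 hg
  have : Algebra.IsIntegral (MvPolynomial (Fin s) ℂ) A := ⟨hi⟩
  have hdim : Ring.KrullDimLE 1 (MvPolynomial (Fin s) ℂ) := by
    rw [Ring.krullDimLE_iff, MvPolynomial.ringKrullDim_of_isNoetherianRing]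
    simp
    exact_mod_cast hs
  -- Contraction along the integral extension keeps `P` nonzero, so the contraction is maximal in a
  -- polynomial ring in at most one variable; maximality then goes up.
  have hne : P.comap (algebraMap (MvPolynomial (Fin s) ℂ) A) ≠ ⊥ :=
    Ideal.IsIntegral.comap_ne_bot _ hP
  have := Ring.krullDimLE_one_iff_of_noZeroDivisors.1 hdim _ hne
    (Ideal.IsPrime.comap (algebraMap (MvPolynomial (Fin s) ℂ) A) (K := P))
  exact Ideal.isMaximal_of_isIntegral_of_isMaximal_comap P this

/-- With two or more variables in the Noether normalization, the coordinate hyperplane is a nonzero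
prime which is not maximal, and lying over would transport it to `A`. -/
theorem trdeg_le_one_of_isMaximal (h : ∀ P : Ideal A, P.IsPrime → P ≠ ⊥ → P.IsMaximal) :
    Algebra.trdeg ℂ A ≤ 1 := by
  obtain ⟨s, g, hg, hi⟩ := exists_integral_inj_algHom_of_fg ℂ A
  rw [trdeg_eq_of_integral g hg hi]
  by_contra hs
  have hs : 2 ≤ s := by
    by_contra h2
    exact hs (by exact_mod_cast (by omega : s ≤ 1))
  let _ : Algebra (MvPolynomial (Fin s) ℂ) A := g.toRingHom.toAlgebra
  have : FaithfulSMul (MvPolynomial (Fin s) ℂ) A := (faithfulSMul_iff_algebraMap_injective _ _).2 hg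
  have : Algebra.IsIntegral (MvPolynomial (Fin s) ℂ) A := ⟨hi⟩
  -- the kernel of the substitution of zero for the first variable
  let i0 : Fin s := ⟨0, by omega⟩
  let i1 : Fin s := ⟨1, by omega⟩
  let σ : MvPolynomial (Fin s) ℂ →ₐ[ℂ] MvPolynomial (Fin s) ℂ :=
    MvPolynomial.aeval fun i => if i = i0 then 0 else MvPolynomial.X i
  have hσ0 : σ (MvPolynomial.X i0) = 0 := by simp [σ]
  have hσ1 : σ (MvPolynomial.X i1) = MvPolynomial.X i1 := by simp [σ, i0, i1]
  have hprime : (RingHom.ker σ).IsPrime := RingHom.ker_isPrime σ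
  obtain ⟨Q, -, hQ, hQc⟩ := Ideal.exists_ideal_over_prime_of_isIntegral (S := A) (RingHom.ker σ) ⊥ (by
    rw [← RingHom.ker_eq_comap_bot, (RingHom.injective_iff_ker_eq_bot (algebraMap (MvPolynomial (Fin s) ℂ) A)).1
      (FaithfulSMul.algebraMap_injective _ _)]
    exact bot_le)
  have hQ0 : Q ≠ ⊥ := by
    rintro rfl
    have : MvPolynomial.X i0 ∈ RingHom.ker σ := hσ0
    rw [← hQc, ← RingHom.ker_eq_comap_bot, (RingHom.injective_iff_ker_eq_bot (algebraMap (MvPolynomial (Fin s) ℂ) A)).1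
      (FaithfulSMul.algebraMap_injective _ _)] at this
    exact MvPolynomial.X_ne_zero i0 this
  have hQm := h Q hQ hQ0
  have hm : (RingHom.ker σ).IsMaximal := by
    rw [← hQc]
    exact Ideal.isMaximal_comap_of_isIntegral_of_isMaximal Q
  have hlt : RingHom.ker σ < RingHom.ker ((MvPolynomial.aeval (0 : Fin s → ℂ)).comp σ :
      MvPolynomial (Fin s) ℂ →ₐ[ℂ] ℂ) := by
    refine lt_of_le_of_ne (fun x hx => ?_) fun he => ?_
    · rw [RingHom.mem_ker] at hx ⊢
      simp [hx]
    · have : MvPolynomial.X i1 ∈ RingHom.ker σ := by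
        rw [he, RingHom.mem_ker]
        simp [hσ1]
      rw [RingHom.mem_ker, hσ1] at this
      exact MvPolynomial.X_ne_zero i1 this
  exact (RingHom.ker_ne_top _) (hm.1.2 _ hlt)

/-- Through every point of an irreducible affine variety there is a curve that is not contained in
a given hypersurface. -/
theorem exists_prime_trdeg_le_one (φ : A →ₐ[ℂ] ℂ) {f : A} (hf : f ≠ 0) :
    ∃ q : Ideal A, q.IsPrime ∧ q ≤ RingHom.ker φ ∧ f ∉ q ∧ Algebra.trdeg ℂ (A ⧸ q) ≤ 1 := by
  obtain ⟨s, g, hg, hi⟩ := exists_integral_inj_algHom_of_fg ℂ A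
  let _ : Algebra (MvPolynomial (Fin s) ℂ) A := g.toRingHom.toAlgebra
  have : IsScalarTower ℂ (MvPolynomial (Fin s) ℂ) A :=
    IsScalarTower.of_algebraMap_eq' g.comp_algebraMap.symm
  have : FaithfulSMul (MvPolynomial (Fin s) ℂ) A := (faithfulSMul_iff_algebraMap_injective _ _).2 hg
  have : Algebra.IsIntegral (MvPolynomial (Fin s) ℂ) A := ⟨hi⟩
  -- It is enough to avoid the zeros of a nonzero multiple of `f` coming from the polynomial ring.
  obtain ⟨h, hh0, hhf⟩ : ∃ h : MvPolynomial (Fin s) ℂ, h ≠ 0 ∧ f ∣ algebraMap _ A h := by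
    have hne := Ideal.comap_ne_bot_of_integral_mem (R := MvPolynomial (Fin s) ℂ) hf
      (Ideal.mem_span_singleton_self f) (Algebra.IsIntegral.isIntegral f)
    obtain ⟨h, hh, h0⟩ := Submodule.exists_mem_ne_zero_of_ne_bot hne
    exact ⟨h, h0, Ideal.mem_span_singleton.1 hh⟩
  let c : Fin s → ℂ := fun i => φ (algebraMap (MvPolynomial (Fin s) ℂ) A (MvPolynomial.X i))
  have hc : ∀ x : MvPolynomial (Fin s) ℂ, φ (algebraMap _ A x) = MvPolynomial.eval c x := by
    intro x
    have : φ.comp (IsScalarTower.toAlgHom ℂ (MvPolynomial (Fin s) ℂ) A) = MvPolynomial.aeval c :=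
      MvPolynomial.algHom_ext fun i : Fin s => by simp [c]
    exact congr($this x)
  obtain ⟨d, hd⟩ : ∃ d : Fin s → ℂ, MvPolynomial.eval d h ≠ 0 := by
    by_contra hall
    push Not at hall
    exact hh0 (MvPolynomial.funext fun d => by rw [hall d, map_zero])
  -- Restriction to the line from `c`, the image of the given point, to a point `d` with `h d ≠ 0`.
  -- If `c = d` the line degenerates to a point, which the bound `≤ 1` permits.
  let ℓ : MvPolynomial (Fin s) ℂ →ₐ[ℂ] Polynomial ℂ :=
    MvPolynomial.aeval fun i : Fin s => (Polynomial.C (c i) + Polynomial.X * Polynomial.C (d i - c i) : Polynomial ℂ)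
  have h0 : ∀ x, (ℓ x).eval 0 = MvPolynomial.eval c x := by
    intro x
    have : (Polynomial.aeval (0 : ℂ)).comp ℓ = MvPolynomial.aeval c :=
      MvPolynomial.algHom_ext fun i : Fin s => by simp [ℓ]
    exact congr($this x)
  have h1 : ∀ x, (ℓ x).eval 1 = MvPolynomial.eval d x := by
    intro x
    have : (Polynomial.aeval (1 : ℂ)).comp ℓ = MvPolynomial.aeval d :=
      MvPolynomial.algHom_ext fun i : Fin s => by simp [ℓ]
    exact congr($this x)
  have hprime : (RingHom.ker ℓ).IsPrime := RingHom.ker_isPrime ℓ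
  have hφm := isMaximal_ker φ
  let p0 := (RingHom.ker φ).under (MvPolynomial (Fin s) ℂ)
  have hle : RingHom.ker ℓ ≤ p0 := by
    intro x hx
    change φ (algebraMap _ A x) = 0
    rw [hc, ← h0, (RingHom.mem_ker).1 hx, Polynomial.eval_zero]
  -- Going down over the normal polynomial ring lifts the prime of the line to a prime inside the
  -- ideal of the given point.
  obtain ⟨q, hq, hqp, hqo⟩ := Ideal.exists_ideal_le_liesOver_of_le (p := RingHom.ker ℓ)
    (q := p0) (RingHom.ker φ) hle
  refine ⟨q, hqp, hq, ?_, ?_⟩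
  · intro hfq
    have : h ∈ RingHom.ker ℓ := by
      rw [hqo.over]
      exact q.mem_of_dvd hhf hfq
    apply hd
    rw [← h1, (RingHom.mem_ker).1 this, Polynomial.eval_zero]
  · have hcard : Algebra.trdeg ℂ (MvPolynomial (Fin s) ℂ ⧸ RingHom.ker ℓ) ≤ 1 := by
      have := _root_.trdeg_le_of_injective (Ideal.kerLiftAlg ℓ) (Ideal.kerLiftAlg_injective ℓ)
      rwa [Polynomial.trdeg_of_isDomain] at this
    have hint : Algebra.IsIntegral (MvPolynomial (Fin s) ℂ ⧸ RingHom.ker ℓ) (A ⧸ q) := inferInstance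
    have hadd := _root_.trdeg_add_eq (R := ℂ) (S := MvPolynomial (Fin s) ℂ ⧸ RingHom.ker ℓ)
      (A := A ⧸ q)
    rw [_root_.trdeg_eq_zero (R := MvPolynomial (Fin s) ℂ ⧸ RingHom.ker ℓ)
      (A := A ⧸ q), add_zero] at hadd
    rwa [← hadd]

omit [Algebra.FiniteType ℂ A] [IsDomain A] in
theorem algHom_ext_of_ker_le {φ ψ : A →ₐ[ℂ] ℂ} (h : RingHom.ker φ ≤ RingHom.ker ψ) : φ = ψ := by
  ext a
  have h1 : a - algebraMap ℂ A (φ a) ∈ RingHom.ker φ := by simp [RingHom.mem_ker]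
  have h2 := (RingHom.mem_ker).1 (h h1)
  simp only [map_sub, AlgHom.commutes] at h2
  exact (sub_eq_zero.1 h2).symm

/-- Either the set or its complement contains the generic point. Phrased symmetrically, the
alternative passes to complements at once and the induction only has to treat unions. -/
theorem exists_basicOpen_subset_of_isConstructible {B : Type} [CommRing B] [IsDomain B]
    {S : Set (PrimeSpectrum B)} (hS : IsConstructible S) :
    (∃ b : B, b ≠ 0 ∧ (PrimeSpectrum.basicOpen b : Set (PrimeSpectrum B)) ⊆ S) ∨
      ∃ b : B, b ≠ 0 ∧ (PrimeSpectrum.basicOpen b : Set (PrimeSpectrum B)) ⊆ Sᶜ := by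
  induction hS using IsConstructible.empty_union_induction with
  | open_retrocompact U hU _ =>
    rcases U.eq_empty_or_nonempty with rfl | ⟨x, hx⟩
    · exact Or.inr ⟨1, one_ne_zero, by simp⟩
    · obtain ⟨_, ⟨b, rfl⟩, hxb, hbU⟩ :=
        PrimeSpectrum.isTopologicalBasis_basic_opens.exists_subset_of_mem_open hx hU
      refine Or.inl ⟨b, ?_, hbU⟩
      rintro rfl
      simp at hxb
  | union S _ T _ hS hT =>
    rcases hS with ⟨b, hb, hbS⟩ | ⟨b, hb, hbS⟩
    · exact Or.inl ⟨b, hb, hbS.trans Set.subset_union_left⟩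
    · rcases hT with ⟨c, hc, hcT⟩ | ⟨c, hc, hcT⟩
      · exact Or.inl ⟨c, hc, hcT.trans Set.subset_union_right⟩
      · refine Or.inr ⟨b * c, mul_ne_zero hb hc, ?_⟩
        rw [PrimeSpectrum.basicOpen_mul, Set.compl_union]
        exact Set.inter_subset_inter hbS hcT
  | compl S _ hS =>
    rw [compl_compl]
    exact hS.symm

omit [Algebra.FiniteType ℂ A] in
/-- A dominant morphism of irreducible affine varieties is surjective over a dense open subset. -/
theorem exists_extension_of_injective [Algebra.FiniteType ℂ A] {B : Type} [CommRing B] [IsDomain B]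
    [Algebra ℂ B] [Algebra.FiniteType ℂ B] (f : B →ₐ[ℂ] A) (hf : Function.Injective f) :
    ∃ b : B, b ≠ 0 ∧ ∀ φ : B →ₐ[ℂ] ℂ, φ b ≠ 0 → ∃ ψ : A →ₐ[ℂ] ℂ, ψ.comp f = φ := by
  have : IsNoetherianRing B := Algebra.FiniteType.isNoetherianRing ℂ B
  have hfp : f.toRingHom.FinitePresentation := by
    refine RingHom.FinitePresentation.of_finiteType.1 ?_
    have : (f.toRingHom.comp (algebraMap ℂ B)).FiniteType := by
      have := RingHom.finiteType_algebraMap.2 (inferInstance : Algebra.FiniteType ℂ A)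
      rwa [← f.comp_algebraMap] at this
    exact RingHom.FiniteType.of_comp_finiteType this
  have hc := PrimeSpectrum.isConstructible_range_comap hfp
  -- Chevalley makes the image constructible; it contains the generic point because `f` is
  -- injective, which excludes the second alternative.
  have hbot : (⊥ : PrimeSpectrum B) ∈ Set.range (PrimeSpectrum.comap f.toRingHom) := by
    refine ⟨⊥, ?_⟩
    ext x
    simp [map_eq_zero_iff f hf]
  rcases exists_basicOpen_subset_of_isConstructible hc with ⟨b, hb, h⟩ | ⟨b, hb, h⟩
  · refine ⟨b, hb, fun φ hφ => ?_⟩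
    have := isMaximal_ker φ
    obtain ⟨P, hP⟩ := h (show (⟨RingHom.ker φ, inferInstance⟩ : PrimeSpectrum B) ∈
      PrimeSpectrum.basicOpen b from hφ)
    -- The prime `P` over the point `φ` need not be maximal. Any complex point in its closure also
    -- maps to `φ`, since `ker φ` is maximal.
    obtain ⟨ψ, hψ, -⟩ := exists_algHom_quotient_ne_zero P.asIdeal (a := 1)
      ((Ideal.ne_top_iff_one _).1 P.isPrime.ne_top)
    refine ⟨ψ, (algHom_ext_of_ker_le fun x hx => ?_).symm⟩
    have hx' : x ∈ (PrimeSpectrum.comap f.toRingHom P).asIdeal := by rw [hP]; exact hx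
    exact hψ hx'
  · exact absurd hbot (h (by simpa using hb))

end Algebra

/-! ### The ring of holomorphic germs and substitutions in it. -/

/-- The algebra of functions that are analytic at the origin. -/
def analyticFun : Subalgebra ℂ (ℂ → ℂ) where
  carrier := {f | AnalyticAt ℂ f 0}
  mul_mem' hf hg := AnalyticAt.mul hf hg
  add_mem' hf hg := AnalyticAt.add hf hg
  algebraMap_mem' _ := analyticAt_const

/-- The ideal of functions vanishing near the origin. -/
def germIdeal : Ideal analyticFun where
  carrier := {f | ∀ᶠ t in 𝓝 (0 : ℂ), f.1 t = 0}
  zero_mem' := Eventually.of_forall fun _ => rfl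
  add_mem' {f g} hf hg := by
    filter_upwards [hf, hg] with t h1 h2
    change f.1 t + g.1 t = 0
    rw [h1, h2, add_zero]
  smul_mem' c f hf := by
    filter_upwards [hf] with t h1
    change c.1 t * f.1 t = 0
    rw [h1, mul_zero]

/-- Isolated zeros: two analytic functions which do not vanish identically near the origin are both
nonzero on a common punctured neighbourhood. -/
instance : germIdeal.IsPrime := by
  refine ⟨?_, fun {f g} h => ?_⟩
  · rw [Ideal.ne_top_iff_one]
    intro h
    exact one_ne_zero (α := ℂ) (Eventually.self_of_nhds (p := fun _ => (1 : ℂ) = 0) h)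
  · rcases f.2.eventually_eq_zero_or_eventually_ne_zero with hf | hf
    · exact Or.inl hf
    · refine Or.inr ?_
      rcases g.2.eventually_eq_zero_or_eventually_ne_zero with hg | hg
      · exact hg
      · exfalso
        have h' : ∀ᶠ t in 𝓝[≠] (0 : ℂ), f.1 t * g.1 t = 0 := h.filter_mono nhdsWithin_le_nhds
        obtain ⟨t, h1, h2, h3⟩ := (h'.and (hf.and hg)).exists
        exact mul_ne_zero h2 h3 h1

/-- The ring of germs at the origin of holomorphic functions. -/
def HolGerm : Type := analyticFun ⧸ germIdeal

instance : CommRing HolGerm := Ideal.Quotient.commRing germIdeal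

instance : IsDomain HolGerm := Ideal.Quotient.isDomain germIdeal

instance : Algebra ℂ HolGerm := inferInstanceAs (Algebra ℂ (analyticFun ⧸ germIdeal))

namespace HolGerm

/-- The germ of a function analytic at the origin. -/
def mk (f : ℂ → ℂ) (hf : AnalyticAt ℂ f 0) : HolGerm := Ideal.Quotient.mk germIdeal ⟨f, hf⟩

theorem mk_eq_mk {f g : ℂ → ℂ} {hf : AnalyticAt ℂ f 0} {hg : AnalyticAt ℂ g 0} :
    mk f hf = mk g hg ↔ ∀ᶠ t in 𝓝 (0 : ℂ), f t = g t := by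
  refine Ideal.Quotient.eq.trans ?_
  change (∀ᶠ t in 𝓝 (0 : ℂ), f t - g t = 0) ↔ _
  simp only [sub_eq_zero]

theorem mk_eq_zero {f : ℂ → ℂ} {hf : AnalyticAt ℂ f 0} :
    mk f hf = 0 ↔ ∀ᶠ t in 𝓝 (0 : ℂ), f t = 0 :=
  Ideal.Quotient.eq_zero_iff_mem

theorem exists_rep (r : HolGerm) : ∃ f hf, mk f hf = r := by
  obtain ⟨f, rfl⟩ := Ideal.Quotient.mk_surjective r
  exact ⟨f.1, f.2, rfl⟩

/-- A representing function of a germ. -/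
def rep (r : HolGerm) : ℂ → ℂ := r.exists_rep.choose

theorem analyticAt_rep (r : HolGerm) : AnalyticAt ℂ r.rep 0 := r.exists_rep.choose_spec.choose

@[simp] theorem mk_rep (r : HolGerm) : mk r.rep r.analyticAt_rep = r :=
  r.exists_rep.choose_spec.choose_spec

theorem rep_mk {f : ℂ → ℂ} (hf : AnalyticAt ℂ f 0) : ∀ᶠ t in 𝓝 (0 : ℂ), (mk f hf).rep t = f t :=
  mk_eq_mk.1 (mk_rep _)

theorem rep_mul (r s : HolGerm) : ∀ᶠ t in 𝓝 (0 : ℂ), (r * s).rep t = r.rep t * s.rep t := by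
  have h : mk _ (r.analyticAt_rep.mul s.analyticAt_rep) = r * s := by
    conv_rhs => rw [← mk_rep r, ← mk_rep s]
    rfl
  exact mk_eq_mk.1 ((mk_rep _).trans h.symm)

theorem rep_algebraMap (c : ℂ) : ∀ᶠ t in 𝓝 (0 : ℂ), (algebraMap ℂ HolGerm c).rep t = c := by
  have h : mk _ (analyticAt_const (v := c)) = algebraMap ℂ HolGerm c := rfl
  exact mk_eq_mk.1 ((mk_rep _).trans h.symm)

/-- The value of a germ at the origin. -/
def eval0 : HolGerm →ₐ[ℂ] ℂ :=
  Ideal.Quotient.liftₐ germIdeal ((Pi.evalAlgHom ℂ (fun _ : ℂ => ℂ) 0).comp analyticFun.val)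
    fun f ha => Eventually.self_of_nhds (p := fun t => f.1 t = (0 : ℂ)) ha

theorem eval0_mk {f : ℂ → ℂ} (hf : AnalyticAt ℂ f 0) : eval0 (mk f hf) = f 0 := rfl

theorem eval0_eq (r : HolGerm) : eval0 r = r.rep 0 := by
  rw [← eval0_mk r.analyticAt_rep, mk_rep]

/-- Substitution of a germ at the origin into a germ. -/
def comp (α : ℂ → ℂ) (hα : AnalyticAt ℂ α 0) (h0 : α 0 = 0) : HolGerm →ₐ[ℂ] HolGerm :=
  Ideal.quotientMapₐ germIdeal
    { toFun := fun f => ⟨f.1 ∘ α, AnalyticAt.comp (by rw [h0]; exact f.2) hα⟩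
      map_one' := rfl
      map_mul' := fun _ _ => rfl
      map_zero' := rfl
      map_add' := fun _ _ => rfl
      commutes' := fun _ => rfl }
    fun f hf => by
      have h : Tendsto α (𝓝 0) (𝓝 0) := by simpa [h0] using hα.continuousAt.tendsto
      exact h.eventually hf

theorem tendsto_of_analyticAt {α : ℂ → ℂ} (hα : AnalyticAt ℂ α 0) (h0 : α 0 = 0) :
    Tendsto α (𝓝 0) (𝓝 0) := by simpa [h0] using hα.continuousAt.tendsto

theorem comp_mk {α : ℂ → ℂ} (hα : AnalyticAt ℂ α 0) (h0 : α 0 = 0) {f : ℂ → ℂ}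
    (hf : AnalyticAt ℂ f 0) :
    comp α hα h0 (mk f hf) = mk (f ∘ α) (AnalyticAt.comp (by rwa [h0]) hα) := rfl

theorem rep_comp {α : ℂ → ℂ} (hα : AnalyticAt ℂ α 0) (h0 : α 0 = 0) (r : HolGerm) :
    ∀ᶠ t in 𝓝 (0 : ℂ), (comp α hα h0 r).rep t = r.rep (α t) := by
  have h := comp_mk hα h0 r.analyticAt_rep
  rw [mk_rep] at h
  rw [h]
  exact rep_mk _

theorem eval0_comp {α : ℂ → ℂ} (hα : AnalyticAt ℂ α 0) (h0 : α 0 = 0) (r : HolGerm) :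
    eval0 (comp α hα h0 r) = eval0 r := by
  conv_lhs => rw [← mk_rep r, comp_mk, eval0_mk]
  rw [Function.comp_apply, h0, eval0_eq]

/-- The germ of the coordinate function. -/
def X : HolGerm := mk id analyticAt_id

theorem eval0_X : eval0 X = 0 := rfl

theorem isUnit_of_eval0_ne_zero {r : HolGerm} (h : eval0 r ≠ 0) : IsUnit r := by
  rw [eval0_eq] at h
  refine IsUnit.of_mul_eq_one (mk _ (r.analyticAt_rep.inv h)) ?_
  have h1 : mk _ (r.analyticAt_rep.mul (r.analyticAt_rep.inv h)) =
      r * mk _ (r.analyticAt_rep.inv h) := by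
    conv_rhs => enter [1]; rw [← mk_rep r]
    rfl
  rw [← h1]
  refine mk_eq_mk.2 ?_
  filter_upwards [r.analyticAt_rep.continuousAt.eventually_ne h] with t ht
  exact mul_inv_cancel₀ ht

theorem isUnit_iff {r : HolGerm} : IsUnit r ↔ eval0 r ≠ 0 :=
  ⟨fun h => (h.map eval0).ne_zero, isUnit_of_eval0_ne_zero⟩

theorem mk_mul {f g : ℂ → ℂ} (hf : AnalyticAt ℂ f 0) (hg : AnalyticAt ℂ g 0) :
    mk f hf * mk g hg = mk (fun t => f t * g t) (hf.mul hg) := rfl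

theorem X_pow (n : ℕ) : X ^ n = mk (fun t => t ^ n) (analyticAt_id.pow n) := by
  exact (map_pow (Ideal.Quotient.mk germIdeal) _ n).symm

theorem exists_eq_X_pow_mul {r : HolGerm} (hr : r ≠ 0) :
    ∃ (n : ℕ) (u : HolGerm), eval0 u ≠ 0 ∧ r = X ^ n * u := by
  have h : ¬ ∀ᶠ t in 𝓝 (0 : ℂ), r.rep t = 0 := by
    rwa [← mk_eq_zero (hf := r.analyticAt_rep), mk_rep]
  obtain ⟨n, g, hg, hg0, he⟩ := r.analyticAt_rep.exists_eventuallyEq_pow_smul_nonzero_iff.2 h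
  refine ⟨n, mk g hg, hg0, ?_⟩
  rw [X_pow, mk_mul, ← mk_rep r]
  refine mk_eq_mk.2 ?_
  filter_upwards [he] with t ht
  simpa using ht

theorem X_ne_zero : X ≠ 0 := by
  intro h
  have h1 : ∀ᶠ t in 𝓝 (0 : ℂ), t = 0 := mk_eq_zero.1 h
  have h2 : ∀ᶠ t in 𝓝[≠] (0 : ℂ), t = 0 := h1.filter_mono nhdsWithin_le_nhds
  obtain ⟨t, h3, h4⟩ := (h2.and self_mem_nhdsWithin).exists
  exact h4 h3

theorem X_dvd_iff {r : HolGerm} : X ∣ r ↔ eval0 r = 0 := by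
  constructor
  · rintro ⟨s, rfl⟩
    rw [map_mul, eval0_X, zero_mul]
  · intro h
    by_cases hr : r = 0
    · rw [hr]
      exact dvd_zero _
    · obtain ⟨n, u, hu, rfl⟩ := exists_eq_X_pow_mul hr
      cases n with
      | zero => simp [hu] at h
      | succ n => exact ⟨X ^ n * u, by ring⟩

theorem prime_X : Prime X := by
  refine ⟨X_ne_zero, fun h => (isUnit_iff.1 h) eval0_X, fun a b h => ?_⟩
  simpa [X_dvd_iff, map_mul] using h

instance : IsDiscreteValuationRing HolGerm :=
  IsDiscreteValuationRing.ofHasUnitMulPowIrreducibleFactorization ⟨X, prime_X.irreducible, by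
    intro r hr
    obtain ⟨n, u, hu, rfl⟩ := exists_eq_X_pow_mul hr
    exact ⟨n, (isUnit_of_eval0_ne_zero hu).unit, rfl⟩⟩

/-- Krull's intersection theorem in its simplest form: a nonzero germ has a finite order of
vanishing. -/
theorem eq_zero_of_forall_pow_dvd {h r : HolGerm} (hh : eval0 h = 0) (H : ∀ n, h ^ n ∣ r) :
    r = 0 := by
  by_contra hr
  obtain ⟨n, u, hu, rfl⟩ := exists_eq_X_pow_mul hr
  obtain ⟨c, hc⟩ := (pow_dvd_pow_of_dvd (X_dvd_iff.2 hh) (n + 1)).trans (H (n + 1))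
  have : u = X * c := mul_left_cancel₀ (pow_ne_zero n X_ne_zero) (by rw [hc]; ring)
  rw [this, map_mul, eval0_X, zero_mul] at hu
  exact hu rfl

/-- The implicit function theorem for analytic equations. -/
theorem exists_analyticAt_implicit {E : Type} [NormedAddCommGroup E] [NormedSpace ℂ E]
    [CompleteSpace E] {F : ℂ × E → E} {w₀ : E} (hF : AnalyticAt ℂ F (0, w₀))
    (L : E ≃L[ℂ] E) (hL : HasFDerivAt (fun w => F (0, w)) (L : E →L[ℂ] E) w₀) :
    ∃ w : ℂ → E, AnalyticAt ℂ w 0 ∧ w 0 = w₀ ∧ ∀ᶠ t in 𝓝 (0 : ℂ), F (t, w t) = F (0, w₀) := by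
  have hc : ContDiffAt ℂ ⊤ F (0, w₀) := hF.contDiffAt
  have hd : fderiv ℂ F (0, w₀) ∘L .inr ℂ ℂ E = (L : E →L[ℂ] E) := by
    have h1 : HasFDerivAt (fun w : E => ((0 : ℂ), w)) (.inr ℂ ℂ E) w₀ :=
      hasFDerivAt_prodMk_right 0 w₀
    have h2 := (hF.differentiableAt.hasFDerivAt).comp w₀ h1
    exact h2.unique hL
  have hi : (fderiv ℂ F (0, w₀) ∘L .inr ℂ ℂ E).IsInvertible := by
    rw [hd]
    exact ⟨L, rfl⟩
  refine ⟨hc.implicitFunction (by simp) hi, (hc.contDiffAt_implicitFunction (by simp) hi).analyticAt,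
    hc.implicitFunction_apply_self (by simp) hi, hc.eventually_apply_implicitFunction (by simp) hi⟩

/-- A nonconstant germ becomes a power of the coordinate after a substitution. -/
theorem exists_comp_eq_X_pow {c : HolGerm} (hc : c ≠ 0) (hc0 : eval0 c = 0) :
    ∃ (n : ℕ) (α : ℂ → ℂ) (hα : AnalyticAt ℂ α 0) (h0 : α 0 = 0),
      n ≠ 0 ∧ (¬ ∀ᶠ t in 𝓝 (0 : ℂ), α t = 0) ∧ comp α hα h0 c = X ^ n := by
  obtain ⟨n, u, hu, rfl⟩ := exists_eq_X_pow_mul hc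
  have hn : n ≠ 0 := by
    rintro rfl
    simp [hu] at hc0
  rw [eval0_eq] at hu
  -- For `c = X ^ n * u` one looks for `α = t * w(t)` with `w ^ n * u(t * w) = 1`. At `t = 0` this
  -- reads `w₀ ^ n * u(0) = 1`, and its derivative in `w` there is `n * w₀ ^ (n - 1) * u(0) ≠ 0`.
  obtain ⟨w₀, hw₀⟩ := IsAlgClosed.exists_pow_nat_eq (u.rep 0)⁻¹ (Nat.pos_of_ne_zero hn)
  have hw0 : w₀ ≠ 0 := by
    rintro rfl
    rw [zero_pow hn] at hw₀
    exact inv_ne_zero hu hw₀.symm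
  let F : ℂ × ℂ → ℂ := fun p => p.2 ^ n * u.rep (p.1 * p.2)
  have hF : AnalyticAt ℂ F (0, w₀) := by
    refine (analyticAt_snd.pow n).mul (AnalyticAt.comp (g := u.rep) ?_
      (analyticAt_fst.mul analyticAt_snd))
    simpa using u.analyticAt_rep
  have hne : (n : ℂ) * w₀ ^ (n - 1) * u.rep 0 ≠ 0 :=
    mul_ne_zero (mul_ne_zero (Nat.cast_ne_zero.2 hn) (pow_ne_zero _ hw0)) hu
  have hD : HasDerivAt (fun w => F (0, w)) ((n : ℂ) * w₀ ^ (n - 1) * u.rep 0) w₀ := by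
    simpa [F] using (hasDerivAt_pow n w₀).mul_const (u.rep 0)
  obtain ⟨w, hw, hw1, hw2⟩ := exists_analyticAt_implicit hF
    (ContinuousLinearEquiv.unitsEquivAut ℂ (Units.mk0 _ hne)) (by
      have : ((ContinuousLinearEquiv.unitsEquivAut ℂ (Units.mk0 _ hne) : ℂ ≃L[ℂ] ℂ) : ℂ →L[ℂ] ℂ) =
          ContinuousLinearMap.toSpanSingleton ℂ ((n : ℂ) * w₀ ^ (n - 1) * u.rep 0) := by
        ext
        simp
      rw [this]
      exact hD.hasFDerivAt)
  have hα : AnalyticAt ℂ (fun t => t * w t) 0 := analyticAt_id.mul hw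
  refine ⟨n, fun t => t * w t, hα, by simp, hn, fun h => ?_, ?_⟩
  · have h2 : ∀ᶠ t in 𝓝 (0 : ℂ), w t ≠ 0 := hw.continuousAt.eventually_ne (by rwa [hw1])
    have h3 : ∀ᶠ t in 𝓝[≠] (0 : ℂ), t * w t = 0 ∧ w t ≠ 0 :=
      (h.and h2).filter_mono nhdsWithin_le_nhds
    obtain ⟨t, ⟨h4, h5⟩, h6⟩ := (h3.and self_mem_nhdsWithin).exists
    exact mul_ne_zero h6 h5 h4
  · refine (mk_rep _).symm.trans ((mk_eq_mk.2 ?_).trans (X_pow n).symm)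
    have h4 := tendsto_of_analyticAt hα (by simp)
    filter_upwards [hw2, rep_comp hα (by simp) (X ^ n * u), h4.eventually (rep_mul (X ^ n) u),
      h4.eventually (mk_eq_mk.1 ((mk_rep (X ^ n)).trans (X_pow n)))] with t h1 h2 h3 h5
    rw [h2, h3, h5, mul_pow, mul_assoc]
    have h6 : w t ^ n * u.rep (t * w t) = 1 := by
      refine h1.trans ?_
      simp [F, hw₀, hu]
    rw [h6, mul_one]

theorem comp_comp {α β : ℂ → ℂ} (hα : AnalyticAt ℂ α 0) (hα0 : α 0 = 0) (hβ : AnalyticAt ℂ β 0)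
    (hβ0 : β 0 = 0) (r : HolGerm) :
    comp β hβ hβ0 (comp α hα hα0 r) =
      comp (α ∘ β) (AnalyticAt.comp (by rwa [hβ0]) hβ) (by simp [hα0, hβ0]) r := by
  rw [← mk_rep r]
  rfl

theorem not_eventually_eq_zero_comp_pow {α : ℂ → ℂ} (hα : AnalyticAt ℂ α 0) {n : ℕ} (hn : n ≠ 0)
    (h : ¬ ∀ᶠ t in 𝓝 (0 : ℂ), α t = 0) : ¬ ∀ᶠ t in 𝓝 (0 : ℂ), (α ∘ fun t => t ^ n) t = 0 := by
  have h1 : ∀ᶠ t in 𝓝[≠] (0 : ℂ), α t ≠ 0 :=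
    hα.eventually_eq_zero_or_eventually_ne_zero.resolve_left h
  have h2 : Tendsto (fun t : ℂ => t ^ n) (𝓝[≠] 0) (𝓝[≠] 0) := by
    refine tendsto_nhdsWithin_of_tendsto_nhds_of_eventually_within _ ?_ ?_
    · exact (Continuous.tendsto' (f := fun t : ℂ => t ^ n) (by fun_prop) 0 0 (zero_pow hn)).mono_left nhdsWithin_le_nhds
    · filter_upwards [self_mem_nhdsWithin] with t ht
      exact pow_ne_zero n ht
  intro h3
  obtain ⟨t, h4, h5⟩ := ((h2.eventually h1).and (h3.filter_mono nhdsWithin_le_nhds)).exists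
  exact h4 h5

/-- Two nonconstant germs agree after suitable substitutions. -/
theorem exists_comp_eq_comp {c b : HolGerm} (hc : c ≠ 0) (hc0 : eval0 c = 0) (hb : b ≠ 0)
    (hb0 : eval0 b = 0) :
    ∃ (α β : ℂ → ℂ) (hα : AnalyticAt ℂ α 0) (hα0 : α 0 = 0) (hβ : AnalyticAt ℂ β 0)
      (hβ0 : β 0 = 0), (¬ ∀ᶠ t in 𝓝 (0 : ℂ), α t = 0) ∧ (¬ ∀ᶠ t in 𝓝 (0 : ℂ), β t = 0) ∧
      comp α hα hα0 c = comp β hβ hβ0 b ∧ comp α hα hα0 c ≠ 0 := by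
  obtain ⟨n, α, hα, hα0, hn, hαn, hαc⟩ := exists_comp_eq_X_pow hc hc0
  obtain ⟨m, β, hβ, hβ0, hm, hβn, hβb⟩ := exists_comp_eq_X_pow hb hb0
  have hp : ∀ k : ℕ, AnalyticAt ℂ (fun t : ℂ => t ^ k) 0 := fun k => analyticAt_id.pow k
  have hX : ∀ (k l : ℕ) (hk : k ≠ 0), comp (fun t => t ^ k) (hp k) (zero_pow hk) (X ^ l) =
      X ^ (k * l) := by
    intro k l hk
    rw [map_pow, pow_mul]
    congr 1
  -- With normal forms `X ^ n` and `X ^ m`, the further substitutions `t ^ m` and `t ^ n` turn both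
  -- germs into `X ^ (m * n)`.
  have e1 : comp (α ∘ fun t => t ^ m) (AnalyticAt.comp (by simpa [hm] using hα) (hp m))
      (by simp [hα0, hm]) c = X ^ (m * n) := by
    rw [← hX m n hm, ← hαc, comp_comp]
  have e2 : comp (β ∘ fun t => t ^ n) (AnalyticAt.comp (by simpa [hn] using hβ) (hp n))
      (by simp [hβ0, hn]) b = X ^ (m * n) := by
    rw [mul_comm, ← hX n m hn, ← hβb, comp_comp]
  refine ⟨_, _, _, _, _, _, not_eventually_eq_zero_comp_pow hα hm hαn,
    not_eventually_eq_zero_comp_pow hβ hn hβn, e1.trans e2.symm, ?_⟩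
  rw [e1]
  exact pow_ne_zero _ X_ne_zero

end HolGerm

/-! ### Germs at smooth points of affine curves. -/

section Uniformizer

variable {A : Type} [CommRing A] [Algebra ℂ A]

/-- `π` generates the maximal ideal of the local ring of `A` at the point `φ`. -/
def IsUniformizer (φ : A →ₐ[ℂ] ℂ) (π : A) : Prop :=
  φ π = 0 ∧ ∀ a, φ a = 0 → ∃ s, φ s ≠ 0 ∧ π ∣ s * a

open HolGerm

/-- A holomorphic germ is determined by its base point and the value of a uniformizer. -/
theorem IsUniformizer.algHom_ext {φ : A →ₐ[ℂ] ℂ} {π : A} (hπ : IsUniformizer φ π)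
    {Ψ Χ : A →ₐ[ℂ] HolGerm} (hΨ : eval0.comp Ψ = φ) (hΧ : eval0.comp Χ = φ) (h : Ψ π = Χ π) :
    Ψ = Χ := by
  have hΨ' : ∀ a, eval0 (Ψ a) = φ a := fun a => congr($hΨ a)
  have hΧ' : ∀ a, eval0 (Χ a) = φ a := fun a => congr($hΧ a)
  -- The two maps agree modulo every power of `Ψ π`. Writing `s * a' = π * b`, the difference at
  -- `a'` becomes, up to the unit `Ψ s`, a combination of the differences at `b` and `s` whose
  -- coefficients are divisible by `Ψ π`.
  have key : ∀ (n : ℕ) (a : A), Ψ π ^ n ∣ Ψ a - Χ a := by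
    intro n
    induction n with
    | zero => simp
    | succ n ih =>
      intro a
      obtain ⟨s, hs, b, hb⟩ := hπ.2 (a - algebraMap ℂ A (φ a)) (by simp)
      have e0 : Ψ a - Χ a = Ψ (a - algebraMap ℂ A (φ a)) - Χ (a - algebraMap ℂ A (φ a)) := by
        simp
      rw [e0]
      generalize a - algebraMap ℂ A (φ a) = a' at hb ⊢
      have h1 : Ψ s * Ψ a' = Ψ π * Ψ b := by rw [← map_mul, hb, map_mul]
      have h2 : Χ s * Χ a' = Ψ π * Χ b := by rw [← map_mul, hb, map_mul, h]
      have us : IsUnit (Ψ s) := isUnit_of_eval0_ne_zero (by rwa [hΨ'])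
      have us' : IsUnit (Χ s) := isUnit_of_eval0_ne_zero (by rwa [hΧ'])
      have h3 : Ψ π ∣ Χ a' := us'.dvd_mul_left.1 ⟨_, h2⟩
      have h4 : Ψ s * (Ψ a' - Χ a') = Ψ π * (Ψ b - Χ b) - (Ψ s - Χ s) * Χ a' := by
        linear_combination h1 - h2
      rw [← us.dvd_mul_left, h4, pow_succ]
      refine dvd_sub ?_ (mul_dvd_mul (ih s) h3)
      rw [mul_comm]
      exact mul_dvd_mul_left _ (ih b)
  ext a
  rw [← sub_eq_zero]
  exact eq_zero_of_forall_pow_dvd (by rw [hΨ', hπ.1]) fun n => key n a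

theorem analyticAt_proj {σ : Type} [Fintype σ] (i : σ) (p : σ → ℂ) :
    AnalyticAt ℂ (fun w : σ → ℂ => w i) p :=
  (ContinuousLinearMap.proj (R := ℂ) (φ := fun _ : σ => ℂ) i).analyticAt p

theorem analyticAt_eval {E σ : Type} [NormedAddCommGroup E] [NormedSpace ℂ E] {w : E → σ → ℂ}
    {x : E} (hw : ∀ i, AnalyticAt ℂ (fun t => w t i) x) (G : MvPolynomial σ ℂ) :
    AnalyticAt ℂ (fun t => MvPolynomial.eval (w t) G) x :=
  AnalyticAt.aeval_mvPolynomial (A := ℂ) hw G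

theorem aeval_mk {σ : Type} [Fintype σ] {w : ℂ → σ → ℂ} (hw : ∀ i, AnalyticAt ℂ (fun t => w t i) 0)
    (G : MvPolynomial σ ℂ) :
    MvPolynomial.aeval (fun i => mk (fun t => w t i) (hw i)) G =
      mk (fun t => MvPolynomial.eval (w t) G) (analyticAt_eval hw G) := by
  induction G using MvPolynomial.induction_on with
  | C c =>
    simp only [MvPolynomial.aeval_C, MvPolynomial.eval_C]
    rfl
  | add G H hG hH =>
    rw [map_add, hG, hH]
    refine mk_eq_mk.2 (Eventually.of_forall fun t => ?_)
    exact (map_add _ _ _).symm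
  | mul_X G i hG =>
    rw [map_mul, hG, MvPolynomial.aeval_X, mk_mul]
    refine mk_eq_mk.2 (Eventually.of_forall fun t => ?_)
    simp

/-- The analytic solution of the equations `Sᵢ(w) wᵢ = t Aᵢ(w)`. -/
theorem exists_germ_solution {σ : Type} [Fintype σ] (S T : σ → MvPolynomial σ ℂ)
    (hS : ∀ i, MvPolynomial.eval 0 (S i) ≠ 0) :
    ∃ ev : MvPolynomial σ ℂ →ₐ[ℂ] HolGerm, (∀ G, eval0 (ev G) = MvPolynomial.eval 0 G) ∧
      ∀ i, ev (S i) * ev (MvPolynomial.X i) = X * ev (T i) := by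
  let F : ℂ × (σ → ℂ) → (σ → ℂ) := fun p i =>
    MvPolynomial.eval p.2 (S i) * p.2 i - p.1 * MvPolynomial.eval p.2 (T i)
  have hev : ∀ (G : MvPolynomial σ ℂ) (p : ℂ × (σ → ℂ)),
      AnalyticAt ℂ (fun p : ℂ × (σ → ℂ) => MvPolynomial.eval p.2 G) p := fun G p =>
    analyticAt_eval (fun i => (analyticAt_proj i p.2).comp analyticAt_snd) G
  have hF : AnalyticAt ℂ F (0, 0) := by
    rw [analyticAt_pi_iff]
    intro i
    refine ((hev (S i) _).mul ?_).sub (analyticAt_fst.mul (hev (T i) _))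
    exact (analyticAt_proj i _).comp analyticAt_snd
  -- At `t = 0` the system is `Sᵢ(w) * wᵢ`, whose linearization at `w = 0` is diagonal with entries
  -- `Sᵢ(0)`.
  let L : (σ → ℂ) ≃L[ℂ] (σ → ℂ) := ContinuousLinearEquiv.piCongrRight fun i =>
    ContinuousLinearEquiv.unitsEquivAut ℂ (Units.mk0 _ (hS i))
  have hL : HasFDerivAt (fun w => F (0, w)) (L : (σ → ℂ) →L[ℂ] (σ → ℂ)) 0 := by
    rw [hasFDerivAt_pi']
    intro i
    have h1 : HasFDerivAt (fun w : σ → ℂ => MvPolynomial.eval w (S i))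
        (fderiv ℂ (fun w : σ → ℂ => MvPolynomial.eval w (S i)) 0) 0 := by
      refine DifferentiableAt.hasFDerivAt (AnalyticAt.differentiableAt ?_)
      exact analyticAt_eval (fun i => analyticAt_proj i 0) (S i)
    have h2 := (ContinuousLinearMap.proj (R := ℂ) (φ := fun _ : σ => ℂ) i).hasFDerivAt (x := 0)
    have h3 := h1.mul h2
    have h4 : (fun w : σ → ℂ => F (0, w) i) = fun w => MvPolynomial.eval w (S i) * w i := by
      ext w
      simp [F]
    rw [h4]
    refine h3.congr_fderiv ?_
    ext v
    simp [L, mul_comm]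
  obtain ⟨w, hw, hw0, hwF⟩ := exists_analyticAt_implicit hF L hL
  have hwi : ∀ i, AnalyticAt ℂ (fun t => w t i) 0 := analyticAt_pi_iff.1 hw
  refine ⟨MvPolynomial.aeval fun i => mk (fun t => w t i) (hwi i), fun G => ?_, fun i => ?_⟩
  · rw [aeval_mk, eval0_mk, hw0]
  · rw [aeval_mk, aeval_mk, aeval_mk, X, mk_mul, mk_mul]
    refine mk_eq_mk.2 ?_
    filter_upwards [hwF] with t ht
    have h5 : F (0, 0) i = 0 := by simp [F]
    have h6 := congr_fun ht i
    rw [h5] at h6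
    simpa [F, sub_eq_zero] using h6

/-- A smooth point of an affine curve has a local holomorphic parametrization. -/
theorem IsUniformizer.exists_algHom [IsDomain A] [Algebra.FiniteType ℂ A] {φ : A →ₐ[ℂ] ℂ} {π : A}
    (hπ : IsUniformizer φ π) (hπ0 : π ≠ 0) :
    ∃ ψ : A →ₐ[ℂ] HolGerm, eval0.comp ψ = φ ∧ ψ π = X := by
  obtain ⟨n, g, hg⟩ := Algebra.FiniteType.iff_quotient_mvPolynomial''.1
    (inferInstance : Algebra.FiniteType ℂ A)
  -- Generators of `A` translated to vanish at the point, with `π` adjoined as the generator of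
  -- index `none`.
  let x : Option (Fin n) → A := fun i => i.elim π fun k =>
    g (MvPolynomial.X k) - algebraMap ℂ A (φ (g (MvPolynomial.X k)))
  have hx : ∀ i, φ (x i) = 0 := by
    rintro (_ | k)
    · exact hπ.1
    · simp [x]
  let ρ : MvPolynomial (Option (Fin n)) ℂ →ₐ[ℂ] A := MvPolynomial.aeval x
  have hρX : ∀ i, ρ (MvPolynomial.X i) = x i := fun i => by simp [ρ]
  have hρ : Function.Surjective ρ := by
    intro a
    obtain ⟨G, rfl⟩ := hg a
    refine ⟨MvPolynomial.aeval (fun k => MvPolynomial.X (some k) +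
      MvPolynomial.C (φ (g (MvPolynomial.X k)))) G, ?_⟩
    refine congr($(MvPolynomial.algHom_ext (f := ρ.comp (MvPolynomial.aeval _)) (g := g)
      fun k => ?_) G)
    simp [ρ, x]
  have hφρ : ∀ G, φ (ρ G) = MvPolynomial.eval 0 G := by
    intro G
    have : φ.comp ρ = MvPolynomial.aeval (0 : Option (Fin n) → ℂ) :=
      MvPolynomial.algHom_ext fun i => by simp [hρX, hx]
    exact congr($this G)
  -- The uniformizer property gives equations `S * xᵢ = π * T` with `S` a unit at the point. They
  -- are solved analytically with `π` replaced by the coordinate; choosing `S = T = 1` for `none`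
  -- forces `π` to go to `X`.
  have hST : ∀ i, ∃ S T : MvPolynomial (Option (Fin n)) ℂ, MvPolynomial.eval 0 S ≠ 0 ∧
      ρ S * x i = π * ρ T ∧ (i = none → S = 1 ∧ T = 1) := by
    rintro (_ | k)
    · exact ⟨1, 1, by simp, by simp [x, mul_comm], fun _ => ⟨rfl, rfl⟩⟩
    · obtain ⟨s, hs, a, ha⟩ := hπ.2 _ (hx (some k))
      obtain ⟨S, rfl⟩ := hρ s
      obtain ⟨T, rfl⟩ := hρ a
      exact ⟨S, T, by rwa [← hφρ], ha, fun h => by simp at h⟩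
  choose S T hS hSx hnone using hST
  obtain ⟨ev, hev0, hev⟩ := exists_germ_solution S T hS
  -- Up to a unit at the point, `G - G(0)` is divisible by `π` in `A` and by `X` among germs, with
  -- the same polynomial `G'` representing both quotients.
  have step : ∀ G, ∃ U G', MvPolynomial.eval 0 U ≠ 0 ∧
      ρ (U * (G - MvPolynomial.C (MvPolynomial.eval 0 G))) = π * ρ G' ∧
      ev (U * (G - MvPolynomial.C (MvPolynomial.eval 0 G))) = X * ev G' := by
    intro G
    induction G using MvPolynomial.induction_on with
    | C c => exact ⟨1, 0, by simp, by simp, by simp⟩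
    | add G H hG hH =>
      obtain ⟨U, G', hU, h1, h2⟩ := hG
      obtain ⟨W, H', hW, h3, h4⟩ := hH
      refine ⟨U * W, W * G' + U * H', by rw [map_mul]; exact mul_ne_zero hU hW, ?_, ?_⟩
      · simp only [map_mul, map_sub, map_add] at h1 h3 ⊢
        linear_combination ρ W * h1 + ρ U * h3
      · simp only [map_mul, map_sub, map_add] at h2 h4 ⊢
        linear_combination ev W * h2 + ev U * h4
    | mul_X G i _ =>
      refine ⟨S i, G * T i, hS i, ?_, ?_⟩
      · have := hSx i
        simp only [map_mul, hρX, MvPolynomial.eval_X, Pi.zero_apply, mul_zero, map_zero,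
          sub_zero]
        linear_combination ρ G * this
      · have := hev i
        simp only [map_mul, MvPolynomial.eval_X, Pi.zero_apply, mul_zero, map_zero,
          sub_zero]
        linear_combination ev G * this
  -- A relation `ρ G = 0` can be divided by `π` forever, as `A` is a domain. The parallel divisions
  -- by `X` show that `ev G` is divisible by every power of `X`, so `ev` descends to `A`.
  have hker : ∀ G, ρ G = 0 → ev G = 0 := by
    intro G hG
    have iter : ∀ k : ℕ, ∃ U G', MvPolynomial.eval 0 U ≠ 0 ∧ ρ (U * G) = π ^ k * ρ G' ∧
        ev (U * G) = X ^ k * ev G' := by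
      intro k
      induction k with
      | zero => exact ⟨1, G, by simp, by simp, by simp⟩
      | succ k ih =>
        obtain ⟨U, G', hU, h1, h2⟩ := ih
        have h3 : ρ G' = 0 := by
          rw [map_mul, hG, mul_zero] at h1
          exact (mul_eq_zero.1 h1.symm).resolve_left (pow_ne_zero k hπ0)
        have h4 : MvPolynomial.eval 0 G' = 0 := by rw [← hφρ, h3, map_zero]
        obtain ⟨W, G'', hW, h5, h6⟩ := step G'
        rw [h4, map_zero, sub_zero] at h5 h6
        refine ⟨W * U, G'', by rw [map_mul]; exact mul_ne_zero hW hU, ?_, ?_⟩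
        · rw [map_mul] at h1 h5
          rw [map_mul, map_mul, mul_assoc, h1]
          linear_combination π ^ k * h5
        · rw [map_mul] at h2 h6
          rw [map_mul, map_mul, mul_assoc, h2]
          linear_combination X ^ k * h6
    refine eq_zero_of_forall_pow_dvd eval0_X fun k => ?_
    obtain ⟨U, G', hU, -, h2⟩ := iter k
    have us : IsUnit (ev U) := isUnit_of_eval0_ne_zero (by rwa [hev0])
    rw [← us.dvd_mul_left, ← map_mul, h2]
    exact dvd_mul_right _ _
  let ψ : A →ₐ[ℂ] HolGerm := (Ideal.Quotient.liftₐ (RingHom.ker ρ) ev fun G hG => hker G hG).comp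
    (Ideal.quotientKerAlgEquivOfSurjective hρ).symm.toAlgHom
  have hψ : ∀ G, ψ (ρ G) = ev G := by
    intro G
    have : (Ideal.quotientKerAlgEquivOfSurjective hρ).symm (ρ G) = Ideal.Quotient.mk _ G := by
      rw [AlgEquiv.symm_apply_eq]
      rfl
    change Ideal.Quotient.liftₐ _ _ (fun G hG => hker G hG) ((Ideal.quotientKerAlgEquivOfSurjective hρ).symm (ρ G)) = _
    rw [this]
    rfl
  refine ⟨ψ, ?_, ?_⟩
  · ext a
    obtain ⟨G, rfl⟩ := hρ a
    change eval0 (ψ (ρ G)) = _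
    rw [hψ, hev0, hφρ]
  · have h1 := hev none
    rw [(hnone none rfl).1, (hnone none rfl).2, map_one, one_mul, mul_one] at h1
    have h2 : ρ (MvPolynomial.X none) = π := hρX none
    rw [← h2, hψ, h1]

end Uniformizer

/-! ### Uniformizers from the normalization of a curve. -/

section Normalization

/-- Take `π ∈ p \ p ^ 2` and factor `(π) = p * I`. Then `I` is not contained in `p`, and any `s ∈ I
\ p` gives `s * p ⊆ (π)`. -/
theorem exists_local_generator {D : Type*} [CommRing D] [IsDedekindDomain D] (p : Ideal D)
    [p.IsPrime] (hp : p ≠ ⊥) : ∃ π ∈ p, π ≠ 0 ∧ ∀ a ∈ p, ∃ s ∉ p, π ∣ s * a := by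
  have hlt : p ^ 2 < p := by
    simpa using Ideal.pow_right_strictAnti p hp (Ideal.IsPrime.ne_top ‹_›) one_lt_two
  obtain ⟨π, hπ, hπ'⟩ := SetLike.exists_of_lt hlt
  obtain ⟨I, hI⟩ := Ideal.dvd_span_singleton.2 hπ
  have hIp : ¬ I ≤ p := fun h => hπ' <| by
    rw [← Ideal.span_singleton_le_iff_mem, hI, pow_two]
    exact Ideal.mul_mono_right h
  obtain ⟨s, hs, hs'⟩ := SetLike.not_le_iff_exists.1 hIp
  refine ⟨π, hπ, fun h => hπ' (h ▸ zero_mem _), fun a ha => ⟨s, hs', ?_⟩⟩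
  rw [← Ideal.mem_span_singleton, hI, mul_comm s]
  exact Ideal.mul_mem_mul ha hs

/-- Divisibility is total in the discrete valuation ring `D_p`; the element `s` clears the
denominator. -/
theorem exists_notMem_dvd_mul_or {D : Type*} [CommRing D] [IsDedekindDomain D] (p : Ideal D)
    [p.IsPrime] (hp : p ≠ ⊥) (x y : D) : ∃ s ∉ p, y ∣ s * x ∨ x ∣ s * y := by
  have : IsDiscreteValuationRing (Localization.AtPrime p) :=
    IsLocalization.AtPrime.isDiscreteValuationRing_of_dedekind_domain D hp _
  have key : ∀ x y : D, algebraMap D (Localization.AtPrime p) y ∣ algebraMap D _ x →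
      ∃ s ∉ p, y ∣ s * x := by
    rintro x y ⟨z, hz⟩
    obtain ⟨d, s, rfl⟩ := IsLocalization.exists_mk'_eq p.primeCompl z
    refine ⟨s, s.2, d, IsLocalization.injective (Localization.AtPrime p)
      p.primeCompl_le_nonZeroDivisors ?_⟩
    rw [map_mul, map_mul, hz, mul_left_comm, mul_comm (algebraMap D _ _) (IsLocalization.mk' _ _ _),
      IsLocalization.mk'_spec]
  rcases ValuationRing.dvd_total (algebraMap D (Localization.AtPrime p) y) (algebraMap D _ x) with
    h | h
  · obtain ⟨s, hs, h⟩ := key _ _ h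
    exact ⟨s, hs, .inl h⟩
  · obtain ⟨s, hs, h⟩ := key _ _ h
    exact ⟨s, hs, .inr h⟩

variable {K : Type*} [Field K] [Algebra ℂ K] {Γ : Type*} [LinearOrderedCommGroupWithZero Γ]

/-- The centre `p` of `v` on `D` has a local generator, but `D` need not contain `B`. Inverting one
element outside `p` brings the generators of `B` in, without changing the local ring at `p`. -/
theorem exists_uniformizer_of_isDedekindDomain (v : Valuation K Γ)
    (D : Subalgebra ℂ K) (hD : D.FG) [IsDedekindDomain D] (hfrac : ∀ x : K, ∃ a ∈ D, ∃ b ∈ D,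
      b ≠ 0 ∧ x = a / b) (hDv : ∀ a ∈ D, v a ≤ 1) (t : K) (htD : t ∈ D) (ht0 : t ≠ 0)
    (htv : v t < 1) (B : Subalgebra ℂ K) (hB : B.FG) (hBv : ∀ b ∈ B, v b ≤ 1) :
    ∃ A : Subalgebra ℂ K, A.FG ∧ B ≤ A ∧ (∀ a ∈ A, v a ≤ 1) ∧ ∃ π ∈ A, π ≠ 0 ∧ v π < 1 ∧
      ∀ a ∈ A, v a < 1 → ∃ s ∈ A, ¬ v s < 1 ∧ ∃ b ∈ A, s * a = π * b := by
  let p : Ideal D :=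
    { carrier := {a | v a < 1}
      add_mem' := fun {a b} ha hb => v.map_add_lt ha hb
      zero_mem' := by simp
      smul_mem' := fun c a ha => by
        simp only [smul_eq_mul, Set.mem_ofPred_eq, MulMemClass.coe_mul, map_mul]
        exact lt_of_le_of_lt (mul_le_of_le_one_left' (hDv c c.2)) ha }
  have mem_p : ∀ a : D, a ∈ p ↔ v a < 1 := fun a => Iff.rfl
  have notMem_p : ∀ a : D, a ∉ p ↔ v a = 1 := fun a => by
    rw [mem_p, not_lt]
    exact ⟨fun h => le_antisymm (hDv a a.2) h, fun h => h.ge⟩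
  have hp : p.IsPrime := by
    refine ⟨?_, fun {a b} hab => ?_⟩
    · rw [Ideal.ne_top_iff_one, notMem_p]
      simp
    · by_contra! h
      rw [notMem_p, notMem_p] at h
      rw [mem_p] at hab
      simp [h.1, h.2] at hab
  have hp0 : p ≠ ⊥ := fun h => ht0 <| by
    have : (⟨t, htD⟩ : D) ∈ p := htv
    rw [h, Ideal.mem_bot] at this
    exact congr_arg Subtype.val this
  obtain ⟨π, hπ, hπ0, hπg⟩ := exists_local_generator p hp0
  -- Every element integral for `v` has a denominator outside `p`. For `b = x / y`, if `x` divides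
  -- `s * y` with quotient `d`, then `v b ≤ 1` forces `v d = 1`, and `d` is the denominator.
  have hs1 : ∀ b : K, v b ≤ 1 → ∃ s : D, s ∉ p ∧ (s : K) * b ∈ D := by
    intro b hb
    obtain ⟨x, hx, y, hy, hy0, rfl⟩ := hfrac b
    obtain ⟨s, hs, ⟨d, hd⟩ | ⟨d, hd⟩⟩ := exists_notMem_dvd_mul_or p hp0 ⟨x, hx⟩ ⟨y, hy⟩
    · have hd : (s : K) * x = y * d := congr_arg Subtype.val hd
      refine ⟨s, hs, ?_⟩
      rw [← mul_div_assoc, hd, mul_div_cancel_left₀ _ hy0]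
      exact d.2
    · have hd : (s : K) * y = x * d := congr_arg Subtype.val hd
      have h1 : v y = v x * v d := by
        rw [← map_mul, ← hd, map_mul, (notMem_p s).1 hs, one_mul]
      have hvy : 0 < v y := by simpa [zero_lt_iff] using hy0
      rw [map_div₀, div_le_one₀ hvy] at hb
      refine ⟨d, fun hdp => ?_, ?_⟩
      · have h2 : v x ≠ 0 := fun h => by simp [h1, h] at hvy
        have h3 : v x * v d < v x * 1 := mul_lt_mul_of_pos_left hdp (zero_lt_iff.2 h2)
        rw [mul_one, ← h1] at h3
        exact absurd hb h3.not_ge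
      · have : (d : K) * (x / y) = s := by
          rw [← mul_div_assoc, mul_comm, ← hd, mul_div_cancel_right₀ _ hy0]
        rw [this]
        exact s.2
  obtain ⟨F, rfl⟩ := hB
  have hs2 : ∃ s : D, s ∉ p ∧ ∀ b ∈ F, (s : K) * b ∈ D := by
    have : ∀ b ∈ F, v b ≤ 1 := fun b hb => hBv b (Algebra.subset_adjoin hb)
    clear hBv
    induction F using Finset.cons_induction with
    | empty => exact ⟨1, by simp [notMem_p], by simp⟩
    | cons b F hbF ih =>
      obtain ⟨s, hs, h⟩ := ih fun b hb => this b (by simp [hb])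
      obtain ⟨s', hs', h'⟩ := hs1 b (this b (by simp))
      refine ⟨s * s', fun h => (hp.mem_or_mem h).elim hs hs', fun c hc => ?_⟩
      rcases Finset.mem_cons.1 hc with rfl | hc
      · simpa [mul_assoc] using D.mul_mem s.2 h'
      · simpa [mul_assoc, mul_left_comm] using D.mul_mem s'.2 (h c hc)
  obtain ⟨s, hs, hsF⟩ := hs2
  have hvs : v s = 1 := (notMem_p s).1 hs
  have hs0 : (s : K) ≠ 0 := fun h => by simp [h] at hvs
  let A := D ⊔ Algebra.adjoin ℂ {(s : K)⁻¹}
  have hDA : D ≤ A := le_sup_left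
  have hsA : ∀ n : ℕ, ((s : K) ^ n)⁻¹ ∈ A := fun n => by
    rw [← inv_pow]
    exact A.pow_mem (le_sup_right (a := D) (Algebra.subset_adjoin rfl)) n
  have hAeq : A = Algebra.adjoin ℂ ((D : Set K) ∪ {(s : K)⁻¹}) := by
    rw [Algebra.adjoin_union, Algebra.adjoin_eq]
  have hA : ∀ a ∈ A, ∃ n : ℕ, (s : K) ^ n * a ∈ D := by
    intro a ha
    rw [hAeq] at ha
    induction ha using Algebra.adjoin_induction with
    | mem x hx =>
      rcases hx with hx | rfl
      · exact ⟨0, by simpa using hx⟩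
      · exact ⟨1, by simp [hs0]⟩
    | algebraMap r => exact ⟨0, by simp⟩
    | add x y hx hy ihx ihy =>
      obtain ⟨n, hn⟩ := ihx
      obtain ⟨m, hm⟩ := ihy
      refine ⟨n + m, ?_⟩
      have : (s : K) ^ (n + m) * (x + y) = s ^ m * (s ^ n * x) + s ^ n * (s ^ m * y) := by ring
      rw [this]
      exact D.add_mem (D.mul_mem (D.pow_mem s.2 m) hn) (D.mul_mem (D.pow_mem s.2 n) hm)
    | mul x y hx hy ihx ihy =>
      obtain ⟨n, hn⟩ := ihx
      obtain ⟨m, hm⟩ := ihy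
      refine ⟨n + m, ?_⟩
      have : (s : K) ^ (n + m) * (x * y) = (s ^ n * x) * (s ^ m * y) := by ring
      rw [this]
      exact D.mul_mem hn hm
  have hAv : ∀ a (n : ℕ), v ((s : K) ^ n * a) = v a := fun a n => by simp [hvs]
  refine ⟨A, hD.sup (by simpa using Subalgebra.fg_adjoin_finset {(s : K)⁻¹}), ?_, ?_, π, hDA π.2, by simpa using hπ0,
    hπ, ?_⟩
  · refine Algebra.adjoin_le fun b hb => ?_
    have : b = s * b * ((s : K) ^ 1)⁻¹ := by field_simp
    rw [this]
    exact A.mul_mem (hDA (hsF b hb)) (hsA 1)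
  · intro a ha
    obtain ⟨n, hn⟩ := hA a ha
    rw [← hAv a n]
    exact hDv _ hn
  · intro a ha hva
    obtain ⟨n, hn⟩ := hA a ha
    obtain ⟨s', hs', b, hb⟩ := hπg ⟨_, hn⟩ (by rw [mem_p]; simpa [hvs] using hva)
    refine ⟨s', hDA s'.2, hs', b * ((s : K) ^ n)⁻¹, A.mul_mem (hDA b.2) (hsA n), ?_⟩
    have hb : (s' : K) * (s ^ n * a) = π * b := congr_arg Subtype.val hb
    rw [← mul_assoc, ← hb]
    field_simp

/-- `D` is the integral closure of `ℂ[t]` in `K`. It is finite over `ℂ[t]` because `K` is finite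
over `ℂ(t)`, and `v ≤ 1` on it because valuation rings are integrally closed. -/
theorem exists_isDedekindDomain (v : Valuation K Γ) (B : Subalgebra ℂ K) (hB : B.FG)
    (hBv : ∀ b ∈ B, v b ≤ 1) (hfrac : ∀ x : K, ∃ a ∈ B, ∃ b ∈ B, b ≠ 0 ∧ x = a / b)
    (htr : Algebra.trdeg ℂ B ≤ 1) (t : K) (ht : t ∈ B) (ht0 : t ≠ 0) (htv : v t < 1) :
    ∃ D : Subalgebra ℂ K, D.FG ∧ IsDedekindDomain D ∧ (∀ x : K, ∃ a ∈ D, ∃ b ∈ D,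
      b ≠ 0 ∧ x = a / b) ∧ (∀ a ∈ D, v a ≤ 1) ∧ t ∈ D := by
  -- An algebraic `t` would be a nonzero constant; its inverse would lie in `B` and have value
  -- greater than `1`.
  have htt : Transcendental ℂ t := by
    intro h
    obtain ⟨c, rfl⟩ := minpoly.mem_range_of_degree_eq_one ℂ t <|
      IsAlgClosed.degree_eq_one_of_irreducible ℂ (minpoly.irreducible h.isIntegral)
    have h1 := hBv _ (B.algebraMap_mem c⁻¹)
    rw [map_inv₀, map_inv₀, inv_le_one₀ (by simpa [zero_lt_iff] using ht0)] at h1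
    exact htv.not_ge h1
  let φ : Polynomial ℂ →ₐ[ℂ] K := Polynomial.aeval t
  have hφ : Function.Injective φ := transcendental_iff_injective.1 htt
  let : Algebra (Polynomial ℂ) K := φ.toRingHom.toAlgebra
  have hmap : ∀ q, algebraMap (Polynomial ℂ) K q = Polynomial.aeval t q := fun q => rfl
  have : IsScalarTower ℂ (Polynomial ℂ) K := IsScalarTower.of_algHom φ
  have : FaithfulSMul (Polynomial ℂ) K := (faithfulSMul_iff_algebraMap_injective _ _).2 hφ
  let := FractionRing.liftAlgebra (Polynomial ℂ) K
  have : IsScalarTower ℂ (FractionRing (Polynomial ℂ)) K := IsScalarTower.to₁₃₄ ℂ (Polynomial ℂ) _ K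
  have : Algebra.EssFiniteType ℂ K := by
    rw [Algebra.essFiniteType_iff]
    obtain ⟨F, rfl⟩ := hB
    refine ⟨F, fun x => ?_⟩
    obtain ⟨a, ha, b, hb, hb0, rfl⟩ := hfrac x
    exact ⟨b, hb, hb0.isUnit, by rwa [div_mul_cancel₀ _ hb0]⟩
  have : Algebra.EssFiniteType (FractionRing (Polynomial ℂ)) K :=
    Algebra.EssFiniteType.of_comp ℂ _ _
  have : Algebra.IsAlgebraic (FractionRing (Polynomial ℂ)) K := by
    have : Algebra.IsAlgebraic B K := ⟨fun x => by
      obtain ⟨a, ha, b, hb, hb0, rfl⟩ := hfrac x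
      rw [div_eq_mul_inv]
      exact (isAlgebraic_algebraMap (⟨a, ha⟩ : B)).mul (isAlgebraic_algebraMap (⟨b, hb⟩ : B)).inv⟩
    -- In transcendence degree at most one, the single transcendental element `t` is already a
    -- transcendence basis.
    have h1 : AlgebraicIndependent ℂ fun _ : Unit => (⟨t, ht⟩ : B) := by
      rw [algebraicIndependent_unique_type_iff]
      exact fun h => htt (h.algHom B.val)
    have h2 := (h1.isTranscendenceBasis_of_lift_trdeg_le_of_finite (by simpa using htr)).algebraMap_comp
      (A := K)
    refine h2.isAlgebraic_iff.2 fun _ => ?_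
    have h3 : t = algebraMap (FractionRing (Polynomial ℂ)) K 
        (algebraMap (Polynomial ℂ) _ Polynomial.X) := by
      rw [← IsScalarTower.algebraMap_apply, hmap, Polynomial.aeval_X]
    change IsAlgebraic _ t
    rw [h3]
    exact isAlgebraic_algebraMap _
  have : FiniteDimensional (FractionRing (Polynomial ℂ)) K :=
    Algebra.finite_of_essFiniteType_of_isAlgebraic
  have hDed := integralClosure.isDedekindDomain (Polynomial ℂ) (FractionRing (Polynomial ℂ)) K
  have := IsIntegralClosure.finite (Polynomial ℂ) (FractionRing (Polynomial ℂ)) K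
    (integralClosure (Polynomial ℂ) K)
  have := integralClosure.isFractionRing_of_finite_extension (A := Polynomial ℂ)
    (FractionRing (Polynomial ℂ)) K
  refine ⟨(integralClosure (Polynomial ℂ) K).restrictScalars ℂ, ?_, hDed, ?_, ?_, ?_⟩
  · rw [Subalgebra.fg_iff_finiteType]
    have : IsScalarTower ℂ (Polynomial ℂ) (integralClosure (Polynomial ℂ) K) :=
      IsScalarTower.of_algebraMap_eq fun x =>
        Subtype.ext (IsScalarTower.algebraMap_apply ℂ (Polynomial ℂ) K x)
    have h : Algebra.FiniteType ℂ (integralClosure (Polynomial ℂ) K) :=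
      Algebra.FiniteType.trans (S := Polynomial ℂ) inferInstance inferInstance
    exact h
  · intro x
    obtain ⟨a, b, hb, rfl⟩ := IsFractionRing.div_surjective (integralClosure (Polynomial ℂ) K) x
    exact ⟨a, a.2, b, b.2, by simpa using nonZeroDivisors.ne_zero hb, rfl⟩
  · intro a ha
    have ha : (algebraMap (Polynomial ℂ) K).IsIntegralElem a := ha
    have hvφ : ∀ q, φ q ∈ v.integer := by
      intro q
      have h0 : Algebra.adjoin ℂ {t} ≤ B := Algebra.adjoin_le (by simpa using ht)
      exact hBv _ (h0 (Polynomial.aeval_mem_adjoin_singleton ℂ t))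
    have h1 : algebraMap (Polynomial ℂ) K = v.integer.subtype.comp (φ.toRingHom.codRestrict _ hvφ) :=
      rfl
    rw [h1] at ha
    exact (Valuation.integer.integers v).mem_of_integral ha.of_comp
  · have := (integralClosure (Polynomial ℂ) K).algebraMap_mem Polynomial.X
    rwa [hmap, Polynomial.aeval_X] at this

theorem exists_uniformizer (v : Valuation K Γ) (B : Subalgebra ℂ K) (hB : B.FG)
    (hBv : ∀ b ∈ B, v b ≤ 1) (hfrac : ∀ x : K, ∃ a ∈ B, ∃ b ∈ B, b ≠ 0 ∧ x = a / b)
    (htr : Algebra.trdeg ℂ B ≤ 1) (t : K) (ht : t ∈ B) (ht0 : t ≠ 0) (htv : v t < 1) :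
    ∃ A : Subalgebra ℂ K, A.FG ∧ B ≤ A ∧ (∀ a ∈ A, v a ≤ 1) ∧ ∃ π ∈ A, π ≠ 0 ∧ v π < 1 ∧
      ∀ a ∈ A, v a < 1 → ∃ s ∈ A, ¬ v s < 1 ∧ ∃ b ∈ A, s * a = π * b := by
  obtain ⟨D, hD, hDed, hDfrac, hDv, htD⟩ :=
    exists_isDedekindDomain v B hB hBv hfrac htr t ht ht0 htv
  exact exists_uniformizer_of_isDedekindDomain v D hD hDfrac hDv t htD ht0 htv B hB hBv

end Normalization

/-! ### Smooth models of affine curves, branches, and factorization of germs. -/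

section Branch

open HolGerm

variable {B : Type} [CommRing B] [Algebra ℂ B] [Algebra.FiniteType ℂ B] [IsDomain B]
  {Γ : Type*} [LinearOrderedCommGroupWithZero Γ]

omit [Algebra.FiniteType ℂ B] in
theorem trdeg_fractionRing : Algebra.trdeg ℂ (FractionRing B) = Algebra.trdeg ℂ B := by
  have h1 := _root_.trdeg_add_eq ℂ B (A := FractionRing B)
  have := IsLocalization.isAlgebraic (R := B) (S := FractionRing B) (nonZeroDivisors B)
  rw [← h1, _root_.trdeg_eq_zero (R := B), add_zero]

/-- A valuation of the function field of an affine curve is centered at a smooth point of another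
affine model of it. -/
theorem exists_smooth_model (htr : Algebra.trdeg ℂ B ≤ 1) (v : Valuation (FractionRing B) Γ)
    (hv : ∀ b : B, v (algebraMap B _ b) ≤ 1) {t : B} (ht0 : t ≠ 0)
    (ht : v (algebraMap B _ t) < 1) :
    ∃ A : Subalgebra ℂ (FractionRing B), A.FG ∧ Algebra.trdeg ℂ A ≤ 1 ∧
      (∀ b : B, algebraMap B _ b ∈ A) ∧ (∀ a ∈ A, v a ≤ 1) ∧
      ∃ φ : A →ₐ[ℂ] ℂ, (∀ a, φ a = 0 ↔ v a < 1) ∧ ∃ π : A, π ≠ 0 ∧ IsUniformizer φ π := by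
  let i : B →ₐ[ℂ] FractionRing B := IsScalarTower.toAlgHom ℂ B _
  have hi : Function.Injective i := IsFractionRing.injective B (FractionRing B)
  have hfg : i.range.FG := by
    rw [← Algebra.map_top]
    exact Subalgebra.FG.map i Algebra.FiniteType.out
  have htr' : Algebra.trdeg ℂ i.range ≤ 1 := by
    rwa [← (AlgEquiv.ofInjective i hi).trdeg_eq]
  obtain ⟨A, hA, hBA, hAv, π, hπA, hπ0, hπv, hπ⟩ := exists_uniformizer v i.range hfg
    (by rintro _ ⟨b, rfl⟩; exact hv b) (fun x => by
      obtain ⟨a, b, hb, rfl⟩ := IsFractionRing.div_surjective B x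
      exact ⟨_, ⟨a, rfl⟩, _, ⟨b, rfl⟩, by simpa [i] using nonZeroDivisors.ne_zero hb, rfl⟩)
    htr' (i t) ⟨t, rfl⟩ (by simpa [i] using ht0) ht
  have htrA : Algebra.trdeg ℂ A ≤ 1 := by
    refine (_root_.trdeg_le_of_injective A.val Subtype.val_injective).trans ?_
    rwa [trdeg_fractionRing]
  have : Algebra.FiniteType ℂ A := (Subalgebra.fg_iff_finiteType A).1 hA
  let q : Ideal A :=
    { carrier := {a | v a < 1}
      add_mem' := fun {a b} ha hb => v.map_add_lt ha hb
      zero_mem' := by simp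
      smul_mem' := fun c a ha => by
        simp only [smul_eq_mul, Set.mem_ofPred_eq, MulMemClass.coe_mul, map_mul]
        exact lt_of_le_of_lt (mul_le_of_le_one_left' (hAv c c.2)) ha }
  have mem_q : ∀ a : A, a ∈ q ↔ v a < 1 := fun a => Iff.rfl
  have notMem_q : ∀ a : A, a ∉ q ↔ v a = 1 := fun a => by
    rw [mem_q, not_lt]
    exact ⟨fun h => le_antisymm (hAv a a.2) h, fun h => h.ge⟩
  have hq : q.IsPrime := by
    refine ⟨?_, fun {a b} hab => ?_⟩
    · rw [Ideal.ne_top_iff_one, notMem_q]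
      simp
    · by_contra! h
      rw [notMem_q, notMem_q] at h
      rw [mem_q] at hab
      simp [h.1, h.2] at hab
  have hπq : (⟨π, hπA⟩ : A) ∈ q := hπv
  have hπ0' : (⟨π, hπA⟩ : A) ≠ 0 := fun h => hπ0 (congr_arg Subtype.val h)
  -- The centre `q` of `v` on `A` contains `π ≠ 0`; on a curve it is therefore maximal, that is, a
  -- complex point.
  have := isMaximal_of_trdeg_le_one htrA q fun h => hπ0' (by rwa [h, Ideal.mem_bot] at hπq)
  obtain ⟨φ, hφ⟩ := exists_algHom_ker_eq q
  have hφ' : ∀ a, φ a = 0 ↔ v a < 1 := fun a => by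
    rw [← mem_q, ← hφ, RingHom.mem_ker]
  refine ⟨A, hA, htrA, fun b => hBA ⟨b, rfl⟩, hAv, φ, hφ', ⟨π, hπA⟩, hπ0', (hφ' _).2 hπv,
    fun a ha => ?_⟩
  obtain ⟨s, hs, hvs, b, hb, h⟩ := hπ a a.2 ((hφ' a).1 ha)
  exact ⟨⟨s, hs⟩, fun h => hvs ((hφ' _).1 h), ⟨b, hb⟩, Subtype.ext h⟩

/-- An affine curve has a branch at each of its points. -/
theorem exists_injective_algHom (htr : Algebra.trdeg ℂ B ≤ 1) (φ : B →ₐ[ℂ] ℂ)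
    (hφ : RingHom.ker φ ≠ ⊥) :
    ∃ ψ : B →ₐ[ℂ] HolGerm, Function.Injective ψ ∧ eval0.comp ψ = φ := by
  let i : B →ₐ[ℂ] FractionRing B := IsScalarTower.toAlgHom ℂ B _
  have hi : Function.Injective i := IsFractionRing.injective B (FractionRing B)
  let e : B ≃+* i.range := (AlgEquiv.ofInjective i hi).toRingEquiv
  -- A valuation ring of the function field dominating the local ring at `φ`; its centre on a smooth
  -- model lies over `φ`.
  obtain ⟨V, hV, hIV⟩ := Ideal.image_subset_nonunits_valuationSubring (A := i.range.toSubring)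
    (Ideal.comap e.symm (RingHom.ker φ)) (Ideal.comap_ne_top _ (RingHom.ker_ne_top _))
  have hker : ∀ b, φ b = 0 → V.valuation (i b) < 1 := fun b hb => by
    rw [← ValuationSubring.mem_nonunits_iff]
    refine hIV ⟨e b, ?_, rfl⟩
    simpa using hb
  obtain ⟨t, ht, ht0⟩ := Submodule.exists_mem_ne_zero_of_ne_bot hφ
  obtain ⟨A, hA, htrA, hBA, hAv, ξ, hξ, π, hπ0, hπ⟩ := exists_smooth_model htr V.valuation
    (fun b => (V.valuation_le_one_iff _).2 (hV ⟨b, rfl⟩)) ht0 (hker t ht)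
  have : Algebra.FiniteType ℂ A := (Subalgebra.fg_iff_finiteType A).1 hA
  obtain ⟨ψ, hψ, hψπ⟩ := hπ.exists_algHom hπ0
  let j : B →ₐ[ℂ] A := i.codRestrict A hBA
  have hj : Function.Injective j := fun a b h => hi (congr_arg Subtype.val h)
  -- A nonzero kernel would be maximal, hence equal to the ideal of the centre, which contains `π`;
  -- but `ψ π = X ≠ 0`.
  have hψi : Function.Injective ψ := by
    rw [injective_iff_map_eq_zero]
    by_contra! h
    obtain ⟨a, ha, ha0⟩ := h
    have h1 : RingHom.ker ψ ≠ ⊥ := fun h => ha0 (by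
      have : a ∈ RingHom.ker ψ := ha
      rwa [h, Ideal.mem_bot] at this)
    have := RingHom.ker_isPrime ψ
    have h2 := isMaximal_of_trdeg_le_one htrA (RingHom.ker ψ) h1
    have h3 : RingHom.ker ψ ≤ RingHom.ker ξ := fun a ha => by
      rw [RingHom.mem_ker] at ha ⊢
      rw [← hψ, AlgHom.comp_apply, ha, map_zero]
    have h4 := h2.eq_of_le (RingHom.ker_ne_top _) h3
    have h5 : π ∈ RingHom.ker ψ := h4 ▸ hπ.1
    exact X_ne_zero (hψπ ▸ h5)
  refine ⟨ψ.comp j, hψi.comp hj, ?_⟩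
  rw [← AlgHom.comp_assoc, hψ]
  refine (algHom_ext_of_ker_le fun b hb => ?_).symm
  exact (hξ _).2 (hker b hb)

/-- A holomorphic germ on an affine curve factors through an affine curve which is smooth at the
base point of the germ. -/
theorem exists_smooth_model_germ (htr : Algebra.trdeg ℂ B ≤ 1) (Ψ : B →ₐ[ℂ] HolGerm)
    (hΨ : Function.Injective Ψ) {t : B} (ht0 : t ≠ 0) (ht : eval0 (Ψ t) = 0) :
    ∃ (A : Type) (_ : CommRing A) (_ : Algebra ℂ A) (_ : Algebra.FiniteType ℂ A) (_ : IsDomain A)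
      (ι : B →ₐ[ℂ] A) (Χ : A →ₐ[ℂ] HolGerm) (π : A), Algebra.trdeg ℂ A ≤ 1 ∧
        Function.Injective Χ ∧ Χ.comp ι = Ψ ∧ π ≠ 0 ∧ IsUniformizer (eval0.comp Χ) π := by
  let L := FractionRing HolGerm
  let J : HolGerm →ₐ[ℂ] L := IsScalarTower.toAlgHom ℂ HolGerm _
  have hJ : Function.Injective J := IsFractionRing.injective HolGerm L
  -- The valuation used is the order of vanishing along the germ, pulled back to the function field
  -- through `Ψ`. Elements of the model `A` then have integral image, which is what extends the germ
  -- from `B` to `A`.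
  let w := ValuationRing.valuation HolGerm L
  have hw : w.Integers HolGerm := ⟨hJ, fun x => (ValuationRing.mem_integer_iff _ _ _).2 ⟨x, rfl⟩,
    fun x hx => (ValuationRing.mem_integer_iff _ _ _).1 hx⟩
  have hw1 : ∀ a, w (J a) < 1 ↔ eval0 a = 0 := fun a => by
    have h1 : w (J a) = 1 ↔ IsUnit a := hw.isUnit_iff_valuation_eq_one.symm
    rw [isUnit_iff] at h1
    rw [← not_iff_not, ← ne_eq (eval0 a), ← h1, not_lt]
    exact ⟨fun h => le_antisymm (hw.map_le_one a) h, fun h => h.ge⟩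
  let F : FractionRing B →ₐ[ℂ] L := IsFractionRing.liftAlgHom (g := J.comp Ψ) (hJ.comp hΨ)
  have hF : ∀ b, F (algebraMap B _ b) = J (Ψ b) := fun b =>
    IsFractionRing.lift_algebraMap (g := (J.comp Ψ).toRingHom) (hJ.comp hΨ) b
  obtain ⟨A, hA, htrA, hBA, hAv, ξ, hξ, π, hπ0, hπ⟩ := exists_smooth_model htr (w.comap F.toRingHom)
    (fun b => (congr_arg w (hF b)).trans_le (hw.map_le_one _)) ht0
    ((congr_arg w (hF t)).trans_lt ((hw1 _).2 ht))
  have hAF : ∀ a : A, ∃ g, J g = F a := fun a => hw.exists_of_le_one (hAv a a.2)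
  choose G hG using hAF
  let Χ : A →ₐ[ℂ] HolGerm :=
    { toFun := G
      map_one' := hJ (by simp [hG])
      map_mul' := fun a b => hJ (by simp [hG])
      map_zero' := hJ (by simp [hG])
      map_add' := fun a b => hJ (by simp [hG])
      commutes' := fun r => hJ (by
        rw [hG]
        simp) }
  have hΧ : ∀ a, J (Χ a) = F a := hG
  have hξ' : eval0.comp Χ = ξ := by
    refine (algHom_ext_of_ker_le fun a ha => ?_).symm
    have h1 : w (F a) < 1 := (hξ a).1 ha
    rw [← hΧ, hw1] at h1
    exact h1
  refine ⟨A, inferInstance, inferInstance, (Subalgebra.fg_iff_finiteType A).1 hA, inferInstance,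
    (IsScalarTower.toAlgHom ℂ B _).codRestrict A hBA, Χ, π, htrA, ?_, ?_, hπ0, hξ' ▸ hπ⟩
  · intro a b h
    have : F a = F b := by rw [← hΧ, ← hΧ, h]
    exact Subtype.ext (F.toRingHom.injective this)
  · ext b
    refine hJ ?_
    exact (hΧ _).trans (hF b)

end Branch

/-! ### Holomorphic germs of points as algebra homomorphisms to `HolGerm`. -/

section Germs

open HolGerm

section Affine

variable {A : Type} [CommRing A] [Algebra ℂ A] [Algebra.FiniteType ℂ A] [_root_.IsReduced A]

/-- `δ` is a family of points of `affine A` whose coordinates are given by the germs `φ a`. -/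
def Represents (φ : A →ₐ[ℂ] HolGerm) (δ : ℂ → (affine A).Points) : Prop :=
  ∀ a, ∀ᶠ t in 𝓝 (0 : ℂ), evalPt (δ t) a = (φ a).rep t

theorem Represents.evalPt_zero {φ : A →ₐ[ℂ] HolGerm} {δ : ℂ → (affine A).Points}
    (h : Represents φ δ) : evalPt (δ 0) = eval0.comp φ := by
  ext a
  rw [(h a).self_of_nhds, AlgHom.comp_apply, eval0_eq]

theorem Represents.eventually_eq {φ : A →ₐ[ℂ] HolGerm} {δ δ' : ℂ → (affine A).Points}
    (h : Represents φ δ) (h' : Represents φ δ') : ∀ᶠ t in 𝓝 (0 : ℂ), δ t = δ' t := by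
  obtain ⟨F, hF⟩ := (Algebra.FiniteType.out : (⊤ : Subalgebra ℂ A).FG)
  have : ∀ᶠ t in 𝓝 (0 : ℂ), ∀ a ∈ F, evalPt (δ t) a = evalPt (δ' t) a :=
    (eventually_all_finset F).2 fun a _ => by
      filter_upwards [h a, h' a] with t h1 h2
      rw [h1, h2]
  filter_upwards [this] with t ht
  exact evalPt_injective (AlgHom.ext_of_adjoin_eq_top hF ht)

/-- Representatives of the germs of finitely many generators give a map to affine space. By
noetherianity finitely many relations suffice, so near the origin its values satisfy all of them and
are points of `affine A`. -/
theorem exists_represents (φ : A →ₐ[ℂ] HolGerm) : ∃ δ, Represents φ δ := by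
  obtain ⟨n, g, hg⟩ := Algebra.FiniteType.iff_quotient_mvPolynomial''.1
    (inferInstance : Algebra.FiniteType ℂ A)
  let w : ℂ → Fin n → ℂ := fun t i => (φ (g (MvPolynomial.X i))).rep t
  have hw : ∀ i, AnalyticAt ℂ (fun t => w t i) 0 := fun i => analyticAt_rep _
  have hφ : ∀ G, φ (g G) = mk (fun t => MvPolynomial.eval (w t) G) (analyticAt_eval hw G) := by
    intro G
    rw [← aeval_mk hw]
    refine congr($(MvPolynomial.algHom_ext (f := φ.comp g) (g := MvPolynomial.aeval _)
      fun i => ?_) G)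
    rw [MvPolynomial.aeval_X, mk_rep]
    rfl
  have hrep : ∀ G, ∀ᶠ t in 𝓝 (0 : ℂ), MvPolynomial.eval (w t) G = (φ (g G)).rep t := fun G => by
    rw [hφ]
    exact (rep_mk _).mono fun t ht => ht.symm
  obtain ⟨F, hF⟩ := (isNoetherianRing_iff_ideal_fg _).1 (inferInstance :
    IsNoetherianRing (MvPolynomial (Fin n) ℂ)) (RingHom.ker g)
  have hex : ∀ᶠ t in 𝓝 (0 : ℂ), ∃ χ : A →ₐ[ℂ] ℂ, ∀ G, χ (g G) = MvPolynomial.eval (w t) G := by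
    have : ∀ᶠ t in 𝓝 (0 : ℂ), ∀ G ∈ F, MvPolynomial.eval (w t) G = 0 := by
      refine (eventually_all_finset F).2 fun G hG => ?_
      have h1 : g G = 0 := by
        have : G ∈ RingHom.ker g := hF ▸ Ideal.subset_span hG
        exact this
      have h2 := hφ G
      rw [h1, map_zero] at h2
      exact mk_eq_zero.1 h2.symm
    filter_upwards [this] with t ht
    have hker : RingHom.ker g ≤ RingHom.ker (MvPolynomial.aeval (w t) : _ →ₐ[ℂ] ℂ) := by
      rw [← hF, Ideal.span_le]
      intro G hG
      exact ht G hG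
    refine ⟨(Ideal.Quotient.liftₐ (RingHom.ker g) (MvPolynomial.aeval (w t)) hker).comp
      (Ideal.quotientKerAlgEquivOfSurjective hg).symm.toAlgHom, fun G => ?_⟩
    have : (Ideal.quotientKerAlgEquivOfSurjective hg).symm (g G) = Ideal.Quotient.mk _ G := by
      rw [AlgEquiv.symm_apply_eq]
      rfl
    change Ideal.Quotient.liftₐ _ _ hker ((Ideal.quotientKerAlgEquivOfSurjective hg).symm (g G)) = _
    rw [this]
    rfl
  classical
  -- Where the relations fail, the base point serves as a default value; this happens only away from
  -- the origin.
  refine ⟨fun t => ofAlgHom (if h : ∃ χ : A →ₐ[ℂ] ℂ, ∀ G, χ (g G) = MvPolynomial.eval (w t) G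
    then h.choose else eval0.comp φ), fun a => ?_⟩
  obtain ⟨G, rfl⟩ := hg a
  filter_upwards [hex, hrep G] with t h1 h2
  rw [evalPt_ofAlgHom, dif_pos h1, h1.choose_spec, h2]

/-- Near the base point a regular function is a fraction `b / a ^ n` with `a` nonzero there, so it
is a quotient of analytic germs along `δ`. -/
theorem Represents.isHolomorphicGerm {φ : A →ₐ[ℂ] HolGerm} {δ : ℂ → (affine A).Points}
    (h : Represents φ δ) : IsHolomorphicGerm δ := by
  intro U hU
  have key : ∀ f : Γ((affine A).obj.left, U), (∀ᶠ t in 𝓝 (0 : ℂ), (δ t).pt ∈ U) ∧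
      AnalyticAt ℂ (fun t => value f (δ t)) 0 := by
    intro f
    obtain ⟨a, b, n, ha, H⟩ := exists_value_eq_div U f hU
    have h0 : (φ a).rep 0 ≠ 0 := by rwa [← (h a).self_of_nhds]
    have hne : ∀ᶠ t in 𝓝 (0 : ℂ), evalPt (δ t) a ≠ 0 := by
      filter_upwards [h a, (analyticAt_rep (φ a)).continuousAt.eventually_ne h0] with t h1 h2
      rwa [h1]
    refine ⟨hne.mono fun t ht => (H _ ht).1, ?_⟩
    refine ((analyticAt_rep (φ b)).div ((analyticAt_rep (φ a)).pow n) (pow_ne_zero n h0)).congr ?_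
    filter_upwards [hne, h a, h b] with t h1 h2 h3
    rw [(H _ h1).2, h2, h3]
    rfl
  exact ⟨(key 0).1, fun f => (key f).2⟩

theorem Represents.comp_analytic {φ : A →ₐ[ℂ] HolGerm} {δ : ℂ → (affine A).Points}
    (h : Represents φ δ) {α : ℂ → ℂ} (hα : AnalyticAt ℂ α 0) (hα0 : α 0 = 0) :
    Represents ((comp α hα hα0).comp φ) (δ ∘ α) := fun a => by
  filter_upwards [(tendsto_of_analyticAt hα hα0).eventually (h a), rep_comp hα hα0 (φ a)]
    with t h1 h2
  rw [Function.comp_apply, h1, AlgHom.comp_apply, h2]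

theorem Represents.comp_algHom {B : Type} [CommRing B] [Algebra ℂ B] [Algebra.FiniteType ℂ B]
    [_root_.IsReduced B] {φ : A →ₐ[ℂ] HolGerm} {δ : ℂ → (affine A).Points}
    (h : Represents φ δ) (f : B →ₐ[ℂ] A) :
    Represents (φ.comp f) (mapPoints (affineMap f) ∘ δ) := fun b => by
  filter_upwards [h (f b)] with t ht
  rw [Function.comp_apply, evalPt_mapPoints]
  exact ht

theorem Represents.eventually_evalPt_ne_zero {φ : A →ₐ[ℂ] HolGerm} {δ : ℂ → (affine A).Points}
    (h : Represents φ δ) {a : A} (ha : φ a ≠ 0) : ∀ᶠ t in 𝓝[≠] (0 : ℂ), evalPt (δ t) a ≠ 0 := by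
  have h1 : ∀ᶠ t in 𝓝[≠] (0 : ℂ), (φ a).rep t ≠ 0 := by
    refine (analyticAt_rep (φ a)).eventually_eq_zero_or_eventually_ne_zero.resolve_left fun h => ha ?_
    rw [← mk_rep (φ a)]
    exact mk_eq_zero.2 h
  filter_upwards [h1, (h a).filter_mono nhdsWithin_le_nhds] with t h1 h2
  rwa [h2]

end Affine

variable {X Y : ComplexPrevariety}

theorem IsHolomorphicGerm.map {γ : ℂ → X.Points} (h : IsHolomorphicGerm γ) (p : X ⟶ Y) :
    IsHolomorphicGerm (mapPoints p ∘ γ) := by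
  intro U hU
  have hU' : (γ 0).pt ∈ p.hom.left ⁻¹ᵁ U := by
    rw [Function.comp_apply, pt_mapPoints] at hU
    exact hU
  have h1 : ∀ᶠ t in 𝓝 (0 : ℂ), (mapPoints p (γ t)).pt ∈ U :=
    (h _ hU').1.mono fun t ht => by
      rw [pt_mapPoints]
      exact ht
  refine ⟨h1, fun f => ((h _ hU').2 (p.hom.left.app U f)).congr ?_⟩
  filter_upwards [h1] with t ht
  exact (value_mapPoints p f ht).symm

theorem IsHolomorphicGerm.comp_analytic {γ : ℂ → X.Points} (h : IsHolomorphicGerm γ) {α : ℂ → ℂ}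
    (hα : AnalyticAt ℂ α 0) (hα0 : α 0 = 0) : IsHolomorphicGerm (γ ∘ α) := by
  intro U hU
  rw [Function.comp_apply, hα0] at hU
  exact ⟨(tendsto_of_analyticAt hα hα0).eventually (h U hU).1,
    fun f => AnalyticAt.fun_comp (g := fun t => value f (γ t))
      (by rw [hα0]; exact (h U hU).2 f) hα⟩

theorem isHolomorphicGerm_const (x : X.Points) : IsHolomorphicGerm fun _ => x :=
  fun _ hU => ⟨Eventually.of_forall fun _ => hU, fun _ => analyticAt_const⟩

/-- Coordinates of the chart are regular functions on its image, so they are analytic along `γ`;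
their germs assemble into `φ`. -/
theorem IsHolomorphicGerm.exists_represents {γ : ℂ → X.Points} (h : IsHolomorphicGerm γ)
    {A : Type} [CommRing A] [Algebra ℂ A] [Algebra.FiniteType ℂ A] [_root_.IsReduced A]
    (j : affine A ⟶ X) [IsOpenImmersion j.hom.left]
    (h0 : γ 0 ∈ Set.range (mapPoints j)) :
    ∃ (φ : A →ₐ[ℂ] HolGerm) (δ : ℂ → (affine A).Points), Represents φ δ ∧
      ∀ᶠ t in 𝓝 (0 : ℂ), mapPoints j (δ t) = γ t := by
  have hU : (γ 0).pt ∈ j.hom.left.opensRange := by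
    rwa [range_mapPoints_of_isOpenImmersion] at h0
  have hmem : ∀ᶠ t in 𝓝 (0 : ℂ), γ t ∈ Set.range (mapPoints j) := by
    rw [range_mapPoints_of_isOpenImmersion]
    exact (h _ hU).1
  have : Nonempty (affine A).Points := ⟨h0.choose⟩
  let δ : ℂ → (affine A).Points := fun t => Function.invFun (mapPoints j) (γ t)
  have hδ : ∀ᶠ t in 𝓝 (0 : ℂ), mapPoints j (δ t) = γ t :=
    hmem.mono fun t ht => Function.invFun_eq ht
  have han : ∀ a, AnalyticAt ℂ (fun t => evalPt (δ t) a) 0 := by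
    intro a
    obtain ⟨f, hf⟩ := exists_section_of_chart j a
    refine ((h _ hU).2 f).congr ?_
    filter_upwards [hδ] with t ht
    rw [← hf, ht]
  let φ : A →ₐ[ℂ] HolGerm :=
    { toFun := fun a => mk _ (han a)
      map_one' := mk_eq_mk.2 (Eventually.of_forall fun t => map_one _)
      map_mul' := fun a b => mk_eq_mk.2 (Eventually.of_forall fun t => map_mul _ _ _)
      map_zero' := mk_eq_mk.2 (Eventually.of_forall fun t => map_zero _)
      map_add' := fun a b => mk_eq_mk.2 (Eventually.of_forall fun t => map_add _ _ _)
      commutes' := fun r => mk_eq_mk.2 (Eventually.of_forall fun t => AlgHom.commutes _ _) }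
  exact ⟨φ, δ, fun a => (rep_mk (han a)).mono fun t ht => ht.symm, hδ⟩

end Germs

/-! ### Topological characterization of irreducible curves. -/

section Curves

open TopologicalSpace

/-- In a `T1` space the points are the minimal irreducible closed sets, so dimension one means that
nothing lies strictly between a point and the whole space. -/
theorem topologicalKrullDim_eq_one_iff {T : Type*} [TopologicalSpace T] [T1Space T]
    [IrreducibleSpace T] : topologicalKrullDim T = 1 ↔ Nontrivial T ∧
      ∀ Z : Set T, IsClosed Z → IsIrreducible Z → Z.Nontrivial → Z = Set.univ := by
  let top : IrreducibleCloseds T := ⟨Set.univ, IrreducibleSpace.isIrreducible_univ T, isClosed_univ⟩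
  rw [le_antisymm_iff, topologicalKrullDim, Order.krullDim_le_one_iff, Order.one_le_krullDim_iff]
  constructor
  · rintro ⟨h1, x, y, hxy⟩
    refine ⟨not_subsingleton_iff_nontrivial.1 fun hT => ?_, fun Z hZ hZ' hZ'' => ?_⟩
    · have : ∀ z : IrreducibleCloseds T, (z : Set T) = Set.univ := fun z =>
        Subsingleton.eq_univ_of_nonempty z.isIrreducible.nonempty
      exact hxy.ne (IrreducibleCloseds.ext ((this x).trans (this y).symm))
    · rcases h1 ⟨Z, hZ', hZ⟩ with h | h
      · obtain ⟨a, ha, b, hb, hab⟩ := hZ''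
        have h2 : ({a} : Set T) ⊆ Z := Set.singleton_subset_iff.2 ha
        have h3 : Z ⊆ {a} := h (b := ⟨{a}, isIrreducible_singleton, isClosed_singleton⟩) h2
        exact absurd (h3 hb).symm hab
      · exact Set.univ_subset_iff.1 (h (b := top) (Set.subset_univ Z))
  · rintro ⟨hT, h⟩
    refine ⟨fun z => ?_, ?_⟩
    · rcases Set.subsingleton_or_nontrivial (z : Set T) with hz | hz
      · refine .inl fun w hw => ?_
        obtain ⟨a, ha⟩ := w.isIrreducible.nonempty
        exact fun b hb => hz (hw ha) hb ▸ ha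
      · refine .inr fun w _ => ?_
        have := h z z.isClosed z.isIrreducible hz
        exact fun b _ => by
          change b ∈ (z : Set T)
          rw [this]
          trivial
    · obtain ⟨a, b, hab⟩ := exists_pair_ne T
      refine ⟨⟨{a}, isIrreducible_singleton, isClosed_singleton⟩, top, lt_of_le_not_ge ?_ fun h => ?_⟩
      · exact Set.subset_univ _
      · exact hab.symm (h (Set.mem_univ b))

theorem topologicalKrullDim_coe_eq_one_iff {T : Type*} [TopologicalSpace T] [T1Space T]
    {S : Set T} (hS : IsClosed S) (hS' : IsIrreducible S) : topologicalKrullDim S = 1 ↔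
      S.Nontrivial ∧ ∀ Z ⊆ S, IsClosed Z → IsIrreducible Z → Z.Nontrivial → Z = S := by
  have : IrreducibleSpace S := Subtype.irreducibleSpace hS'
  rw [topologicalKrullDim_eq_one_iff, Set.nontrivial_coe_sort]
  refine and_congr_right fun _ => ⟨fun h Z hZS hZ hZ' hZ'' => ?_, fun h Z hZ hZ' hZ'' => ?_⟩
  · have h1 : Subtype.val '' ((↑) ⁻¹' Z : Set S) = Z := by
      rw [Subtype.image_preimage_coe, Set.inter_eq_right.2 hZS]
    have h2 : ((↑) ⁻¹' Z : Set S) = Set.univ := by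
      refine h _ (hZ.preimage continuous_subtype_val) ?_ ?_
      · refine ⟨?_, ?_⟩
        · obtain ⟨a, ha⟩ := hZ'.nonempty
          exact ⟨⟨a, hZS ha⟩, ha⟩
        · rintro _ _ ⟨U, hU, rfl⟩ ⟨V, hV, rfl⟩ ⟨x, hx, hxU⟩ ⟨y, hy, hyV⟩
          obtain ⟨z, hz, hz'⟩ := hZ'.2 U V hU hV ⟨x, hx, hxU⟩ ⟨y, hy, hyV⟩
          exact ⟨⟨z, hZS hz⟩, hz, hz'⟩
      · obtain ⟨a, ha, b, hb, hab⟩ := hZ''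
        exact ⟨⟨a, hZS ha⟩, ha, ⟨b, hZS hb⟩, hb, fun h => hab (congr_arg Subtype.val h)⟩
    rw [← h1, h2, Set.image_univ, Subtype.range_coe]
  · have h1 := h (Subtype.val '' Z) (by simp) (hS.isClosedEmbedding_subtypeVal.isClosedMap _ hZ)
      (hZ'.image _ continuous_subtype_val.continuousOn) (hZ''.image Subtype.val_injective)
    rw [Set.eq_univ_iff_forall]
    rintro ⟨a, ha⟩
    rw [← h1] at ha
    obtain ⟨b, hb, rfl⟩ := ha
    exact hb

variable {X Y : ComplexPrevariety}

theorem isIrreducibleCurve_iff {C : Set X.Points} : IsIrreducibleCurve C ↔ IsClosed C ∧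
    IsIrreducible C ∧ C.Nontrivial ∧
      ∀ Z ⊆ C, IsClosed Z → IsIrreducible Z → Z.Nontrivial → Z = C := by
  have : IsIrreducibleCurve C ↔ IsClosed C ∧ IsIrreducible C ∧
      ∀ Z ∈ irreducibleComponents C, topologicalKrullDim Z = 1 := by
    unfold IsIrreducibleCurve IsCurve
    tauto
  rw [this]
  refine and_congr_right fun h1 => and_congr_right fun h2 => ?_
  have : IrreducibleSpace C := Subtype.irreducibleSpace h2
  rw [irreducibleComponents_eq_singleton, ← topologicalKrullDim_coe_eq_one_iff h1 h2]
  simp only [Set.mem_singleton_iff, forall_eq]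
  rw [(Homeomorph.Set.univ C).isHomeomorph.topologicalKrullDim_eq]

theorem IsCurve.exists_irreducible {C : Set X.Points} (hC : IsCurve C) :
    ∃ S : Set (Set X.Points), S.Finite ∧ (∀ T ∈ S, IsIrreducibleCurve T) ∧ C = ⋃₀ S := by
  have : NoetherianSpace C := IsInducing.subtypeVal.noetherianSpace
  refine ⟨(Subtype.val '' ·) '' irreducibleComponents C,
    NoetherianSpace.finite_irreducibleComponents.image _, ?_, ?_⟩
  · rintro _ ⟨Z, hZ, rfl⟩
    have h1 : IsClosed (Subtype.val '' Z) :=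
      hC.1.isClosedEmbedding_subtypeVal.isClosedMap _ (isClosed_of_mem_irreducibleComponents Z hZ)
    have h2 : IsIrreducible (Subtype.val '' Z) :=
      hZ.1.image _ continuous_subtype_val.continuousOn
    have h3 := hC.2 Z hZ
    rw [(IsEmbedding.subtypeVal.homeomorphImage Z).isHomeomorph.topologicalKrullDim_eq,
      topologicalKrullDim_coe_eq_one_iff h1 h2] at h3
    exact isIrreducibleCurve_iff.2 ⟨h1, h2, h3⟩
  · rw [← Set.image_sUnion, sUnion_irreducibleComponents]
    simp

/-- An irreducible subset of an irreducible curve which is not a point is dense. -/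
theorem IsIrreducibleCurve.closure_eq {C : Set X.Points} (hC : IsIrreducibleCurve C)
    {S : Set X.Points} (hS : IsIrreducible S) (hS' : S.Nontrivial) (hSC : S ⊆ C) :
    closure S = C := by
  obtain ⟨h1, h2, h3, h4⟩ := isIrreducibleCurve_iff.1 hC
  exact h4 _ (h1.closure_subset_iff.2 hSC) isClosed_closure hS.closure (hS'.mono _root_.subset_closure)

end Curves

/-! ### Closed subsets of affine prevarieties and ideals. -/

section Charts

/-- The zero locus of an ideal in the points of an affine prevariety. -/
def zeros {A : Type} [CommRing A] [Algebra ℂ A] [Algebra.FiniteType ℂ A] [_root_.IsReduced A]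
    (I : Ideal A) : Set (affine A).Points := {y | ∀ a ∈ I, evalPt y a = 0}

variable {A : Type} [CommRing A] [Algebra ℂ A] [Algebra.FiniteType ℂ A]

theorem isClosed_zeros [_root_.IsReduced A] (I : Ideal A) : IsClosed (zeros I) := by
  have : zeros I = ⋂ a ∈ I, (basicOpen a)ᶜ := by
    ext y
    simp [zeros, mem_basicOpen]
  rw [this]
  exact isClosed_biInter fun a _ => (isOpen_basicOpen a).isClosed_compl

/-- The ideal of functions vanishing on a set of points. -/
def vanishing [_root_.IsReduced A] (V : Set (affine A).Points) : Ideal A where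
  carrier := {a | ∀ y ∈ V, evalPt y a = 0}
  add_mem' ha hb y hy := by rw [map_add, ha y hy, hb y hy, add_zero]
  zero_mem' y _ := map_zero _
  smul_mem' c a ha y hy := by rw [smul_eq_mul, map_mul, ha y hy, mul_zero]

theorem zeros_vanishing [_root_.IsReduced A] {V : Set (affine A).Points} (hV : IsClosed V) :
    zeros (vanishing V) = V := by
  refine Set.Subset.antisymm (fun y hy => ?_) fun y hy a ha => ha y hy
  by_contra hyV
  obtain ⟨a, ha, haV⟩ := exists_basicOpen_subset hV.isOpen_compl hyV
  rw [mem_basicOpen] at ha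
  refine ha (hy a fun z hz => ?_)
  by_contra h
  exact haV ((mem_basicOpen _ _).2 h) hz

theorem isPrime_vanishing [_root_.IsReduced A] {V : Set (affine A).Points} (hV : IsIrreducible V) :
    (vanishing V).IsPrime := by
  refine ⟨?_, fun {a b} hab => ?_⟩
  · obtain ⟨y, hy⟩ := hV.nonempty
    rw [Ideal.ne_top_iff_one]
    exact fun h => one_ne_zero ((map_one (evalPt y)).symm.trans (h y hy))
  · by_contra! h
    obtain ⟨ha, hb⟩ := h
    have : ∀ c, c ∉ vanishing V → (V ∩ basicOpen c).Nonempty := fun c hc => by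
      by_contra h
      refine hc fun y hy => ?_
      by_contra hyc
      exact h ⟨y, hy, (mem_basicOpen _ _).2 hyc⟩
    obtain ⟨y, hyV, hya, hyb⟩ := hV.2 _ _ (isOpen_basicOpen a) (isOpen_basicOpen b)
      (this a ha) (this b hb)
    rw [mem_basicOpen] at hya hyb
    have := hab y hyV
    rw [map_mul] at this
    exact (mul_ne_zero hya hyb) this

instance isReduced_quotient (I : Ideal A) [I.IsPrime] : _root_.IsReduced (A ⧸ I) := inferInstance

theorem isEmbedding_affineMap_of_surjective [_root_.IsReduced A] {B : Type} [CommRing B]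
    [Algebra ℂ B] [Algebra.FiniteType ℂ B] [_root_.IsReduced B] {f : A →ₐ[ℂ] B}
    (hf : Function.Surjective f) : IsEmbedding (mapPoints (affineMap f)) := by
  refine ⟨isInducing_iff_nhds.2 fun x => le_antisymm
    (continuous_mapPoints _).continuousAt.tendsto.le_comap fun U hU => ?_, fun x y h => ?_⟩
  · obtain ⟨V, hVU, hV, hx⟩ := mem_nhds_iff.1 hU
    obtain ⟨b, hb, hbU⟩ := exists_basicOpen_subset hV hx
    obtain ⟨a, rfl⟩ := hf b
    refine mem_comap.2 ⟨basicOpen a, (isOpen_basicOpen a).mem_nhds ?_, fun y hy => hVU (hbU ?_)⟩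
    · rw [mem_basicOpen] at hb ⊢
      rwa [evalPt_mapPoints]
    · rw [Set.mem_preimage, mem_basicOpen, evalPt_mapPoints] at hy
      rwa [mem_basicOpen]
  · refine evalPt_injective (AlgHom.ext fun b => ?_)
    obtain ⟨a, rfl⟩ := hf b
    have := congr_arg (fun z => evalPt z a) h
    simpa [evalPt_mapPoints] using this

theorem range_affineMap_quotient [_root_.IsReduced A] (I : Ideal A) [I.IsPrime] :
    Set.range (mapPoints (affineMap (Ideal.Quotient.mkₐ ℂ I))) = zeros I := by
  ext y
  constructor
  · rintro ⟨z, rfl⟩ a ha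
    rw [evalPt_mapPoints]
    simp [Ideal.Quotient.eq_zero_iff_mem.2 ha]
  · intro hy
    refine ⟨ofAlgHom (Ideal.Quotient.liftₐ I (evalPt y) hy), ?_⟩
    rw [mapPoints_affineMap]
    refine evalPt_injective ?_
    rw [evalPt_ofAlgHom]
    rfl

theorem exists_ne_zero_basicOpen_subset [IsDomain A] {U : Set (affine A).Points} (hU : IsOpen U)
    (hU' : U.Nonempty) : ∃ a : A, a ≠ 0 ∧ basicOpen a ⊆ U := by
  obtain ⟨x, hx⟩ := hU'
  obtain ⟨a, ha, haU⟩ := exists_basicOpen_subset hU hx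
  refine ⟨a, ?_, haU⟩
  rintro rfl
  rw [mem_basicOpen, map_zero] at ha
  exact ha rfl

instance irreducibleSpace_affine [IsDomain A] : IrreducibleSpace (affine A).Points := by
  have hpt : ∀ a : A, a ≠ 0 → (basicOpen a).Nonempty := fun a ha => by
    obtain ⟨φ, hφ⟩ := exists_algHom_ne_zero (a := a) (by simpa using ha)
    exact ⟨ofAlgHom φ, by rwa [mem_basicOpen, evalPt_ofAlgHom]⟩
  rw [irreducibleSpace_def]
  refine ⟨(hpt 1 one_ne_zero).mono (Set.subset_univ _), fun U V hU hV hU' hV' => ?_⟩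
  rw [Set.top_eq_univ, Set.univ_inter] at hU' hV' ⊢
  obtain ⟨a, ha, haU⟩ := exists_ne_zero_basicOpen_subset hU hU'
  obtain ⟨b, hb, hbV⟩ := exists_ne_zero_basicOpen_subset hV hV'
  obtain ⟨y, hy⟩ := hpt (a * b) (mul_ne_zero ha hb)
  rw [mem_basicOpen, map_mul] at hy
  exact ⟨y, haU ((mem_basicOpen _ _).2 (left_ne_zero_of_mul hy)),
    hbV ((mem_basicOpen _ _).2 (right_ne_zero_of_mul hy))⟩

end Charts

/-! ### Charts of irreducible closed sets, and dimension one in charts. -/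

section Geometry

open HolGerm

variable {X Y : ComplexPrevariety}

/-- A morphism from an affine prevariety which is a closed immersion into an open affine chart. -/
def IsAffineChart {A : Type} [CommRing A] [Algebra ℂ A] [Algebra.FiniteType ℂ A]
    [_root_.IsReduced A] (k : affine A ⟶ X) : Prop :=
  ∃ (B : Type) (_ : CommRing B) (_ : Algebra ℂ B) (_ : Algebra.FiniteType ℂ B)
    (_ : _root_.IsReduced B) (j : affine B ⟶ X) (q : B →ₐ[ℂ] A), IsOpenImmersion j.hom.left ∧
    Function.Surjective q ∧ affineMap q ≫ j = k

theorem mapPoints_comp' {Z : ComplexPrevariety} (f : X ⟶ Y) (g : Y ⟶ Z) :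
    mapPoints (f ≫ g) = mapPoints g ∘ mapPoints f := funext fun x => mapPoints_comp f g x

theorem IsAffineChart.isEmbedding {A : Type} [CommRing A] [Algebra ℂ A] [Algebra.FiniteType ℂ A]
    [_root_.IsReduced A] {k : affine A ⟶ X} (hk : IsAffineChart k) : IsEmbedding (mapPoints k) := by
  obtain ⟨B, _, _, _, _, j, q, hj, hq, rfl⟩ := hk
  rw [mapPoints_comp']
  exact (isOpenEmbedding_mapPoints j).isEmbedding.comp (isEmbedding_affineMap_of_surjective hq)

/-- Every scheme point specializes to a complex point, and open sets are stable under generization,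
so complex points decide the inclusion. -/
theorem range_subset_of_range_mapPoints_subset {A : Type} [CommRing A] [Algebra ℂ A]
    [Algebra.FiniteType ℂ A] [_root_.IsReduced A] {f : affine A ⟶ X} {U : X.obj.left.Opens}
    (h : ∀ x, (mapPoints f x).pt ∈ U) : Set.range f.hom.left ⊆ U := by
  rintro _ ⟨z, rfl⟩
  obtain ⟨m, hm, hzm⟩ := Ideal.exists_le_maximal (PrimeSpectrum.asIdeal (R := A) z)
    (PrimeSpectrum.isPrime (R := A) z).ne_top
  obtain ⟨φ, hφ⟩ := exists_algHom_ker_eq m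
  have h1 : (ofAlgHom φ).pt ∈ f.hom.left ⁻¹ᵁ U := by
    have := h (ofAlgHom φ)
    rw [pt_mapPoints] at this
    exact this
  obtain ⟨_, ⟨a, rfl⟩, ha, haU⟩ := (PrimeSpectrum.isTopologicalBasis_basic_opens
    (R := A)).exists_subset_of_mem_open h1 (f.hom.left ⁻¹ᵁ U).isOpen
  refine haU fun haz => ?_
  refine (pt_ofAlgHom_mem_basicOpen φ a).1 ha ?_
  rw [← RingHom.mem_ker, hφ]
  exact hzm haz

/-- A morphism from an affine prevariety factors through a chart if it does so on points. -/
theorem IsAffineChart.exists_lift {A : Type} [CommRing A] [Algebra ℂ A] [Algebra.FiniteType ℂ A]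
    [_root_.IsReduced A] {k : affine A ⟶ X} (hk : IsAffineChart k) {T : Type} [CommRing T]
    [Algebra ℂ T] [Algebra.FiniteType ℂ T] [_root_.IsReduced T] (f : affine T ⟶ X)
    (hf : Set.range (mapPoints f) ⊆ Set.range (mapPoints k)) :
    ∃ l : A →ₐ[ℂ] T, affineMap l ≫ k = f := by
  obtain ⟨B, _, _, _, _, j, q, hj, hq, rfl⟩ := hk
  rw [mapPoints_comp'] at hf
  obtain ⟨g, rfl⟩ := exists_lift_of_isOpenImmersion j f <|
    range_subset_of_range_mapPoints_subset (U := j.hom.left.opensRange) fun x => by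
      have : mapPoints f x ∈ Set.range (mapPoints j) :=
        (hf.trans (Set.range_comp_subset_range _ _)) ⟨x, rfl⟩
      rwa [range_mapPoints_of_isOpenImmersion] at this
  obtain ⟨g, rfl⟩ := affineMap_surjective g
  -- The containment on points gives a factorization of rings because `T` is reduced: a nonzero
  -- image of an element of `ker q` would be nonzero at some complex point.
  have hker : RingHom.ker q ≤ RingHom.ker g := fun b hb => by
    by_contra hgb
    obtain ⟨χ, hχ⟩ := exists_algHom_ne_zero (a := g b) (by rwa [isNilpotent_iff_eq_zero])
    obtain ⟨y, hy⟩ := hf ⟨ofAlgHom χ, rfl⟩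
    rw [mapPoints_comp, Function.comp_apply] at hy
    have h1 := mapPoints_injective_of_isOpenImmersion j hy
    have h2 := congr_arg (fun z => evalPt z b) h1
    simp only [evalPt_mapPoints, AlgHom.comp_apply, evalPt_ofAlgHom] at h2
    rw [RingHom.mem_ker] at hb
    rw [hb, map_zero] at h2
    exact hχ h2.symm
  refine ⟨(Ideal.Quotient.liftₐ (RingHom.ker q) g hker).comp
    (Ideal.quotientKerAlgEquivOfSurjective hq).symm.toAlgHom, ?_⟩
  rw [← Category.assoc, ← affineMap_comp]
  congr 2
  ext b
  have : (Ideal.quotientKerAlgEquivOfSurjective hq).symm (q b) = Ideal.Quotient.mk _ b := by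
    rw [AlgEquiv.symm_apply_eq]
    rfl
  change Ideal.Quotient.liftₐ _ _ hker ((Ideal.quotientKerAlgEquivOfSurjective hq).symm (q b)) = _
  rw [this]
  rfl

/-- A holomorphic germ in an irreducible closed subset is given by germs of functions on an affine
chart of that subset. -/
theorem IsHolomorphicGerm.exists_chart {γ : ℂ → X.Points} (h : IsHolomorphicGerm γ)
    {V : Set X.Points} (hV : IsClosed V) (hV' : IsIrreducible V) (hγ : ∀ᶠ t in 𝓝 (0 : ℂ), γ t ∈ V)
    {O : X.obj.left.Opens} (hO : (γ 0).pt ∈ O) :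
    ∃ (A : Type) (_ : CommRing A) (_ : Algebra ℂ A) (_ : Algebra.FiniteType ℂ A) (_ : IsDomain A)
      (k : affine A ⟶ X) (U : Set X.Points) (φ : A →ₐ[ℂ] HolGerm) (δ : ℂ → (affine A).Points),
      IsAffineChart k ∧ IsOpen U ∧ γ 0 ∈ U ∧ Set.range (mapPoints k) = V ∩ U ∧
      (∀ a, (mapPoints k a).pt ∈ O) ∧
      Represents φ δ ∧ ∀ᶠ t in 𝓝 (0 : ℂ), mapPoints k (δ t) = γ t := by
  obtain ⟨A, _, _, _, _, j, hj, h0, hjO⟩ := ComplexPrevariety.exists_chart hO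
  obtain ⟨φ, δ, hφ, hδ⟩ := h.exists_represents j h0
  have hje := isOpenEmbedding_mapPoints j
  have hV0 : IsIrreducible (mapPoints j ⁻¹' V) := by
    obtain ⟨a, ha⟩ := h0
    exact hV'.preimage hje ⟨γ 0, hγ.self_of_nhds, a, ha⟩
  have hV0' := hV.preimage (continuous_mapPoints j)
  -- The ideal of `V` in the ambient chart is prime, and `φ` kills it since the germ stays in `V`;
  -- hence the germ lives on the chart `A ⧸ I` of `V`.
  let I := vanishing (mapPoints j ⁻¹' V)
  have hI : I.IsPrime := isPrime_vanishing hV0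
  have hIφ : ∀ a ∈ I, φ a = 0 := fun a ha => by
    rw [← mk_rep (φ a)]
    refine mk_eq_zero.2 ?_
    filter_upwards [hφ a, hδ, hγ] with t h1 h2 h3
    rw [← h1]
    exact ha _ (by rwa [Set.mem_preimage, h2])
  let ψ : A ⧸ I →ₐ[ℂ] HolGerm := Ideal.Quotient.liftₐ I φ hIφ
  have hr : Set.range (mapPoints (affineMap (Ideal.Quotient.mkₐ ℂ I))) = mapPoints j ⁻¹' V := by
    rw [range_affineMap_quotient, zeros_vanishing hV0']
  have hk : mapPoints (affineMap (Ideal.Quotient.mkₐ ℂ I) ≫ j) =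
      mapPoints j ∘ mapPoints (affineMap (Ideal.Quotient.mkₐ ℂ I)) := mapPoints_comp' _ _
  obtain ⟨δ', hδ'⟩ := ComplexPrevariety.exists_represents ψ
  refine ⟨A ⧸ I, inferInstance, inferInstance, inferInstance, inferInstance,
    affineMap (Ideal.Quotient.mkₐ ℂ I) ≫ j, Set.range (mapPoints j), ψ, δ', ?_,
    hje.isOpen_range, h0, ?_, fun a => ?_, hδ', ?_⟩
  · exact ⟨A, _, _, _, _, j, _, hj, Ideal.Quotient.mkₐ_surjective ℂ I, rfl⟩
  · rw [hk, Set.range_comp, hr, Set.image_preimage_eq_inter_range]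
  · rw [hk, Function.comp_apply, pt_mapPoints]
    exact hjO ⟨_, rfl⟩
  · have h1 := hδ'.comp_algHom (Ideal.Quotient.mkₐ ℂ I)
    have h2 : ψ.comp (Ideal.Quotient.mkₐ ℂ I) = φ := by
      ext a
      rfl
    rw [h2] at h1
    filter_upwards [h1.eventually_eq hφ, hδ] with t h3 h4
    rw [hk, ← h4, ← h3]
    rfl

theorem exists_chart_of_isIrreducible {V : Set X.Points} (hV : IsClosed V) (hV' : IsIrreducible V)
    {x : X.Points} (hx : x ∈ V) :
    ∃ (A : Type) (_ : CommRing A) (_ : Algebra ℂ A) (_ : Algebra.FiniteType ℂ A) (_ : IsDomain A)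
      (k : affine A ⟶ X) (U : Set X.Points), IsAffineChart k ∧ IsOpen U ∧ x ∈ U ∧
      Set.range (mapPoints k) = V ∩ U := by
  obtain ⟨A, i1, i2, i3, i4, k, U, φ, δ, h1, h2, h3, h4, -⟩ :=
    (isHolomorphicGerm_const x).exists_chart hV hV' (Eventually.of_forall fun _ => hx)
      (O := ⊤) trivial
  exact ⟨A, i1, i2, i3, i4, k, U, h1, h2, h3, h4⟩

/-- A holomorphic germ lies in a closed subset, or avoids it outside of its base point. -/
theorem IsHolomorphicGerm.eventually_mem_or_notMem {γ : ℂ → X.Points} (h : IsHolomorphicGerm γ)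
    {V : Set X.Points} (hV : IsClosed V) :
    (∀ᶠ t in 𝓝 (0 : ℂ), γ t ∈ V) ∨ ∀ᶠ t in 𝓝[≠] (0 : ℂ), γ t ∉ V := by
  obtain ⟨A, _, _, _, _, j, hj, h0, -⟩ := ComplexPrevariety.exists_chart (x := γ 0) (U := ⊤) trivial
  obtain ⟨φ, δ, hφ, hδ⟩ := h.exists_represents j h0
  -- Either the finitely many equations of `V` all vanish along the germ, or one of them has an
  -- isolated zero at the origin.
  let I := vanishing (mapPoints j ⁻¹' V)
  by_cases hI : ∀ a ∈ I, φ a = 0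
  · left
    have : IsNoetherianRing A := Algebra.FiniteType.isNoetherianRing ℂ A
    obtain ⟨F, hF⟩ := (isNoetherianRing_iff_ideal_fg A).1 this I
    have h1 : ∀ᶠ t in 𝓝 (0 : ℂ), ∀ a ∈ F, evalPt (δ t) a = 0 := by
      refine (eventually_all_finset F).2 fun a ha => ?_
      have h2 := hI a (hF ▸ Ideal.subset_span ha)
      rw [← mk_rep (φ a), mk_eq_zero] at h2
      filter_upwards [h2, hφ a] with t h3 h4
      rw [h4, h3]
    filter_upwards [h1, hδ] with t h2 h3
    rw [← h3]
    change δ t ∈ mapPoints j ⁻¹' V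
    rw [← zeros_vanishing (hV.preimage (continuous_mapPoints j))]
    have h4 : I ≤ RingHom.ker (evalPt (δ t)) := by
      rw [← hF, Ideal.span_le]
      exact h2
    exact h4
  · right
    push Not at hI
    obtain ⟨a, ha, ha'⟩ := hI
    filter_upwards [hφ.eventually_evalPt_ne_zero ha', hδ.filter_mono nhdsWithin_le_nhds]
      with t h1 h2 h3
    exact h1 (ha _ (by rwa [Set.mem_preimage, h2]))

/-- A germ contained in none of the finitely many components would leave all of them on a punctured
neighbourhood. -/
theorem IsHolomorphicGerm.exists_irreducibleCurve {γ : ℂ → X.Points} (h : IsHolomorphicGerm γ)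
    {C : Set X.Points} (hC : IsCurve C) (hγ : ∀ᶠ t in 𝓝 (0 : ℂ), γ t ∈ C) :
    ∃ C' ⊆ C, IsIrreducibleCurve C' ∧ ∀ᶠ t in 𝓝 (0 : ℂ), γ t ∈ C' := by
  obtain ⟨S, hS, hS', rfl⟩ := hC.exists_irreducible
  by_contra H
  have h1 : ∀ T ∈ S, ∀ᶠ t in 𝓝[≠] (0 : ℂ), γ t ∉ T := fun T hT =>
    (h.eventually_mem_or_notMem (hS' T hT).1.1).resolve_left
      fun hT' => H ⟨T, Set.subset_sUnion_of_mem hT, hS' T hT, hT'⟩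
  have h2 := (eventually_all_finite hS).2 h1
  obtain ⟨t, h3, T, hT, h4⟩ := (h2.and (hγ.filter_mono nhdsWithin_le_nhds)).exists
  exact h3 T hT h4

section

variable {A : Type} [CommRing A] [Algebra ℂ A] [Algebra.FiniteType ℂ A] [IsDomain A]

theorem isIrreducible_zeros (P : Ideal A) [P.IsPrime] : IsIrreducible (zeros P) := by
  rw [← range_affineMap_quotient, ← Set.image_univ]
  exact (IrreducibleSpace.isIrreducible_univ _).image _ (continuous_mapPoints _).continuousOn

theorem exists_mem_zeros_evalPt_ne_zero (P : Ideal A) [P.IsPrime] {a : A} (ha : a ∉ P) :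
    ∃ y ∈ zeros P, evalPt y a ≠ 0 := by
  obtain ⟨φ, hφ, h⟩ := exists_algHom_quotient_ne_zero P ha
  refine ⟨ofAlgHom φ, fun b hb => ?_, ?_⟩
  · rw [evalPt_ofAlgHom]
    exact hφ hb
  · rwa [evalPt_ofAlgHom]

theorem nontrivial_zeros {P : Ideal A} [P.IsPrime] (hP : ¬ P.IsMaximal) : (zeros P).Nontrivial := by
  obtain ⟨m, hm, hPm⟩ := Ideal.exists_le_maximal P (Ideal.IsPrime.ne_top ‹_›)
  obtain ⟨a, ha, haP⟩ := SetLike.exists_of_lt (lt_of_le_of_ne hPm fun h => hP (h ▸ hm))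
  obtain ⟨φ, hφ⟩ := exists_algHom_ker_eq m
  obtain ⟨y, hy, hya⟩ := exists_mem_zeros_evalPt_ne_zero P haP
  refine ⟨ofAlgHom φ, fun b hb => ?_, y, hy, ?_⟩
  · rw [evalPt_ofAlgHom, ← RingHom.mem_ker, hφ]
    exact hPm hb
  · rintro rfl
    rw [evalPt_ofAlgHom] at hya
    rw [← hφ] at ha
    exact hya ha

/-- The coordinate ring of an affine chart of an irreducible curve has dimension at most `1`. -/
theorem IsIrreducibleCurve.trdeg_le_one {C : Set X.Points} (hC : IsIrreducibleCurve C)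
    {k : affine A ⟶ X} (hk : IsEmbedding (mapPoints k)) (hkC : Set.range (mapPoints k) ⊆ C) :
    Algebra.trdeg ℂ A ≤ 1 := by
  refine trdeg_le_one_of_isMaximal fun P hP hP0 => ?_
  by_contra hPm
  -- A nonzero non-maximal prime would have a non-degenerate zero set, hence one dense in the curve.
  -- Being closed in the chart it would be the whole chart, contradicting `P ≠ ⊥`.
  have h1 := hC.closure_eq ((isIrreducible_zeros P).image _ (continuous_mapPoints k).continuousOn)
    ((nontrivial_zeros hPm).image hk.injective) ((Set.image_subset_range _ _).trans hkC)
  have h2 := hk.closure_eq_preimage_closure_image (zeros P)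
  rw [h1, (isClosed_zeros P).closure_eq] at h2
  obtain ⟨a, ha, ha0⟩ := Submodule.exists_mem_ne_zero_of_ne_bot hP0
  obtain ⟨φ, hφ⟩ := exists_algHom_ne_zero (a := a) (by simpa using ha0)
  have h3 : ofAlgHom φ ∈ zeros P := by
    rw [h2]
    exact hkC ⟨_, rfl⟩
  exact hφ (by simpa [evalPt_ofAlgHom] using h3 a ha)

end

theorem nontrivial_inter_of_isIrreducible {Z U : Set X.Points} (hZ : IsIrreducible Z)
    (hZ' : Z.Nontrivial) (hU : IsOpen U) (h : (Z ∩ U).Nonempty) : (Z ∩ U).Nontrivial := by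
  obtain ⟨x, hx⟩ := h
  obtain ⟨y, hy, hyx⟩ := hZ'.exists_ne x
  obtain ⟨z, hz, hzU, hzx⟩ := hZ.2 U {x}ᶜ hU isOpen_compl_singleton ⟨x, hx⟩ ⟨y, hy, hyx⟩
  exact ⟨x, hx, z, ⟨hz, hzU⟩, fun h => hzx h.symm⟩

/-- A closed irreducible `Z ⊆ W` with more than one point is a prime in a chart. A nonzero prime
would be maximal and `Z` a single point there; so the prime is zero and `Z` contains a dense open
part of `W`. -/
theorem isIrreducibleCurve_of_trdeg_le_one {W : Set X.Points} (hW : IsClosed W)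
    (hW' : IsIrreducible W) (hWn : W.Nontrivial)
    (H : ∀ (B : Type) [CommRing B] [Algebra ℂ B] [Algebra.FiniteType ℂ B] [IsDomain B]
      (k : affine B ⟶ X), IsAffineChart k →
      (∃ U, IsOpen U ∧ Set.range (mapPoints k) = W ∩ U) → Algebra.trdeg ℂ B ≤ 1) :
    IsIrreducibleCurve W := by
  refine isIrreducibleCurve_iff.2 ⟨hW, hW', hWn, fun Z hZW hZ hZ' hZn => ?_⟩
  obtain ⟨x, hx⟩ := hZ'.nonempty
  obtain ⟨B, _, _, _, _, k, U, hk, hU, hxU, hr⟩ := exists_chart_of_isIrreducible hW hW' (hZW hx)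
  have htr := H B k hk ⟨U, hU, hr⟩
  replace hk := hk.isEmbedding
  have himg : mapPoints k '' (mapPoints k ⁻¹' Z) = Z ∩ U := by
    rw [Set.image_preimage_eq_inter_range, hr, ← Set.inter_assoc, Set.inter_eq_left.2 hZW]
  have hZk : IsClosed (mapPoints k ⁻¹' Z) := hZ.preimage (continuous_mapPoints k)
  have hn := nontrivial_inter_of_isIrreducible hZ' hZn hU ⟨x, hx, hxU⟩
  have hirr : IsIrreducible (mapPoints k ⁻¹' Z) := by
    obtain ⟨b, hb⟩ : x ∈ Set.range (mapPoints k) := hr ▸ ⟨hZW hx, hxU⟩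
    refine ⟨⟨b, by rwa [Set.mem_preimage, hb]⟩, fun O O' hO hO' h1 h2 => ?_⟩
    obtain ⟨Q, hQ, rfl⟩ := hk.isOpen_iff.1 hO
    obtain ⟨Q', hQ', rfl⟩ := hk.isOpen_iff.1 hO'
    obtain ⟨y, hy, hyO⟩ := h1
    obtain ⟨z, hz, hzO⟩ := h2
    have hmem : ∀ b, mapPoints k b ∈ U := fun b => (hr ▸ Set.mem_range_self b : _ ∈ W ∩ U).2
    obtain ⟨w, hw, ⟨hwO, hwU⟩, hwO', -⟩ := hZ'.2 (Q ∩ U) (Q' ∩ U) (hQ.inter hU) (hQ'.inter hU)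
      ⟨_, hy, hyO, hmem y⟩ ⟨_, hz, hzO, hmem z⟩
    obtain ⟨c, rfl⟩ : w ∈ Set.range (mapPoints k) := hr ▸ ⟨hZW hw, hwU⟩
    exact ⟨c, hw, hwO, hwO'⟩
  have hP := isPrime_vanishing hirr
  have hz := zeros_vanishing hZk
  have hP0 : vanishing (mapPoints k ⁻¹' Z) = ⊥ := by
    by_contra hne
    have hm := isMaximal_of_trdeg_le_one htr _ hne
    rw [← himg] at hn
    obtain ⟨_, ⟨a, ha, rfl⟩, _, ⟨b, hb, rfl⟩, hab⟩ := hn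
    refine hab (congr_arg _ ?_)
    have : ∀ c ∈ mapPoints k ⁻¹' Z,
        vanishing (mapPoints k ⁻¹' Z) = RingHom.ker (evalPt c) := fun c hc =>
      hm.eq_of_le (RingHom.ker_ne_top _) fun f hf => hf c hc
    refine evalPt_injective (algHom_ext_of_ker_le ?_)
    rw [← this a ha, ← this b hb]
  have huniv : mapPoints k ⁻¹' Z = Set.univ := by
    rw [← hz, hP0, Set.eq_univ_iff_forall]
    rintro y a rfl
    exact map_zero _
  have hWU : W ∩ U ⊆ Z := by
    rw [← hr, ← Set.image_univ, ← huniv]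
    exact Set.image_preimage_subset _ _
  refine Set.Subset.antisymm hZW ?_
  exact (subset_closure_inter_of_isPreirreducible_of_isOpen hW'.2 hU ⟨x, hZW hx, hxU⟩).trans
    (hZ.closure_subset_iff.2 hWU)

end Geometry

/-! ### Images of curves, curves through given points, and branches. -/

section CurveConstruction

open HolGerm

variable {X Y : ComplexPrevariety}

section

theorem finiteType_away {A : Type} [CommRing A] [Algebra ℂ A] [Algebra.FiniteType ℂ A] (a : A) : Algebra.FiniteType ℂ (Localization.Away a) :=
  have : Algebra.FiniteType A (Localization.Away a) :=
    IsLocalization.finiteType_of_monoid_fg (Submonoid.powers a) _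
  Algebra.FiniteType.trans (S := A) inferInstance inferInstance

theorem isDomain_away {A : Type} [CommRing A] [IsDomain A] {a : A} (ha : a ≠ 0) : IsDomain (Localization.Away a) :=
  IsLocalization.isDomain_localization (powers_le_nonZeroDivisors_of_noZeroDivisors ha)

theorem trdeg_away {A : Type} [CommRing A] [Algebra ℂ A] [IsDomain A] {a : A} (ha : a ≠ 0) :
    Algebra.trdeg ℂ (Localization.Away a) = Algebra.trdeg ℂ A := by
  have := isDomain_away ha
  have h0 := powers_le_nonZeroDivisors_of_noZeroDivisors ha
  have : FaithfulSMul A (Localization.Away a) :=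
    (faithfulSMul_iff_algebraMap_injective _ _).2 (IsLocalization.injective _ h0)
  have h1 := _root_.trdeg_add_eq ℂ A (A := Localization.Away a)
  have := IsLocalization.isAlgebraic (R := A) (S := Localization.Away a) (Submonoid.powers a)
  rw [← h1, _root_.trdeg_eq_zero (R := A), add_zero]

theorem exists_algHom_away {A : Type} [CommRing A] [Algebra ℂ A] {a : A} (φ : A →ₐ[ℂ] ℂ) (ha : φ a ≠ 0) :
    ∃ ψ : Localization.Away a →ₐ[ℂ] ℂ, ψ.comp (IsScalarTower.toAlgHom ℂ A _) = φ := by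
  refine ⟨IsLocalization.liftAlgHom (M := Submonoid.powers a) (f := φ) ?_, ?_⟩
  · rintro ⟨_, n, rfl⟩
    simpa using fun h => absurd h ha
  · ext b
    simp

variable {A : Type} [CommRing A] [Algebra ℂ A] [Algebra.FiniteType ℂ A] [IsDomain A]

/-- A morphism of affine prevarieties corestricts, over a principal open subset, to a dominant
morphism to a chart of the closure of its image. -/
theorem exists_injective_algHom_of_dense {B : Type} [CommRing B] [Algebra ℂ B] [Algebra.FiniteType ℂ B]
    [IsDomain B] {f : affine A ⟶ X} {k : affine B ⟶ X} (hk : IsAffineChart k) {U : Set X.Points}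
    (hU : IsOpen U) (hr : Set.range (mapPoints k) = closure (Set.range (mapPoints f)) ∩ U) :
    ∃ (A' : Type) (_ : CommRing A') (_ : Algebra ℂ A') (_ : Algebra.FiniteType ℂ A')
      (_ : IsDomain A') (i : A →ₐ[ℂ] A') (l : B →ₐ[ℂ] A'), Function.Injective l ∧
        affineMap l ≫ k = affineMap i ≫ f ∧ Algebra.trdeg ℂ A' = Algebra.trdeg ℂ A := by
  have key : ∀ O : Set X.Points, IsOpen O → (Set.range (mapPoints k) ∩ O).Nonempty →
      (mapPoints f ⁻¹' (U ∩ O)).Nonempty := by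
    rintro O hO ⟨_, ⟨b, rfl⟩, hb⟩
    have h1 : mapPoints k b ∈ closure (Set.range (mapPoints f)) ∩ U := hr ▸ ⟨b, rfl⟩
    obtain ⟨_, hx, a, rfl⟩ := mem_closure_iff.1 h1.1 (U ∩ O) (hU.inter hO) ⟨h1.2, hb⟩
    exact ⟨a, hx⟩
  -- Shrinking the source to `a ≠ 0` brings its image into `U`, so that the morphism factors through
  -- the chart `k`.
  obtain ⟨a, ha, haU⟩ := exists_ne_zero_basicOpen_subset (hU.preimage (continuous_mapPoints f)) (by
    simpa using key Set.univ isOpen_univ (by simpa using Set.range_nonempty _))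
  have := finiteType_away a
  have := isDomain_away ha
  let i : A →ₐ[ℂ] Localization.Away a := IsScalarTower.toAlgHom ℂ A _
  have hi : ∀ y, mapPoints (affineMap i) y ∈ basicOpen a := fun y => by
    rw [mem_basicOpen, evalPt_mapPoints]
    exact ((IsLocalization.Away.algebraMap_isUnit a).map (evalPt y)).ne_zero
  obtain ⟨l, hl⟩ := hk.exists_lift (affineMap i ≫ f) <| by
    rintro _ ⟨y, rfl⟩
    rw [hr, mapPoints_comp]
    exact ⟨subset_closure ⟨_, rfl⟩, haU (hi y)⟩
  refine ⟨_, _, _, finiteType_away a, isDomain_away ha, i, l, ?_, hl, trdeg_away ha⟩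
  rw [injective_iff_map_eq_zero]
  intro b hb
  by_contra hb0
  obtain ⟨φ, hφ⟩ := exists_algHom_ne_zero (a := b) (by simpa using hb0)
  obtain ⟨O, hO, hOb⟩ := hk.isEmbedding.isOpen_iff.1 (isOpen_basicOpen b)
  -- If `l b = 0` with `b ≠ 0`, density still produces source points mapping to where `b ≠ 0`.
  -- Choosing one with `a ≠ 0` lifts it to the localization, where `b` pulls back to zero.
  have hne := key O hO ⟨_, ⟨ofAlgHom φ, rfl⟩, by
    change ofAlgHom φ ∈ mapPoints k ⁻¹' O
    rwa [hOb, mem_basicOpen, evalPt_ofAlgHom]⟩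
  obtain ⟨a', ha', haO⟩ := exists_ne_zero_basicOpen_subset
    ((hU.inter hO).preimage (continuous_mapPoints f)) hne
  obtain ⟨χ, hχ⟩ := exists_algHom_ne_zero (a := a * a') (by simpa using ⟨ha, ha'⟩)
  rw [map_mul] at hχ
  obtain ⟨ψ, hψ⟩ := exists_algHom_away χ (left_ne_zero_of_mul hχ)
  have h1 : mapPoints f (ofAlgHom χ) ∈ U ∩ O :=
    haO ((mem_basicOpen _ _).2 (by rw [evalPt_ofAlgHom]; exact right_ne_zero_of_mul hχ))
  have h2 : mapPoints k (mapPoints (affineMap l) (ofAlgHom ψ)) = mapPoints f (ofAlgHom χ) := by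
    rw [← mapPoints_comp, hl, mapPoints_comp, mapPoints_affineMap, hψ]
  rw [← h2] at h1
  have h3 : mapPoints (affineMap l) (ofAlgHom ψ) ∈ basicOpen b := by
    rw [← hOb]
    exact h1.2
  rw [mem_basicOpen, mapPoints_affineMap, evalPt_ofAlgHom, AlgHom.comp_apply, hb, map_zero] at h3
  exact h3 rfl

/-- The closure of a nonconstant image of an affine curve is an irreducible curve. -/
theorem isIrreducibleCurve_closure_range (htr : Algebra.trdeg ℂ A ≤ 1) (f : affine A ⟶ X)
    (hf : (Set.range (mapPoints f)).Nontrivial) :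
    IsIrreducibleCurve (closure (Set.range (mapPoints f))) := by
  refine isIrreducibleCurve_of_trdeg_le_one isClosed_closure ?_ (hf.mono subset_closure) ?_
  · rw [isIrreducible_iff_closure, ← Set.image_univ]
    exact (IrreducibleSpace.isIrreducible_univ _).image _ (continuous_mapPoints f).continuousOn
  · rintro B _ _ _ _ k hk ⟨U, hU, hr⟩
    obtain ⟨A', _, _, _, _, i, l, hl, -, h⟩ := exists_injective_algHom_of_dense hk hU hr
    exact (_root_.trdeg_le_of_injective l hl).trans (h.trans_le htr)

end

/-- The closure of a nonconstant image of an irreducible curve is an irreducible curve. -/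
theorem IsIrreducibleCurve.closure_image {C : Set X.Points} (hC : IsIrreducibleCurve C) (p : X ⟶ Y)
    (hp : (mapPoints p '' C).Nontrivial) : IsIrreducibleCurve (closure (mapPoints p '' C)) := by
  obtain ⟨x, hx⟩ := hC.2.nonempty
  obtain ⟨A, _, _, _, _, k, U, hk, hU, hxU, hr⟩ := exists_chart_of_isIrreducible hC.1.1 hC.2 hx
  have hd : C ⊆ closure (Set.range (mapPoints k)) := by
    rw [hr]
    exact subset_closure_inter_of_isPreirreducible_of_isOpen hC.2.2 hU ⟨x, hx, hxU⟩
  have hkC : Set.range (mapPoints k) ⊆ C := hr ▸ Set.inter_subset_left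
  have himg : Set.range (mapPoints (k ≫ p)) = mapPoints p '' Set.range (mapPoints k) := by
    rw [mapPoints_comp', Set.range_comp]
  have hcl : closure (mapPoints p '' C) = closure (Set.range (mapPoints (k ≫ p))) := by
    rw [himg]
    refine (closure_mono (Set.image_mono hkC)).antisymm' ?_
    refine closure_minimal ((Set.image_mono hd).trans ?_) isClosed_closure
    exact image_closure_subset_closure_image (continuous_mapPoints p)
  rw [hcl]
  refine isIrreducibleCurve_closure_range
    (hC.trdeg_le_one hk.isEmbedding hkC) _ ?_
  rw [← Set.not_subsingleton_iff]
  intro hs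
  have h1 := hs.closure
  rw [← hcl] at h1
  exact Set.not_subsingleton_iff.2 hp (h1.anti subset_closure)

/-- Through a point of an irreducible closed set there is an irreducible curve in it which meets a
given nonempty open subset. -/
theorem exists_irreducibleCurve_through {W : Set X.Points} (hW : IsClosed W)
    (hW' : IsIrreducible W) {x : X.Points} (hx : x ∈ W) (hWx : W.Nontrivial) {O : Set X.Points}
    (hO : IsOpen O) (hWO : (W ∩ O).Nonempty) :
    ∃ C ⊆ W, IsIrreducibleCurve C ∧ x ∈ C ∧ (C ∩ O).Nonempty := by
  obtain ⟨A, _, _, _, _, k, U, hk, hU, hxU, hr⟩ := exists_chart_of_isIrreducible hW hW' hx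
  have hkc := continuous_mapPoints k
  have hn := nontrivial_inter_of_isIrreducible hW' hWx hU ⟨x, hx, hxU⟩
  obtain ⟨a, rfl⟩ : x ∈ Set.range (mapPoints k) := hr ▸ ⟨hx, hxU⟩
  rw [← hr] at hn
  obtain ⟨_, ⟨b, rfl⟩, hba⟩ := hn.exists_ne (mapPoints k a)
  obtain ⟨y, hy, hyO, hyU⟩ := hW'.2 O U hO hU hWO ⟨_, hx, hxU⟩
  obtain ⟨c, rfl⟩ : y ∈ Set.range (mapPoints k) := hr ▸ ⟨hy, hyU⟩
  -- Off the zeros of `f` one is inside `O`, off those of `g` one is away from `a`. A curve through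
  -- `a` on which `f * g` is not identically zero meets `O` and is not a point.
  obtain ⟨f, hf, hfO⟩ := exists_ne_zero_basicOpen_subset (hO.preimage hkc) ⟨c, hyO⟩
  obtain ⟨g, hg, hga⟩ := exists_ne_zero_basicOpen_subset (U := {a}ᶜ) isOpen_compl_singleton
    ⟨b, fun h => hba (congr_arg _ h)⟩
  obtain ⟨q, hq, hqa, hfq, htr⟩ := exists_prime_trdeg_le_one (evalPt a) (mul_ne_zero hf hg)
  obtain ⟨z, hz, hzf⟩ := exists_mem_zeros_evalPt_ne_zero q hfq
  rw [map_mul] at hzf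
  have haz : a ∈ zeros q := fun b hb => hqa hb
  have hrange : Set.range (mapPoints (affineMap (Ideal.Quotient.mkₐ ℂ q) ≫ k)) =
      mapPoints k '' zeros q := by
    rw [mapPoints_comp', Set.range_comp, range_affineMap_quotient]
  have hzO : mapPoints k z ∈ O := hfO ((mem_basicOpen _ _).2 (left_ne_zero_of_mul hzf))
  have hza : z ≠ a := hga ((mem_basicOpen _ _).2 (right_ne_zero_of_mul hzf))
  refine ⟨closure (Set.range (mapPoints (affineMap (Ideal.Quotient.mkₐ ℂ q) ≫ k))), ?_,
    isIrreducibleCurve_closure_range htr _ ?_, ?_, mapPoints k z, ?_, hzO⟩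
  · rw [hW.closure_subset_iff, hrange]
    exact (Set.image_subset_range _ _).trans (hr ▸ Set.inter_subset_left)
  · rw [hrange]
    exact ⟨_, ⟨z, hz, rfl⟩, _, ⟨a, haz, rfl⟩, fun h => hza (hk.isEmbedding.injective h)⟩
  · exact subset_closure (hrange ▸ ⟨a, haz, rfl⟩)
  · exact subset_closure (hrange ▸ ⟨z, hz, rfl⟩)

/-- An irreducible curve has a branch at each of its points. -/
theorem IsIrreducibleCurve.exists_branch {C : Set X.Points} (hC : IsIrreducibleCurve C)
    {x : X.Points} (hx : x ∈ C) : ∃ β : ℂ → X.Points, IsHolomorphicGerm β ∧ β 0 = x ∧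
      (∀ᶠ t in 𝓝 (0 : ℂ), β t ∈ C) ∧
      ∀ O : Set X.Points, IsOpen O → (C ∩ O).Nonempty → ∀ᶠ t in 𝓝[≠] (0 : ℂ), β t ∈ O := by
  obtain ⟨A, _, _, _, _, k, U, hk, hU, hxU, hr⟩ := exists_chart_of_isIrreducible hC.1.1 hC.2 hx
  have hkC : Set.range (mapPoints k) ⊆ C := hr ▸ Set.inter_subset_left
  have htr := hC.trdeg_le_one hk.isEmbedding hkC
  have hn := nontrivial_inter_of_isIrreducible hC.2 (isIrreducibleCurve_iff.1 hC).2.2.1 hU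
    ⟨x, hx, hxU⟩
  obtain ⟨a, rfl⟩ : x ∈ Set.range (mapPoints k) := hr ▸ ⟨hx, hxU⟩
  rw [← hr] at hn
  obtain ⟨_, ⟨b, rfl⟩, hba⟩ := hn.exists_ne (mapPoints k a)
  -- The chart has a second point, so the ideal of `a` is nonzero and a branch exists. Injectivity
  -- of `ψ` is what later makes the branch generic in the curve.
  obtain ⟨ψ, hψ, hψa⟩ := exists_injective_algHom htr (evalPt a) fun h => hba <| by
    refine congr_arg _ (evalPt_injective (algHom_ext_of_ker_le ?_)).symm
    rw [h]
    exact bot_le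
  obtain ⟨δ, hδ⟩ := exists_represents ψ
  refine ⟨mapPoints k ∘ δ, hδ.isHolomorphicGerm.map k, ?_,
    Eventually.of_forall fun t => hkC ⟨_, rfl⟩, fun O hO hCO => ?_⟩
  · have : δ 0 = a := evalPt_injective (by rw [hδ.evalPt_zero, hψa])
    rw [Function.comp_apply, this]
  · obtain ⟨y, hy, hyO, hyU⟩ := hC.2.2 O U hO hU hCO ⟨_, hx, hxU⟩
    obtain ⟨c, rfl⟩ : y ∈ Set.range (mapPoints k) := hr ▸ ⟨hy, hyU⟩
    obtain ⟨f, hf, hfO⟩ := exists_ne_zero_basicOpen_subset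
      (hO.preimage (continuous_mapPoints k)) ⟨c, hyO⟩
    have : ψ f ≠ 0 := fun h => hf (hψ (h.trans (map_zero _).symm))
    filter_upwards [hδ.eventually_evalPt_ne_zero this] with t ht
    exact hfO ((mem_basicOpen _ _).2 ht)

end CurveConstruction

/-! ### Curve covering and submersive morphisms. -/

section Submersive

open TopologicalSpace

variable {X Y : ComplexPrevariety}

/-- The components avoiding `w` have closed union; if they contained `F`, they would contain its
limit point `w`. -/
theorem exists_irreducibleComponent_through {F : Set X.Points} {w : X.Points}
    (hw : w ∈ closure F) : ∃ W : Set X.Points, IsClosed W ∧ IsIrreducible W ∧ w ∈ W ∧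
      (W ∩ F).Nonempty := by
  obtain ⟨S, hS, hSc, hSi, hSu⟩ :=
    NoetherianSpace.exists_finite_set_isClosed_irreducible (isClosed_univ (X := X.Points))
  by_contra! H
  have h1 : F ⊆ ⋃ T ∈ {T ∈ S | w ∉ T}, T := fun z hz => by
    obtain ⟨T, hT, hzT⟩ : z ∈ ⋃₀ S := hSu ▸ Set.mem_univ z
    refine Set.mem_biUnion (x := T) ⟨hT, fun hwT => ?_⟩ hzT
    have := H T (hSc T hT) (hSi T hT) hwT
    exact (this ▸ (⟨hzT, hz⟩ : z ∈ T ∩ F) : z ∈ (∅ : Set X.Points))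
  have h2 : IsClosed (⋃ T ∈ {T ∈ S | w ∉ T}, T) :=
    (hS.subset (Set.sep_subset _ _)).isClosed_biUnion fun T hT => hSc T hT.1
  have h3 := h2.closure_subset_iff.2 h1 hw
  simp only [Set.mem_iUnion] at h3
  obtain ⟨T, hT, hwT⟩ := h3
  exact hT.2 hwT

/-- The image in `X` of a curve which is mapped to `C` by a nonconstant map covers `C`. -/
theorem exists_covering_curve {p : X ⟶ Y} {C : Set Y.Points} (hC : IsIrreducibleCurve C)
    {y : Y.Points} {Z : ComplexPrevariety} (s : Z ⟶ X) {D : Set Z.Points}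
    (hD : IsIrreducibleCurve D) (hDC : ∀ z ∈ D, mapPoints p (mapPoints s z) ∈ C) {z₀ z₁ : Z.Points}
    (hz₀ : z₀ ∈ D) (hz₁ : z₁ ∈ D) (h₀ : mapPoints p (mapPoints s z₀) = y)
    (h₁ : mapPoints p (mapPoints s z₁) ≠ y) :
    ∃ C' : Set X.Points, IsIrreducibleCurve C' ∧
      y ∈ mapPoints p '' C' ∧ mapPoints p '' C' ⊆ C ∧ C ⊆ closure (mapPoints p '' C') := by
  have hC' : IsIrreducibleCurve (closure (mapPoints s '' D)) := hD.closure_image s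
    ⟨_, ⟨z₀, hz₀, rfl⟩, _, ⟨z₁, hz₁, rfl⟩, fun h => h₁ (by rw [← h, h₀])⟩
  have hmem : ∀ z ∈ D, mapPoints s z ∈ closure (mapPoints s '' D) := fun z hz =>
    subset_closure ⟨z, hz, rfl⟩
  have hsub : mapPoints p '' closure (mapPoints s '' D) ⊆ C := by
    refine (image_closure_subset_closure_image (continuous_mapPoints p)).trans ?_
    refine hC.1.1.closure_subset_iff.2 ?_
    rintro _ ⟨_, ⟨z, hz, rfl⟩, rfl⟩
    exact hDC z hz
  refine ⟨_, hC', ⟨_, hmem z₀ hz₀, h₀⟩, hsub, (hC.closure_eq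
    (hC'.2.image _ (continuous_mapPoints p).continuousOn) ?_ hsub).ge⟩
  exact ⟨_, ⟨_, hmem z₁ hz₁, rfl⟩, _, ⟨_, hmem z₀ hz₀, rfl⟩, fun h => h₁ (h.trans h₀)⟩

theorem submersive_universally_le_curveCovering : Submersive.universally ≤ CurveCovering := by
  intro X Y p hp C hC y hy
  obtain ⟨A, _, _, _, _, k, U, hk, hU, hyU, hr⟩ := exists_chart_of_isIrreducible hC.1.1 hC.2 hy
  have hkC : Set.range (mapPoints k) ⊆ C := hr ▸ Set.inter_subset_left
  have hn := nontrivial_inter_of_isIrreducible hC.2 (isIrreducibleCurve_iff.1 hC).2.2.1 hU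
    ⟨y, hy, hyU⟩
  obtain ⟨a, rfl⟩ : y ∈ Set.range (mapPoints k) := hr ▸ ⟨hy, hyU⟩
  rw [← hr] at hn
  obtain ⟨_, ⟨b, rfl⟩, hba⟩ := hn.exists_ne (mapPoints k a)
  obtain ⟨P, fst, snd, hP⟩ := exists_isPullback p k
  have hq : IsQuotientMap (mapPoints snd) := hp fst k snd hP.flip
  -- By the quotient topology a closed preimage would make `{a}` open, impossible in an irreducible
  -- `T1` space with a second point. Hence some `w` over `a` is a limit of points not over `a`.
  have hF : ¬ IsClosed (mapPoints snd ⁻¹' {a}ᶜ) := fun h => by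
    have h1 : IsOpen ({a} : Set (affine A).Points) := by
      simpa using (hq.isClosed_preimage.1 h).isOpen_compl
    obtain ⟨z, -, hz, hz'⟩ := (IrreducibleSpace.isIrreducible_univ (affine A).Points).2 {a} {a}ᶜ h1
      isOpen_compl_singleton ⟨a, trivial, rfl⟩ ⟨b, trivial, fun h => hba (congr_arg _ h)⟩
    exact hz' hz
  obtain ⟨w, hw, hwF⟩ := Set.not_subset.1 fun h => hF (isClosed_of_closure_subset h)
  have hwa : mapPoints snd w = a := by simpa using hwF
  obtain ⟨W, hW, hW', hwW, hWF⟩ := exists_irreducibleComponent_through hw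
  obtain ⟨v, hvW, hvF⟩ := id hWF
  obtain ⟨D, hDW, hD, hwD, z, hzD, hzF⟩ := exists_irreducibleCurve_through hW hW' hwW
    ⟨w, hwW, v, hvW, fun h => hwF (h ▸ hvF)⟩
    (isOpen_compl_singleton.preimage (continuous_mapPoints snd)) hWF
  have hcomm : ∀ z, mapPoints p (mapPoints fst z) = mapPoints k (mapPoints snd z) := fun z => by
    rw [← mapPoints_comp, hP.w, mapPoints_comp]
  refine exists_covering_curve hC fst hD (fun z _ => hcomm z ▸ hkC ⟨_, rfl⟩) hwD hzD
    (by rw [hcomm, hwa]) ?_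
  rw [hcomm]
  exact fun h => hzF (hk.isEmbedding.injective h)

/-- The image of an irreducible closed set contains a nonempty open subset of its closure. -/
theorem exists_isOpen_inter_closure_image_subset (q : X ⟶ Y) {T : Set X.Points} (hT : IsClosed T)
    (hT' : IsIrreducible T) : ∃ O : Set Y.Points, IsOpen O ∧
      (closure (mapPoints q '' T) ∩ O).Nonempty ∧
      closure (mapPoints q '' T) ∩ O ⊆ mapPoints q '' T := by
  obtain ⟨x, hx⟩ := hT'.nonempty
  obtain ⟨A, _, _, _, _, h, U', hh, hU', hxU', hr'⟩ := exists_chart_of_isIrreducible hT hT' hx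
  have hV : IsIrreducible (closure (mapPoints q '' T)) :=
    (hT'.image _ (continuous_mapPoints q).continuousOn).closure
  have hcl : closure (mapPoints q '' T) = closure (Set.range (mapPoints (h ≫ q))) := by
    rw [mapPoints_comp', Set.range_comp, hr']
    refine (closure_mono (Set.image_mono Set.inter_subset_left)).antisymm' ?_
    refine closure_minimal ((Set.image_mono ?_).trans
      (image_closure_subset_closure_image (continuous_mapPoints q))) isClosed_closure
    exact subset_closure_inter_of_isPreirreducible_of_isOpen hT'.2 hU' ⟨x, hx, hxU'⟩
  obtain ⟨B, _, _, _, _, k, U, hk, hU, hxU, hr⟩ := exists_chart_of_isIrreducible isClosed_closure hV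
    (subset_closure ⟨x, hx, rfl⟩)
  obtain ⟨A', _, _, _, _, i, l, hl, hli, -⟩ := exists_injective_algHom_of_dense (f := h ≫ q) hk hU
    (hcl ▸ hr)
  -- Over the chart the map is dominant after shrinking the source, so all points with `b ≠ 0` are
  -- images.
  obtain ⟨b, hb, hbl⟩ := exists_extension_of_injective l hl
  obtain ⟨O, hO, hOb⟩ := hk.isEmbedding.isOpen_iff.1 (isOpen_basicOpen b)
  refine ⟨U ∩ O, hU.inter hO, ?_, ?_⟩
  · obtain ⟨φ, hφ⟩ := exists_algHom_ne_zero (a := b) (by simpa using hb)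
    have h1 : ofAlgHom φ ∈ mapPoints k ⁻¹' O := by
      rwa [hOb, mem_basicOpen, evalPt_ofAlgHom]
    have h2 : mapPoints k (ofAlgHom φ) ∈ closure (mapPoints q '' T) ∩ U := hr ▸ ⟨_, rfl⟩
    exact ⟨_, h2.1, h2.2, h1⟩
  · rintro y ⟨hy, hyU, hyO⟩
    obtain ⟨c, rfl⟩ : y ∈ Set.range (mapPoints k) := hr ▸ ⟨hy, hyU⟩
    have hc : c ∈ basicOpen b := hOb ▸ hyO
    obtain ⟨ψ, hψ⟩ := hbl (evalPt c) hc
    have h1 : mapPoints k c = mapPoints q (mapPoints h (mapPoints (affineMap i) (ofAlgHom ψ))) := by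
      rw [← mapPoints_comp, ← mapPoints_comp, ← hli, mapPoints_comp, mapPoints_affineMap, hψ,
        ofAlgHom_evalPt]
    rw [h1]
    refine ⟨_, ?_, rfl⟩
    have h2 : mapPoints h (mapPoints (affineMap i) (ofAlgHom ψ)) ∈ T ∩ U' := hr' ▸ ⟨_, rfl⟩
    exact h2.1

/-- Closedness of `F` is tested along curves: a curve through a limit point `y`, generic in the
closure of the image of a component of the preimage, is covered by a curve trapped in that closed
preimage. -/
theorem CurveCovering.submersive {q : X ⟶ Y} (hq : CurveCovering q)
    (hs : Function.Surjective (mapPoints q)) : Submersive q := by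
  refine isQuotientMap_iff_isClosed.2 ⟨hs, fun F => ⟨fun h => h.preimage (continuous_mapPoints q),
    fun hF => ?_⟩⟩
  obtain ⟨S, hS, hSc, hSi, hSu⟩ := NoetherianSpace.exists_finite_set_isClosed_irreducible hF
  have hFS : F = ⋃ T ∈ S, mapPoints q '' T := by
    rw [← Set.image_preimage_eq F hs, hSu, Set.sUnion_eq_biUnion, Set.image_iUnion₂]
  refine isClosed_of_closure_subset fun y hy => ?_
  rw [hFS, hS.closure_biUnion] at hy
  simp only [Set.mem_iUnion] at hy
  obtain ⟨T, hT, hyT⟩ := hy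
  have hTF : mapPoints q '' T ⊆ F := by
    rw [hFS]
    exact Set.subset_biUnion_of_mem (u := fun T => mapPoints q '' T) hT
  obtain ⟨O, hO, hne, hOT⟩ := exists_isOpen_inter_closure_image_subset q (hSc T hT) (hSi T hT)
  have hV : IsIrreducible (closure (mapPoints q '' T)) :=
    ((hSi T hT).image _ (continuous_mapPoints q).continuousOn).closure
  -- If the closure is a single point there is no curve to use, but then `y` is that point and lies
  -- in the image.
  rcases Set.subsingleton_or_nontrivial (closure (mapPoints q '' T)) with h1 | h1
  · obtain ⟨z, hz⟩ := hne
    rw [h1 hyT hz.1]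
    exact hTF (hOT hz)
  · obtain ⟨C, hCV, hC, hyC, hCO⟩ := exists_irreducibleCurve_through isClosed_closure hV hyT h1 hO hne
    obtain ⟨C', hC', ⟨x, hx, rfl⟩, hqC, hd⟩ := hq C hC y hyC
    obtain ⟨c, hcC, hcO⟩ := hCO
    obtain ⟨_, hzO, z, hz, rfl⟩ := mem_closure_iff.1 (hd hcC) O hO hcO
    have h2 : C' ∩ mapPoints q ⁻¹' O ⊆ mapPoints q ⁻¹' F := fun w hw =>
      hTF (hOT ⟨hCV (hqC ⟨w, hw.1, rfl⟩), hw.2⟩)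
    exact hF.closure_subset_iff.2 h2 (subset_closure_inter_of_isPreirreducible_of_isOpen hC'.2.2
      (hO.preimage (continuous_mapPoints q)) ⟨z, hz, hzO⟩ hx)

theorem surjective_of_isPullback {P Z : ComplexPrevariety} {fst : P ⟶ X} {snd : P ⟶ Z} {p : X ⟶ Y}
    {g : Z ⟶ Y} (h : IsPullback fst snd p g) (hp : Function.Surjective (mapPoints p)) :
    Function.Surjective (mapPoints snd) := fun z => by
  obtain ⟨x, hx⟩ := hp (mapPoints g z)
  obtain ⟨w, -, hw⟩ := exists_mapPoints_of_isPullback h hx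
  exact ⟨w, hw⟩

end Submersive

/-! ### Curve covering and weakly proper morphisms. -/

section WeaklyProper

open HolGerm

variable {X Y : ComplexPrevariety}

theorem affineMap_id {A : Type} [CommRing A] [Algebra ℂ A] [Algebra.FiniteType ℂ A]
    [_root_.IsReduced A] : affineMap (AlgHom.id ℂ A) = 𝟙 (affine A) := by
  apply ObjectProperty.hom_ext
  apply Over.OverMorphism.ext
  exact Spec.map_id _

theorem Represents.algHom_eq {A : Type} [CommRing A] [Algebra ℂ A] [Algebra.FiniteType ℂ A]
    [_root_.IsReduced A] {φ φ' : A →ₐ[ℂ] HolGerm} {δ δ' : ℂ → (affine A).Points}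
    (h : Represents φ δ) (h' : Represents φ' δ') (hδ : ∀ᶠ t in 𝓝 (0 : ℂ), δ t = δ' t) : φ = φ' := by
  ext a
  rw [← mk_rep (φ a), ← mk_rep (φ' a), mk_eq_mk]
  filter_upwards [h a, h' a, hδ] with t h1 h2 h3
  rw [← h1, ← h2, h3]

/-- An irreducible curve through the base point is covered as soon as one of its branches lifts,
after reparametrization. -/
theorem exists_covering_curve_of_germ {p : X ⟶ Y} {X' Y' : ComplexPrevariety} {p' : X' ⟶ Y'}
    {i₁ : X' ⟶ X} {i₂ : Y' ⟶ Y} (hP : IsPullback p' i₁ i₂ p) {C : Set Y'.Points}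
    (hC : IsIrreducibleCurve C) {β : ℂ → Y'.Points} (hβ : IsHolomorphicGerm β)
    (hβC : ∀ᶠ t in 𝓝 (0 : ℂ), β t ∈ C) (hβ0 : ∀ᶠ t in 𝓝[≠] (0 : ℂ), β t ≠ β 0)
    {γ : ℂ → X.Points} (hγ : IsHolomorphicGerm γ) {α : ℂ → ℂ} (hα : AnalyticAt ℂ α 0)
    (hα0 : α 0 = 0) (hαn : ¬ ∀ᶠ t in 𝓝 (0 : ℂ), α t = 0)
    (hpγ : ∀ᶠ t in 𝓝 (0 : ℂ), mapPoints p (γ t) = mapPoints i₂ (β (α t))) :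
    ∃ C' : Set X'.Points, IsIrreducibleCurve C' ∧
      β 0 ∈ mapPoints p' '' C' ∧ mapPoints p' '' C' ⊆ C ∧ C ⊆ closure (mapPoints p' '' C') := by
  have hy : mapPoints p (γ 0) = mapPoints i₂ (β 0) := by
    have := hpγ.self_of_nhds
    rwa [hα0] at this
  -- An affine chart of `Y` around the common image point turns the germ identity in `Y` into the
  -- equality `hm` of algebra maps.
  obtain ⟨E, _, _, _, _, j, hj, hjy, -⟩ := exists_chart (x := mapPoints i₂ (β 0)) (U := ⊤) trivial
  have hjc : IsAffineChart j :=
    ⟨E, _, _, _, _, j, AlgHom.id ℂ E, hj, Function.surjective_id, by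
      rw [affineMap_id, Category.id_comp]⟩
  have hO : (mapPoints i₂ (β 0)).pt ∈ j.hom.left.opensRange := by
    rwa [range_mapPoints_of_isOpenImmersion] at hjy
  have hlift : ∀ {T : Type} [CommRing T] [Algebra ℂ T] [Algebra.FiniteType ℂ T] [_root_.IsReduced T]
      (f : affine T ⟶ Y), (∀ x, (mapPoints f x).pt ∈ j.hom.left.opensRange) →
      ∃ l : E →ₐ[ℂ] T, affineMap l ≫ j = f := fun f hf => hjc.exists_lift f <| by
    rintro _ ⟨x, rfl⟩
    rw [range_mapPoints_of_isOpenImmersion]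
    exact hf x
  obtain ⟨A, _, _, _, _, k, U, φ, δ, hk, hU, hβU, hr, hkO, hφ, hδ⟩ :=
    hβ.exists_chart hC.1.1 hC.2 hβC (O := i₂.hom.left ⁻¹ᵁ j.hom.left.opensRange) (by
      rw [pt_mapPoints] at hO
      exact hO)
  obtain ⟨m₂, hm₂⟩ := hlift (k ≫ i₂) fun x => by
    rw [mapPoints_comp, pt_mapPoints]
    exact hkO x
  obtain ⟨B, _, _, _, _, h, hh, hγ0, hhO⟩ := exists_chart (x := γ 0)
    (U := p.hom.left ⁻¹ᵁ j.hom.left.opensRange) (by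
      rw [← hy, pt_mapPoints] at hO
      exact hO)
  obtain ⟨m₁, hm₁⟩ := hlift (h ≫ p) fun x => by
    rw [mapPoints_comp, pt_mapPoints]
    refine hhO ?_
    rw [pt_mapPoints]
    exact ⟨_, rfl⟩
  obtain ⟨ψ, ε, hψ, hε⟩ := hγ.exists_represents h hγ0
  let φ' : A →ₐ[ℂ] HolGerm := (comp α hα hα0).comp φ
  have hφ' : Represents φ' (δ ∘ α) := hφ.comp_analytic hα hα0
  have hδα : ∀ᶠ t in 𝓝 (0 : ℂ), mapPoints k (δ (α t)) = β (α t) :=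
    (tendsto_of_analyticAt hα hα0).eventually hδ
  have hm : ψ.comp m₁ = φ'.comp m₂ := by
    refine (hψ.comp_algHom m₁).algHom_eq (hφ'.comp_algHom m₂) ?_
    filter_upwards [hε, hδα, hpγ] with t h1 h2 h3
    refine mapPoints_injective_of_isOpenImmersion j ?_
    simp only [Function.comp_apply]
    rw [← mapPoints_comp, ← mapPoints_comp, hm₁, hm₂, mapPoints_comp, mapPoints_comp, h1, h2, h3]
  -- The coordinate ring of the Zariski closure of the pair of germs: a finitely generated domain.
  -- The agreement `hm` over `E` yields a morphism `s` from it to the fibre product.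
  let T : Subalgebra ℂ HolGerm := ψ.range ⊔ φ'.range
  have hT : Algebra.FiniteType ℂ T := by
    rw [← Subalgebra.fg_iff_finiteType]
    refine Subalgebra.FG.sup ?_ ?_ <;>
    · rw [← Algebra.map_top]
      exact Subalgebra.FG.map _ Algebra.FiniteType.out
  let u : B →ₐ[ℂ] T := ψ.codRestrict T fun b => le_sup_left (a := ψ.range) ⟨b, rfl⟩
  let v : A →ₐ[ℂ] T := φ'.codRestrict T fun a => le_sup_right (a := ψ.range) ⟨a, rfl⟩
  have huv : (affineMap v ≫ k) ≫ i₂ = (affineMap u ≫ h) ≫ p := by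
    rw [Category.assoc, Category.assoc, ← hm₁, ← hm₂, ← Category.assoc, ← Category.assoc,
      ← affineMap_comp, ← affineMap_comp]
    congr 2
    ext e
    exact congr_arg Subtype.val (Subtype.ext congr($hm.symm e) : v (m₂ e) = u (m₁ e))
  let s : affine T ⟶ X' := hP.lift (affineMap v ≫ k) (affineMap u ≫ h) huv
  have hs : ∀ z, mapPoints p' (mapPoints s z) = mapPoints k (mapPoints (affineMap v) z) := fun z => by
    rw [← mapPoints_comp, hP.lift_fst, mapPoints_comp]
  obtain ⟨θ, hθ⟩ := exists_represents T.val
  have hθv : ∀ᶠ t in 𝓝 (0 : ℂ), mapPoints (affineMap v) (θ t) = δ (α t) :=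
    (hθ.comp_algHom v).eventually_eq hφ'
  have hα' : ∀ᶠ t in 𝓝[≠] (0 : ℂ), α t ≠ 0 :=
    hα.eventually_eq_zero_or_eventually_ne_zero.resolve_left hαn
  have hα'' : Tendsto α (𝓝[≠] 0) (𝓝[≠] 0) := tendsto_nhdsWithin_iff.2
    ⟨(tendsto_of_analyticAt hα hα0).mono_left nhdsWithin_le_nhds, hα'⟩
  -- Since `α` is non-constant, some `θ t` maps to a point of `C` other than `β 0`; hence a curve
  -- through `θ 0` can be chosen outside the fibre over `β 0`.
  obtain ⟨t, ht1, ht2, ht3⟩ := ((hα''.eventually hβ0).and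
    ((hθv.and hδα).filter_mono nhdsWithin_le_nhds)).exists
  have h0 : mapPoints p' (mapPoints s (θ 0)) = β 0 := by
    rw [hs, hθv.self_of_nhds, hδα.self_of_nhds, hα0]
  have ht : mapPoints p' (mapPoints s (θ t)) ≠ β 0 := by
    rwa [hs, ht2, ht3]
  obtain ⟨D, -, hD, hD0, z, hzD, hz⟩ := exists_irreducibleCurve_through isClosed_univ
    (IrreducibleSpace.isIrreducible_univ (affine T).Points) (Set.mem_univ (θ 0))
    ⟨_, trivial, θ t, trivial, fun h => ht (h ▸ h0)⟩
    (O := (fun z => mapPoints p' (mapPoints s z)) ⁻¹' {β 0}ᶜ)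
    (isOpen_compl_singleton.preimage ((continuous_mapPoints p').comp (continuous_mapPoints s)))
    ⟨θ t, trivial, ht⟩
  refine exists_covering_curve hC s hD (fun z _ => ?_) hD0 hzD h0 hz
  have : mapPoints k (mapPoints (affineMap v) z) ∈ C ∩ U := hr ▸ ⟨_, rfl⟩
  rw [hs]
  exact this.1

/-- Only the image of the branch in `Y` needs lifting. If the curve maps to a point, that image is
constant and a point of the fibre of `p` serves; otherwise the closure of the image is a curve, as
the definition of a local curve demands. -/
theorem WeaklyProper.curveCovering_universally {p : X ⟶ Y} (hp : WeaklyProper p)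
    (hs : Function.Surjective (mapPoints p)) : CurveCovering.universally p := by
  intro X' Y' i₁ i₂ p' hP C hC y hy
  obtain ⟨β, hβ, rfl, hβC, hβO⟩ := hC.exists_branch hy
  have hβ0 : ∀ᶠ t in 𝓝[≠] (0 : ℂ), β t ≠ β 0 := by
    obtain ⟨z, hz, hz0⟩ := (isIrreducibleCurve_iff.1 hC).2.2.1.exists_ne (β 0)
    exact hβO {β 0}ᶜ isOpen_compl_singleton ⟨z, hz, hz0⟩
  rcases Set.subsingleton_or_nontrivial (mapPoints i₂ '' C) with h | h
  · obtain ⟨x, hx⟩ := hs (mapPoints i₂ (β 0))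
    refine exists_covering_curve_of_germ hP hC hβ hβC hβ0 (isHolomorphicGerm_const x) analyticAt_id
      rfl (fun h => ?_) (hβC.mono fun t ht => ?_)
    · obtain ⟨t, h1, h2⟩ := ((h.filter_mono nhdsWithin_le_nhds).and
        (self_mem_nhdsWithin : ({0}ᶜ : Set ℂ) ∈ 𝓝[≠] (0 : ℂ))).exists
      exact h2 h1
    · rw [hx]
      exact h ⟨_, hy, rfl⟩ ⟨_, ht, rfl⟩
  · obtain ⟨D, γ, ⟨-, hγ, -⟩, -, α, hα, hα0, hαn, H⟩ := hp (closure (mapPoints i₂ '' C))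
      (mapPoints i₂ ∘ β) ⟨(hC.closure_image i₂ h).1, hβ.map i₂,
        hβC.mono fun t ht => subset_closure ⟨_, ht, rfl⟩⟩
    exact exists_covering_curve_of_germ hP hC hβ hβC hβ0 hγ hα hα0 hαn H

theorem exists_weakLifting_const {p : X ⟶ Y} (hp : CurveCovering p) {C : Set Y.Points}
    (hC : IsIrreducibleCurve C) {γ : ℂ → Y.Points} (hγC : γ 0 ∈ C)
    (hγ : ∀ᶠ t in 𝓝 (0 : ℂ), γ t = γ 0) :
    ∃ (C' : Set X.Points) (γ' : ℂ → X.Points), IsLocalCurve C' γ' ∧ IsWeakLifting p C' γ' C γ := by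
  obtain ⟨C', hC', ⟨x, hx, hxy⟩, hpC, -⟩ := hp C hC _ hγC
  refine ⟨C', fun _ => x, ⟨hC'.1, isHolomorphicGerm_const x, Eventually.of_forall fun _ => hx⟩,
    eventually_mem_nhdsWithin.mono fun z hz => hpC ⟨z, hz, rfl⟩, id, analyticAt_id, rfl,
    fun h => ?_, hγ.mono fun t ht => hxy.trans ht.symm⟩
  obtain ⟨t, h1, h2⟩ := ((h.filter_mono nhdsWithin_le_nhds).and
    (self_mem_nhdsWithin : ({0}ᶜ : Set ℂ) ∈ 𝓝[≠] (0 : ℂ))).exists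
  exact h2 h1

/-- The weak lifting of a germ which is given by an injective map from the coordinate ring of an
affine curve. -/
theorem exists_weakLifting_of_injective {p : X ⟶ Y} (hp : CurveCovering.universally p)
    {C : Set Y.Points} (hC : IsClosed C) {γ : ℂ → Y.Points}
    {A : Type} [CommRing A] [Algebra ℂ A] [Algebra.FiniteType ℂ A] [IsDomain A]
    (htr : Algebra.trdeg ℂ A ≤ 1) {k : affine A ⟶ Y} (hk : Function.Injective (mapPoints k))
    (hkC : Set.range (mapPoints k) ⊆ C) {φ : A →ₐ[ℂ] HolGerm} {δ : ℂ → (affine A).Points}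
    (hφ : Represents φ δ) (hδ : ∀ᶠ t in 𝓝 (0 : ℂ), mapPoints k (δ t) = γ t)
    (hinj : Function.Injective φ) {a : A} (ha : a ≠ 0) (ha0 : eval0 (φ a) = 0) :
    ∃ (C' : Set X.Points) (γ' : ℂ → X.Points), IsLocalCurve C' γ' ∧ IsWeakLifting p C' γ' C γ := by
  obtain ⟨B, _, _, _, _, ι, Χ, π, htrB, hΧ, hΧι, hπ0, hπ⟩ := exists_smooth_model_germ htr φ hinj ha ha0
  have hΧπ : Χ π ≠ 0 := fun h => hπ0 (hΧ (h.trans (map_zero _).symm))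
  have hιa : ι a ≠ 0 := fun h => ha (hinj (by rw [← hΧι, AlgHom.comp_apply, h, map_zero, map_zero]))
  obtain ⟨P, fst, snd, hP⟩ := exists_isPullback p (affineMap ι ≫ k)
  have hw : ∀ z, mapPoints p (mapPoints fst z) =
      mapPoints k (mapPoints (affineMap ι) (mapPoints snd z)) := fun z => by
    rw [← mapPoints_comp, hP.w, mapPoints_comp, mapPoints_comp]
  let z₀ : (affine B).Points := ofAlgHom (eval0.comp Χ)
  have hz₀π : evalPt z₀ π = 0 := by
    rw [evalPt_ofAlgHom]
    exact hπ.1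
  -- The smooth model is itself an irreducible curve, having points where `π` vanishes and where it
  -- does not; so curve covering applies to it after base change.
  have hZ : IsIrreducibleCurve (Set.univ : Set (affine B).Points) := by
    have h1 : Set.range (mapPoints (𝟙 (affine B))) = Set.univ :=
      Set.range_eq_univ.2 fun x => ⟨x, mapPoints_id x⟩
    have h2 := isIrreducibleCurve_closure_range htrB (𝟙 (affine B)) (by
      obtain ⟨χ, hχ⟩ := exists_algHom_ne_zero (a := π) (by simpa using hπ0)
      rw [h1]
      refine ⟨z₀, trivial, ofAlgHom χ, trivial, fun h => hχ ?_⟩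
      rw [← evalPt_ofAlgHom χ, ← h, hz₀π])
    rwa [h1, closure_univ] at h2
  obtain ⟨D, hD, ⟨w, hwD, hwz⟩, -, hDd⟩ := hp fst _ snd hP.flip _ hZ z₀ trivial
  have hmeet : ∀ b : B, b ≠ 0 → ∃ z ∈ D, evalPt (mapPoints snd z) b ≠ 0 := fun b hb => by
    obtain ⟨χ, hχ⟩ := exists_algHom_ne_zero (a := b) (by simpa using hb)
    obtain ⟨_, hz, z, hzD, rfl⟩ := mem_closure_iff.1 (hDd (Set.mem_univ (ofAlgHom χ))) _
      (isOpen_basicOpen b) (by rwa [mem_basicOpen, evalPt_ofAlgHom])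
    exact ⟨z, hzD, hz⟩
  obtain ⟨β, hβ, rfl, hβD, hβO⟩ := hD.exists_branch hwD
  have : IsOpenImmersion (𝟙 (affine B) : affine B ⟶ affine B).hom.left :=
    inferInstanceAs (IsOpenImmersion (𝟙 (affine B).obj.left))
  obtain ⟨χ, ε, hχ, hε⟩ := (hβ.map snd).exists_represents (𝟙 (affine B)) ⟨_, mapPoints_id _⟩
  simp only [mapPoints_id, Function.comp_apply] at hε
  have hχ0 : eval0.comp χ = eval0.comp Χ := by
    rw [← hχ.evalPt_zero, hε.self_of_nhds, hwz, evalPt_ofAlgHom]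
  -- `D` dominates the smooth model, so its branch leaves the zero set of `π`; without this the two
  -- values of `π` could not be matched.
  have hχπ : χ π ≠ 0 := fun h => by
    obtain ⟨z, hzD, hz⟩ := hmeet π hπ0
    have h1 := hβO (mapPoints snd ⁻¹' basicOpen π)
      ((isOpen_basicOpen π).preimage (continuous_mapPoints snd)) ⟨z, hzD, hz⟩
    rw [← mk_rep (χ π), mk_eq_zero] at h
    obtain ⟨t, h2, h3, h4, h5⟩ := (h1.and
      ((h.and ((hχ π).and hε)).filter_mono nhdsWithin_le_nhds)).exists
    rw [Set.mem_preimage, mem_basicOpen, ← h5, h4] at h2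
    exact h2 h3
  obtain ⟨α, η, hα, hα0, hη, hη0, hαn, -, hαη, -⟩ := exists_comp_eq_comp hΧπ hπ.1 hχπ
    (by rw [← AlgHom.comp_apply, hχ0]; exact hπ.1)
  -- Both germs are centred at the same smooth point and, after the substitutions, agree on the
  -- uniformizer; hence they are equal.
  have hΨ : (comp α hα hα0).comp Χ = (comp η hη hη0).comp χ := by
    refine hπ.algHom_ext ?_ ?_ hαη
    · ext b
      simp [eval0_comp]
    · rw [← hχ0]
      ext b
      simp [eval0_comp]
  have hcomp : ∀ᶠ t in 𝓝 (0 : ℂ), mapPoints (affineMap ι) (ε (η t)) = δ (α t) := by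
    have h1 := (hχ.comp_analytic hη hη0).comp_algHom ι
    rw [← hΨ, AlgHom.comp_assoc, hΧι] at h1
    exact h1.eventually_eq (hφ.comp_analytic hα hα0)
  have hη' := tendsto_of_analyticAt hη hη0
  have hD' : IsIrreducibleCurve (closure (mapPoints fst '' D)) := by
    -- The projection of `D` to `X` is not a point: `ι a` vanishes over `z₀` but not everywhere on
    -- `D`, and this is seen in `Y` because `k` is injective.
    obtain ⟨z, hzD, hz⟩ := hmeet (ι a) hιa
    refine hD.closure_image fst ⟨_, ⟨z, hzD, rfl⟩, _, ⟨_, hwD, rfl⟩, fun h => hz ?_⟩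
    have h1 := congr_arg (mapPoints p) h
    rw [hw, hw] at h1
    have h2 := congr_arg (fun y => evalPt y a) (hk h1)
    simp only [evalPt_mapPoints, hwz, AlgHom.comp_apply] at h2
    rw [h2, evalPt_ofAlgHom, AlgHom.comp_apply, ← AlgHom.comp_apply Χ, hΧι, ha0]
  have hpC : mapPoints p '' closure (mapPoints fst '' D) ⊆ C := by
    refine (image_closure_subset_closure_image (continuous_mapPoints p)).trans ?_
    refine hC.closure_subset_iff.2 ?_
    rintro _ ⟨_, ⟨z, -, rfl⟩, rfl⟩
    rw [hw]
    exact hkC ⟨_, rfl⟩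
  refine ⟨_, mapPoints fst ∘ β ∘ η, ⟨hD'.1, (hβ.comp_analytic hη hη0).map fst,
    (hη'.eventually hβD).mono fun t ht => subset_closure ⟨_, ht, rfl⟩⟩,
    eventually_mem_nhdsWithin.mono fun z hz => hpC ⟨z, hz, rfl⟩, α, hα, hα0, hαn, ?_⟩
  filter_upwards [hcomp, hη'.eventually hε, (tendsto_of_analyticAt hα hα0).eventually hδ]
    with t h1 h2 h3
  simp only [Function.comp_apply]
  rw [hw, ← h2, h1, h3]

/-- On a curve a germ is constant or generic. The kernel of `φ` is prime; if nonzero it is maximal,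
hence equal to the ideal of the base point, and then the germ is constant. -/
theorem exists_weakLifting {p : X ⟶ Y} (hp : CurveCovering.universally p) {C : Set Y.Points}
    (hC : IsIrreducibleCurve C) {γ : ℂ → Y.Points} (hγ : IsHolomorphicGerm γ)
    (hγC : ∀ᶠ t in 𝓝 (0 : ℂ), γ t ∈ C) :
    ∃ (C' : Set X.Points) (γ' : ℂ → X.Points), IsLocalCurve C' γ' ∧ IsWeakLifting p C' γ' C γ := by
  obtain ⟨A, _, _, _, _, k, U, φ, δ, hk, hU, hγU, hr, -, hφ, hδ⟩ :=
    hγ.exists_chart hC.1.1 hC.2 hγC (O := ⊤) trivial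
  have hkC : Set.range (mapPoints k) ⊆ C := hr ▸ Set.inter_subset_left
  have htr := hC.trdeg_le_one hk.isEmbedding hkC
  by_cases hconst : RingHom.ker (eval0.comp φ) ≤ RingHom.ker φ
  · refine exists_weakLifting_const (MorphismProperty.universally_le _ _ hp) hC hγC.self_of_nhds ?_
    -- Each `a` differs from its value at the base point by an element killed by `φ`, so every
    -- coordinate germ is constant.
    have h1 : Represents φ fun _ => δ 0 := fun a => by
      have h2 : φ (a - algebraMap ℂ A (eval0 (φ a))) = 0 := hconst (by simp [RingHom.mem_ker])
      rw [map_sub, sub_eq_zero, AlgHom.commutes] at h2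
      simp only [hφ.evalPt_zero, AlgHom.comp_apply]
      generalize eval0 (φ a) = c at h2 ⊢
      rw [h2]
      exact (rep_algebraMap c).mono fun t ht => ht.symm
    filter_upwards [hφ.eventually_eq h1, hδ] with t h2 h3
    rw [← h3, h2, hδ.self_of_nhds]
  · obtain ⟨a, ha, ha'⟩ := SetLike.not_le_iff_exists.1 hconst
    refine exists_weakLifting_of_injective hp hC.1.1 htr hk.isEmbedding.injective hkC hφ hδ
      ((injective_iff_map_eq_zero φ).2 fun b hb => ?_) (a := a) (fun h => ha' ?_) ha
    · by_contra hb0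
      have := RingHom.ker_isPrime φ
      have hm := isMaximal_of_trdeg_le_one htr (RingHom.ker φ) fun h => hb0 <| by
        rw [← Ideal.mem_bot, ← h]
        exact hb
      have hle : RingHom.ker φ ≤ RingHom.ker (eval0.comp φ) := fun c hc => by
        rw [RingHom.mem_ker] at hc ⊢
        rw [AlgHom.comp_apply, hc, map_zero]
      exact hconst (hm.eq_of_le (RingHom.ker_ne_top _) hle).ge
    · rw [h]
      exact zero_mem _

theorem CurveCovering.weaklyProper {p : X ⟶ Y} (hp : CurveCovering.universally p) :
    WeaklyProper p := by
  intro C γ hγ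
  obtain ⟨C₁, hC₁C, hC₁, hγC₁⟩ := hγ.2.1.exists_irreducibleCurve hγ.1 hγ.2.2
  obtain ⟨C', γ', h1, h2, h3⟩ := exists_weakLifting hp hC₁ hγ.2.1 hγC₁
  exact ⟨C', γ', h1, h2.mono fun x hx => hC₁C hx, h3⟩

end WeaklyProper

end ComplexPrevariety

end

open ComplexPrevariety in
theorem mainTheorem7 {X Y : ComplexPrevariety} (p : X ⟶ Y)
    (hp : Function.Surjective (mapPoints p)) :
    List.TFAE [WeaklyProper p, CurveCovering.universally p, Submersive.universally p] := by
  tfae_have 1 → 2 := fun h => h.curveCovering_universally hp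
  tfae_have 2 → 1 := CurveCovering.weaklyProper
  tfae_have 2 → 3 := fun h X' Y' i₁ i₂ p' hP =>
    (h i₁ i₂ p' hP).submersive (surjective_of_isPullback hP.flip hp)
  -- A base change of a universally submersive morphism is again one, so covering curves in the
  -- target of each base change suffices.
  tfae_have 3 → 2 := fun h X' Y' i₁ i₂ p' hP =>
    submersive_universally_le_curveCovering _
      (MorphismProperty.IsStableUnderBaseChange.of_isPullback hP.flip h)
  tfae_finish
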